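/- **Setting (Ghatak–Sherrington model).** Fix an integer $\mathcal S\ge 1$. For $\sigma\in\{0,\pm1,\dots,\pm\mathcal S\}^N$ let $$H_N(\sigma)=\frac{\beta}{\sqrt N}\sum_{i<j}g_{i,j}\sigma_i\sigma_j+\mathcal D\sum_{i}\sigma_i^2+h\sum_i\sigma_i,$$ with $g_{i,j}$ i.i.d. $\mathcal N(0,1)$. Let $\langle\cdot\rangle$ be the average over independent replicas $\sigma^1,\sigma^2,\dots$ drawn from the Gibbs measure $\propto e^{H_N}$, and $\nu(\cdot)=\mathbb E\langle\cdot\rangle$. For $p,q\in\mathbb R$ let $\nu_0$ denote the following average over the last spins $\epsilon_1,\epsilon_2,\dots$ of the replicas: given $\eta\sim\mathcal N(0,1)$ they are independent on $\{0,\pm1,\dots,\pm\mathcal S\}$ with weights $\propto\exp\big(\beta\eta\sqrt q\,\epsilon+\tfrac{\beta^2}{2}(p-q)\epsilon^2+\mathcal D\epsilon^2+h\epsilon\big)$, and then $\eta$ is averaged. The numbers $p,q$ are the solution of $p=\nu_0(\epsilon_1^2)$, $q=\nu_0(\epsilon_1\epsilon_2)$. With $b_i=\langle\sigma_i\rangle$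 and $\tilde b_i=\langle\sigma_i^2\rangle$, the basis variables of $n$ replicas are $$T_{k,l}=\frac1N\sum_i(\sigma_i^k-b_i)(\sigma_i^l-b_i),\quad T_k=\frac1N\sum_i(\sigma_i^k-b_i)b_i,\quad S_k=\frac1N\sum_i\big((\sigma_i^k)^2-\tilde b_i\big),$$ $$T=\frac1N\sum_ib_i^2-q,\qquad S=\frac1N\sum_i\tilde b_i-p .$$ **Constants.** Let $A=\nu_0((\epsilon_1-\epsilon_3)(\epsilon_2-\epsilon_4)\epsilon_1\epsilon_2)$, $D=\nu_0((\epsilon_1^2-\epsilon_2^2)\epsilon_1^2)$, $E=\nu_0((\epsilon_1^2-\epsilon_2^2)\epsilon_1\epsilon_3)$, $F=\nu_0((\epsilon_1\epsilon_3-\epsilon_2\epsilon_3)\epsilon_1\epsilon_3)$, $G=\nu_0((\epsilon_1\epsilon_3-\epsilon_2\epsilon_3)\epsilon_1\epsilon_4)$, $I_3=\nu_0((\epsilon_1\epsilon_2-q)\epsilon_3\epsilon_4)$, $I_5=\nu_0((\epsilon_1\epsilon_2-q)\epsilon_3^2)$, $K_3=\nu_0((\epsilon_1^2-p)\epsilon_2\epsilon_3)$,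 $K_4=\nu_0((\epsilon_1^2-p)\epsilon_2^2)$, $M_1=1-\beta^2(F-3G)$, $M_2=1-\tfrac{\beta^2}2D$, $M_3=1-\beta^2(F-G)$, $M=M_1M_2+\beta^4E^2$, and $$A_2^2=\frac{A}{N(1-\beta^2A)},\quad A_1^2=\frac{GM_2+\frac{\beta^2}{2}E^2}{M}\cdot\frac1{NM_3},\quad B_1^2=\frac{DM_1-2\beta^2E^2}{NM},\quad C_1^2=\frac{E}{NM},$$ $$\begin{aligned}A_0^2={}&\tfrac{\beta^2}{M}(\beta^2EK_4+M_2I_5)C_1^2+\tfrac{2\beta^2}{M}\big(\beta^2E(E-K_3)+M_2(2G-I_3)\big)A_1^2\\&+\tfrac{\beta^2}{M}(\beta^2EK_3+M_2I_3)A_2^2+\tfrac1{MN}(\beta^2EK_3+M_2I_3),\end{aligned}$$ $$\begin{aligned}B_0^2={}&\tfrac{\beta^2}{2M}(M_1K_4-\beta^2EI_5)B_1^2+\tfrac{\beta^2}{M}\big(M_1(E-K_3)-\beta^2E(2G-I_3)\big)C_1^2\\&+\tfrac1{MN}(M_1K_4-\beta^2EI_5),\end{aligned}$$ $$\begin{aligned}C_0^2={}&\tfrac{\beta^2}{2M}(M_2I_5+\beta^2EK_4)B_1^2+\tfrac{\beta^2}{M}\big(M_2(2G-I_3)+\beta^2E(E-K_3)\big)C_1^2\\&+\tfrac1{MN}(M_2I_5+\beta^2EK_4).\end{aligned}$$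 (The symbols $C_1^2$, $C_0^2$ denote real numbers, not necessarily nonnegative.) **Statement.** For every integer $\mathcal S\ge1$ there is $\beta'>0$ such that for all $0\le\beta<\beta'$, $h\ge0$ and $\mathcal D\in\mathbb R$: the equations for $(p,q)$ have a unique solution, $M_3>0$ and $M>0$, and for this $(p,q)$ and every $n\ge0$ the following holds. 1. For every $N\ge1$ there is a centered Gaussian vector $(g_X)$, indexed by $X\in\{T_{k,l},T_k,S_k,T,S:\ 1\le k<l\le n \text{ resp. } 1\le k\le n\}$, in which the $g_{T_{k,l}}$ have variance $A_2^2$, each pair $(g_{T_k},g_{S_k})$ has covariance matrix $\begin{bmatrix}A_1^2&C_1^2\\C_1^2&B_1^2\end{bmatrix}$, the pair $(g_T,g_S)$ has covariance matrix $\begin{bmatrix}A_0^2&C_0^2\\C_0^2&B_0^2\end{bmatrix}$, and all other covariances vanish (so the $g_{T_{k,l}}$, the pairs $(g_{T_k},g_{S_k})$ and the pair $(g_T,g_S)$ are independent). 2. For all nonnegative integers $h(k,l)$ $(1\le k<l\le n)$, $h(k),h'(k)$ $(1\le k\le n)$, $h_T$, $h_S$, with $H=\sum_{k<l}h(k,l)+\sum_kh(k)+\sum_kh'(k)+h_T+h_S$,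 there is a constant $K$ independent of $N$ such that for all $N\ge1$ $$\Big|\nu\Big(\prod_{k<l}T_{k,l}^{h(k,l)}\prod_kT_k^{h(k)}\prod_kS_k^{h'(k)}\,T^{h_T}S^{h_S}\Big)-\mathbb E\Big[\prod_{k<l}g_{T_{k,l}}^{h(k,l)}\prod_kg_{T_k}^{h(k)}\prod_kg_{S_k}^{h'(k)}\,g_T^{h_T}g_S^{h_S}\Big]\Big|\le K\,N^{-(H+1)/2}.$$ -/

import Mathlib

open MeasureTheory ProbabilityTheory
open scoped BigOperators

noncomputable section

namespace GhatakSherrington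

/-- Parameters of the Ghatak-Sherrington model: largest spin value `S`, inverse temperature `β`,
external field `h`, crystal field `D`. -/
structure Params where
  S : ℕ
  β : ℝ
  h : ℝ
  D : ℝ

/-- A single spin, with values in `{0, ±1, …, ±S}`. -/
abbrev Spin (S : ℕ) : Type := {x : ℤ // x ∈ Finset.Icc (-(S : ℤ)) (S : ℤ)}

/-- The real value of a spin. -/
def Spin.val {S : ℕ} (x : Spin S) : ℝ := ((x : ℤ) : ℝ)

/-- Spin configurations of `N` sites. -/
abbrev Config (S N : ℕ) : Type := Fin N → Spin S

/-- Unordered pairs of distinct elements of `{1, …, n}`, as pairs `(k, l)` with `k < l`. -/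
abbrev Pair (n : ℕ) : Type := {e : Fin n × Fin n // e.1 < e.2}

/-- A realization of the couplings `g i j`, `i < j`. -/
abbrev Disorder (N : ℕ) : Type := Pair N → ℝ

/-- The law of the couplings: i.i.d. standard Gaussians. -/
def disorderLaw (N : ℕ) : Measure (Disorder N) := Measure.pi fun _ => gaussianReal 0 1

/-- The Hamiltonian of the model. -/
def hamiltonian (P : Params) {N : ℕ} (g : Disorder N) (σ : Config P.S N) : ℝ :=
  P.β / Real.sqrt N * ∑ e : Pair N, g e * (σ e.1.1).val * (σ e.1.2).val
    + P.D * ∑ i, (σ i).val ^ 2 + P.h * ∑ i, (σ i).val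

/-- The partition function. -/
def partitionFunction (P : Params) {N : ℕ} (g : Disorder N) : ℝ :=
  ∑ σ : Config P.S N, Real.exp (hamiltonian P g σ)

/-- The Gibbs probability of a configuration. -/
def gibbsWeight (P : Params) {N : ℕ} (g : Disorder N) (σ : Config P.S N) : ℝ :=
  Real.exp (hamiltonian P g σ) / partitionFunction P g

/-- The quenched average `⟨f⟩` of a function of `n` replicas. -/
def gibbsAvg (P : Params) {N n : ℕ} (g : Disorder N) (f : (Fin n → Config P.S N) → ℝ) : ℝ :=
  ∑ σ : Fin n → Config P.S N, f σ * ∏ k, gibbsWeight P g (σ k)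

/-- The average `ν(f) = E⟨f⟩`, where `f` may depend on the disorder. -/
def nu (P : Params) {N n : ℕ} (f : Disorder N → (Fin n → Config P.S N) → ℝ) : ℝ :=
  ∫ g, gibbsAvg P g (f g) ∂(disorderLaw N)

/-- The quenched magnetization `⟨σ_i⟩` of site `i`. -/
def magnetization (P : Params) {N : ℕ} (g : Disorder N) (i : Fin N) : ℝ :=
  gibbsAvg P g fun σ : Fin 1 → Config P.S N => (σ 0 i).val

/-- The quenched second moment `⟨σ_i ^ 2⟩` of site `i`. -/
def secondMoment (P : Params) {N : ℕ} (g : Disorder N) (i : Fin N) : ℝ :=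
  gibbsAvg P g fun σ : Fin 1 → Config P.S N => (σ 0 i).val ^ 2

/-- The weight of the decoupled last spin at time `0` of the cavity interpolation, `η` being the
Gaussian field that replaces the interaction with the other spins. -/
def cavityWeight (P : Params) (p q η : ℝ) (ε : Spin P.S) : ℝ :=
  Real.exp (ε.val * (P.β * η * Real.sqrt q) + P.β ^ 2 / 2 * (p - q) * ε.val ^ 2
    + P.D * ε.val ^ 2 + P.h * ε.val)

/-- The average `ν₀(f)` of a function `f` of the last spins `ε 0, …, ε (m - 1)` of `m` replicas:
for given `η` they are independent with weights `cavityWeight`; then `η ~ N(0, 1)` is averaged. -/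
def nuZero (P : Params) (p q : ℝ) {m : ℕ} (f : (Fin m → ℝ) → ℝ) : ℝ :=
  ∫ η, ∑ ε : Fin m → Spin P.S, f (fun k => (ε k).val) *
    ∏ k, (cavityWeight P p q η (ε k) / ∑ x : Spin P.S, cavityWeight P p q η x)
    ∂(gaussianReal 0 1)

/-- `p` and `q` solve the replica-symmetric equations
`p = ν₀(ε_1 ε_1)`, `q = ν₀(ε_1 ε_2)`. -/
def IsReplicaSymmetric (P : Params) (p q : ℝ) : Prop :=
  p = nuZero P p q (fun ε : Fin 2 → ℝ => ε 0 * ε 0) ∧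
  q = nuZero P p q (fun ε : Fin 2 → ℝ => ε 0 * ε 1)

section Constants

/-! Replica `j` is written with the index `j - 1`. -/

/-- `A = ν₀((ε₁ - ε₃)(ε₂ - ε₄) ε₁ ε₂)` -/
def cA (P : Params) (p q : ℝ) : ℝ :=
  nuZero P p q fun ε : Fin 4 → ℝ => (ε 0 - ε 2) * (ε 1 - ε 3) * (ε 0 * ε 1)

/-- `D = ν₀((ε₁² - ε₂²) ε₁²)` -/
def cD (P : Params) (p q : ℝ) : ℝ :=
  nuZero P p q fun ε : Fin 4 → ℝ => (ε 0 ^ 2 - ε 1 ^ 2) * ε 0 ^ 2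

/-- `E = ν₀((ε₁² - ε₂²) ε₁ ε₃)` -/
def cE (P : Params) (p q : ℝ) : ℝ :=
  nuZero P p q fun ε : Fin 4 → ℝ => (ε 0 ^ 2 - ε 1 ^ 2) * (ε 0 * ε 2)

/-- `F = ν₀((ε₁ ε₃ - ε₂ ε₃) ε₁ ε₃)` -/
def cF (P : Params) (p q : ℝ) : ℝ :=
  nuZero P p q fun ε : Fin 4 → ℝ => (ε 0 * ε 2 - ε 1 * ε 2) * (ε 0 * ε 2)

/-- `G = ν₀((ε₁ ε₃ - ε₂ ε₃) ε₁ ε₄)` -/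
def cG (P : Params) (p q : ℝ) : ℝ :=
  nuZero P p q fun ε : Fin 4 → ℝ => (ε 0 * ε 2 - ε 1 * ε 2) * (ε 0 * ε 3)

/-- `I₃ = ν₀((ε₁ ε₂ - q) ε₃ ε₄)` -/
def cI3 (P : Params) (p q : ℝ) : ℝ :=
  nuZero P p q fun ε : Fin 4 → ℝ => (ε 0 * ε 1 - q) * (ε 2 * ε 3)

/-- `I₅ = ν₀((ε₁ ε₂ - q) ε₃²)` -/
def cI5 (P : Params) (p q : ℝ) : ℝ :=
  nuZero P p q fun ε : Fin 4 → ℝ => (ε 0 * ε 1 - q) * ε 2 ^ 2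

/-- `K₃ = ν₀((ε₁² - p) ε₂ ε₃)` -/
def cK3 (P : Params) (p q : ℝ) : ℝ :=
  nuZero P p q fun ε : Fin 4 → ℝ => (ε 0 ^ 2 - p) * (ε 1 * ε 2)

/-- `K₄ = ν₀((ε₁² - p) ε₂²)` -/
def cK4 (P : Params) (p q : ℝ) : ℝ :=
  nuZero P p q fun ε : Fin 4 → ℝ => (ε 0 ^ 2 - p) * ε 1 ^ 2

def cM1 (P : Params) (p q : ℝ) : ℝ := 1 - P.β ^ 2 * (cF P p q - 3 * cG P p q)

def cM2 (P : Params) (p q : ℝ) : ℝ := 1 - P.β ^ 2 / 2 * cD P p q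

def cM3 (P : Params) (p q : ℝ) : ℝ := 1 - P.β ^ 2 * (cF P p q - cG P p q)

def cM (P : Params) (p q : ℝ) : ℝ := cM1 P p q * cM2 P p q + P.β ^ 4 * cE P p q ^ 2

/-- The variance `A₂²` of `g_{T_{k,l}}` for system size `N`. -/
def varA2 (P : Params) (p q : ℝ) (N : ℕ) : ℝ :=
  cA P p q / (N * (1 - P.β ^ 2 * cA P p q))

/-- The variance `A₁²` of `g_{T_k}`. -/
def varA1 (P : Params) (p q : ℝ) (N : ℕ) : ℝ :=
  (cG P p q * cM2 P p q + P.β ^ 2 / 2 * cE P p q ^ 2) / cM P p q * (1 / (N * cM3 P p q))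

/-- The variance `B₁²` of `g_{S_k}`. -/
def varB1 (P : Params) (p q : ℝ) (N : ℕ) : ℝ :=
  (cD P p q * cM1 P p q - 2 * P.β ^ 2 * cE P p q ^ 2) / (N * cM P p q)

/-- The covariance `C₁²` of `g_{T_k}` and `g_{S_k}`. -/
def covC1 (P : Params) (p q : ℝ) (N : ℕ) : ℝ :=
  cE P p q / (N * cM P p q)

/-- The variance `A₀²` of `g_T`. -/
def varA0 (P : Params) (p q : ℝ) (N : ℕ) : ℝ :=
  P.β ^ 2 / cM P p q * (P.β ^ 2 * cE P p q * cK4 P p q + cM2 P p q * cI5 P p q) * covC1 P p q N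
  + 2 * (P.β ^ 2 / cM P p q) * (P.β ^ 2 * cE P p q * (cE P p q - cK3 P p q)
      + cM2 P p q * (2 * cG P p q - cI3 P p q)) * varA1 P p q N
  + P.β ^ 2 / cM P p q * (P.β ^ 2 * cE P p q * cK3 P p q + cM2 P p q * cI3 P p q) * varA2 P p q N
  + 1 / (cM P p q * N) * (P.β ^ 2 * cE P p q * cK3 P p q + cM2 P p q * cI3 P p q)

/-- The variance `B₀²` of `g_S`. -/
def varB0 (P : Params) (p q : ℝ) (N : ℕ) : ℝ :=
  P.β ^ 2 / (2 * cM P p q) * (cM1 P p q * cK4 P p q - P.β ^ 2 * cE P p q * cI5 P p q)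
      * varB1 P p q N
  + P.β ^ 2 / cM P p q * (cM1 P p q * (cE P p q - cK3 P p q)
      - cE P p q * P.β ^ 2 * (2 * cG P p q - cI3 P p q)) * covC1 P p q N
  + 1 / (cM P p q * N) * (cM1 P p q * cK4 P p q - P.β ^ 2 * cE P p q * cI5 P p q)

/-- The covariance `C₀²` of `g_T` and `g_S`. -/
def covC0 (P : Params) (p q : ℝ) (N : ℕ) : ℝ :=
  P.β ^ 2 / (2 * cM P p q) * (cM2 P p q * cI5 P p q + P.β ^ 2 * cE P p q * cK4 P p q)
      * varB1 P p q N
  + P.β ^ 2 / cM P p q * (cM2 P p q * (2 * cG P p q - cI3 P p q)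
      + P.β ^ 2 * cE P p q * (cE P p q - cK3 P p q)) * covC1 P p q N
  + 1 / (cM P p q * N) * (cM2 P p q * cI5 P p q + P.β ^ 2 * cE P p q * cK4 P p q)

end Constants

/-- The labels `T_{k,l}` (`k < l`), `T_k`, `S_k`, `T`, `S` of the basis variables of `n` replicas. -/
inductive BasisIndex (n : ℕ) : Type
  | Tpair (e : Pair n)
  | Trep (k : Fin n)
  | Srep (k : Fin n)
  | T
  | S
  deriving DecidableEq, Fintype

/-- The basis variables, as functions of the disorder and of `n` replicas. -/
def basisVar (P : Params) (p q : ℝ) {N n : ℕ} (g : Disorder N) (σ : Fin n → Config P.S N) :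
    BasisIndex n → ℝ
  | .Tpair e => 1 / (N : ℝ) * ∑ i, ((σ e.1.1 i).val - magnetization P g i) *
      ((σ e.1.2 i).val - magnetization P g i)
  | .Trep k => 1 / (N : ℝ) * ∑ i, ((σ k i).val - magnetization P g i) * magnetization P g i
  | .Srep k => 1 / (N : ℝ) * ∑ i, ((σ k i).val ^ 2 - secondMoment P g i)
  | .T => 1 / (N : ℝ) * ∑ i, magnetization P g i ^ 2 - q
  | .S => 1 / (N : ℝ) * ∑ i, secondMoment P g i - p

/-- The covariance matrix of the Gaussian vector for system size `N`. -/
def covMatrix (P : Params) (p q : ℝ) (N n : ℕ) : Matrix (BasisIndex n) (BasisIndex n) ℝ :=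
  Matrix.of fun X Y => match X, Y with
    | .Tpair e, .Tpair e' => if e = e' then varA2 P p q N else 0
    | .Trep k, .Trep l => if k = l then varA1 P p q N else 0
    | .Srep k, .Srep l => if k = l then varB1 P p q N else 0
    | .Trep k, .Srep l => if k = l then covC1 P p q N else 0
    | .Srep k, .Trep l => if k = l then covC1 P p q N else 0
    | .T, .T => varA0 P p q N
    | .S, .S => varB0 P p q N
    | .T, .S => covC0 P p q N
    | .S, .T => covC0 P p q N
    | _, _ => 0

end GhatakSherrington

end

/-!
The moments of the basis variables are compared with Gaussian moments by showing that they satisfy,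
up to an error of higher order in `1 / √N`, the recursion (Gaussian integration by parts, or Wick's
formula) that determines the moments of a Gaussian vector.

*Interpolation.* Every estimate comes from a path of Gaussian energies. Differentiating a Gibbs
average along such a path and integrating by parts in the disorder replaces the disorder by sums
over pairs of replicas, two of them new (`hasDerivAt_gnu_path`). For the law of the last spins, this
shows that the replica-symmetric equations are a fixed-point problem for a contraction of the plane
when `β` is small (`exists_unique_isReplicaSymmetric`).

*Concentration.* Let `R` stand for an overlap `1 / N * ∑ i, σ^x_i σ^y_i` minus its replica-symmetric
value (`p` if `x = y`, `q` otherwise). On the path from independent sites to the model, the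
derivative of `ν (exp (λ N R ^ 2))` is bounded by `β ^ 2` times averages of `N R ^ 2` times the
exponential, and these are paid for by letting `λ` decrease along the path. As independent sites
have sub-Gaussian overlaps, so does the model (`nuK_exp_ov_sq_le`), and every factor `R` counts as
`1 / √N` in all moments (`HighTemp.nuK_ovSum_pow_le`).

*Cavity equations.* Consider `ν (R_{xy} f)`, where `f` is a product of linear combinations of
centered overlaps. As `R_{xy}` is an average over the sites, each site may be treated separately. The
path that decouples this site, expanded to second order, gives linear equations for these
correlations with an error two orders beyond the number of factors of `f` (`HighTemp.cavity_eq`).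
Their coefficients are the covariances of products of two last spins, hence the constants of the
theorem. They involve two new replicas, which by symmetry may be exchanged with replicas that `f`
does not use; so the system closes. Its solution for numbers is `linear_system_solution`, and it
carries over to sequences modulo higher order because linear functionals that vanish on the
negligible sequences detect them (`HighTemp.corr_solution`).

*Wick recursion.* A basis variable is the average, over two replicas of its own, of a linear
combination of centered overlaps. A moment of the basis variables is thus an average of a product of
such forms (`nu_prod_basisVar`), and the solution of the cavity equations says that it satisfies the
recursion of Gaussian moments with covariances `covMatrix`, up to higher order
(`HighTemp.basisMom_insert`). Gaussian moments satisfy the recursion exactly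
(`integral_prod_insert_multivariateGaussian`), and an induction on the number of factors compares the
two (`HighTemp.basisMom_sub_integral`). The existence of the Gaussian vector comes from the same
recursion: `N * covMatrix` does not depend on `N` and is the limit of the rescaled matrices of second
moments, which are positive semidefinite (`HighTemp.covMatrix_posSemidef`).
-/

namespace GhatakSherrington

set_option linter.unusedSectionVars false

/-! ### Gaussian integration by parts -/

/-- The law of a family of independent standard Gaussian variables. -/
noncomputable abbrev gauss (J : Type*) [Fintype J] : Measure (J → ℝ) :=
  Measure.pi fun _ => gaussianReal 0 1

lemma hasDerivAt_gaussianPDFReal (x : ℝ) :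
    HasDerivAt (gaussianPDFReal 0 1) (-x * gaussianPDFReal 0 1 x) x := by
  have h : gaussianPDFReal 0 1 = fun x => (Real.sqrt (2 * Real.pi))⁻¹ * Real.exp (-x ^ 2 / 2) := by
    funext y; simp [gaussianPDFReal]
  rw [h]
  have h1 : HasDerivAt (fun x : ℝ => -x ^ 2 / 2) (-x) x := by
    have := ((hasDerivAt_pow 2 x).neg.div_const 2)
    refine this.congr_deriv ?_
    simp; ring
  refine (h1.exp.const_mul _).congr_deriv ?_
  ring

lemma integral_id_mul_gaussianReal {f f' : ℝ → ℝ} (hf : ∀ x, HasDerivAt f (f' x) x)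
    (h0 : Integrable f (gaussianReal 0 1)) (h1 : Integrable f' (gaussianReal 0 1))
    (h2 : Integrable (fun x => x * f x) (gaussianReal 0 1)) :
    ∫ x, x * f x ∂gaussianReal 0 1 = ∫ x, f' x ∂gaussianReal 0 1 := by
  have key : ∀ g : ℝ → ℝ, Integrable g (gaussianReal 0 1) →
      Integrable (fun x => gaussianPDFReal 0 1 x * g x) := by
    intro g hg
    rw [gaussianReal_of_var_ne_zero _ one_ne_zero] at hg
    have := (integrable_withDensity_iff_integrable_smul₀' (μ := volume)
      (measurable_gaussianPDF 0 1).aemeasurable (by simp [gaussianPDF_lt_top])).1 hg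
    simpa [toReal_gaussianPDF] using this
  rw [integral_gaussianReal_eq_integral_smul one_ne_zero,
    integral_gaussianReal_eq_integral_smul one_ne_zero]
  have := integral_mul_deriv_eq_deriv_mul_of_integrable (u := f) (u' := f')
    (v := gaussianPDFReal 0 1) (v' := fun x => -x * gaussianPDFReal 0 1 x)
    (fun x _ => hf x) (fun x _ => hasDerivAt_gaussianPDFReal x)
    (((key _ h2).neg).congr (Filter.Eventually.of_forall fun x => by simp; ring))
    ((key _ h1).congr (Filter.Eventually.of_forall fun x => by simp; ring))
    ((key _ h0).congr (Filter.Eventually.of_forall fun x => by simp; ring))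
  simp only [smul_eq_mul]
  calc ∫ x, gaussianPDFReal 0 1 x * (x * f x)
      = -∫ x, f x * (-x * gaussianPDFReal 0 1 x) := by
        rw [← integral_neg]; congr 1; funext x; ring
    _ = _ := by rw [this, neg_neg]; congr 1; funext x; ring

/-- Resampling one coordinate preserves the product measure. -/
lemma measurePreserving_update {J : Type*} [Fintype J] [DecidableEq J] (i : J) :
    MeasurePreserving (fun z : ℝ × (J → ℝ) => Function.update z.2 i z.1)
      ((gaussianReal 0 1).prod (gauss J)) (gauss J) := by
  have hm : Measurable (fun z : ℝ × (J → ℝ) => Function.update z.2 i z.1) := by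
    rw [measurable_pi_iff]
    intro j
    by_cases h : j = i
    · subst h; simpa using measurable_fst
    · simp only [Function.update_of_ne h]
      exact (measurable_pi_apply j).comp measurable_snd
  refine ⟨hm, ?_⟩
  symm
  refine Measure.pi_eq fun s hs => ?_
  rw [Measure.map_apply hm (MeasurableSet.univ_pi hs)]
  have : (fun z : ℝ × (J → ℝ) => Function.update z.2 i z.1) ⁻¹' Set.univ.pi s
      = s i ×ˢ Set.univ.pi (Function.update s i Set.univ) := by
    ext z
    simp only [Set.mem_preimage, Set.mem_pi, Set.mem_univ, true_implies, Set.mem_prod]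
    constructor
    · intro h
      refine ⟨by simpa using h i, fun j => ?_⟩
      by_cases hj : j = i
      · subst hj; simp
      · simpa [Function.update_of_ne hj] using h j
    · rintro ⟨h1, h2⟩ j
      by_cases hj : j = i
      · subst hj; simpa using h1
      · simpa [Function.update_of_ne hj] using h2 j
  rw [this, Measure.prod_prod, Measure.pi_pi, ← Finset.mul_prod_erase _ _ (Finset.mem_univ i),
    ← Finset.mul_prod_erase (a := i) Finset.univ (fun j => gaussianReal 0 1 (s j))
      (Finset.mem_univ i)]
  simp only [Function.update_self, measure_univ, one_mul]
  congr 1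
  refine Finset.prod_congr rfl fun j hj => ?_
  rw [Function.update_of_ne (Finset.ne_of_mem_erase hj)]

lemma integral_update {J : Type*} [Fintype J] [DecidableEq J] (i : J) {F : (J → ℝ) → ℝ}
    (hF : Integrable F (gauss J)) :
    ∫ g, F g ∂gauss J
      = ∫ g, ∫ x, F (Function.update g i x) ∂gaussianReal 0 1 ∂gauss J := by
  have mp := measurePreserving_update i
  rw [← mp.map_eq, integral_map mp.measurable.aemeasurable (by rw [mp.map_eq]; exact hF.1), mp.map_eq]
  exact integral_prod_symm _ (mp.integrable_comp_of_integrable hF)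

/-- Gaussian integration by parts in one of finitely many independent coordinates. -/
lemma integral_coord_mul_gauss {J : Type*} [Fintype J] [DecidableEq J] (i : J)
    {F F' : (J → ℝ) → ℝ}
    (hd : ∀ g x, HasDerivAt (fun y => F (Function.update g i y)) (F' (Function.update g i x)) x)
    (h0 : Integrable F (gauss J)) (h1 : Integrable F' (gauss J))
    (h2 : Integrable (fun g => g i * F g) (gauss J)) :
    ∫ g, g i * F g ∂gauss J = ∫ g, F' g ∂gauss J := by
  have mp := measurePreserving_update i
  rw [integral_update i h2, integral_update i h1]
  refine integral_congr_ae ?_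
  filter_upwards [(mp.integrable_comp_of_integrable h0).prod_left_ae,
    (mp.integrable_comp_of_integrable h1).prod_left_ae,
    (mp.integrable_comp_of_integrable h2).prod_left_ae] with g k0 k1 k2
  simp only [Function.comp_def, Function.update_self] at k0 k1 k2 ⊢
  exact integral_id_mul_gaussianReal (fun x => hd g x) k0 k1 k2

/-! ### Gibbs averages over replicas -/

/-- The Gibbs probability of `σ` for the energy function `H` on a finite configuration space. -/
noncomputable def boltz {Ω : Type*} [Fintype Ω] (H : Ω → ℝ) (σ : Ω) : ℝ :=
  Real.exp (H σ) / ∑ τ, Real.exp (H τ)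

/-- The average of a function of the replicas labelled by `κ`, drawn independently from the Gibbs
measure of `H`. -/
noncomputable def ravg {Ω κ : Type*} [Fintype Ω] [Fintype κ] [DecidableEq κ] (H : Ω → ℝ)
    (f : (κ → Ω) → ℝ) : ℝ :=
  ∑ σ : κ → Ω, f σ * ∏ k, boltz H (σ k)

section Gibbs

variable {Ω κ κ' : Type*} [Fintype Ω] [Fintype κ] [DecidableEq κ] [Fintype κ'] [DecidableEq κ']

lemma boltz_nonneg (H : Ω → ℝ) (σ : Ω) : 0 ≤ boltz H σ :=
  div_nonneg (Real.exp_pos _).le (Finset.sum_nonneg fun _ _ => (Real.exp_pos _).le)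

lemma sum_exp_pos [Nonempty Ω] (H : Ω → ℝ) : 0 < ∑ τ, Real.exp (H τ) :=
  Finset.sum_pos (fun _ _ => Real.exp_pos _) Finset.univ_nonempty

lemma sum_boltz [Nonempty Ω] (H : Ω → ℝ) : ∑ σ, boltz H σ = 1 := by
  unfold boltz
  rw [← Finset.sum_div, div_self (sum_exp_pos H).ne']

lemma prod_boltz_nonneg (H : Ω → ℝ) (σ : κ → Ω) : 0 ≤ ∏ k, boltz H (σ k) :=
  Finset.prod_nonneg fun _ _ => boltz_nonneg _ _

lemma sum_prod_boltz [Nonempty Ω] (H : Ω → ℝ) : ∑ σ : κ → Ω, ∏ k, boltz H (σ k) = 1 := by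
  rw [← Fintype.prod_sum (fun (_ : κ) (x : Ω) => boltz H x)]
  simp [sum_boltz]

lemma ravg_const [Nonempty Ω] (H : Ω → ℝ) (c : ℝ) : ravg H (fun _ : κ → Ω => c) = c := by
  unfold ravg
  rw [← Finset.mul_sum, sum_prod_boltz, mul_one]

lemma ravg_add (H : Ω → ℝ) (f g : (κ → Ω) → ℝ) :
    ravg H (fun σ => f σ + g σ) = ravg H f + ravg H g := by
  simp [ravg, add_mul, Finset.sum_add_distrib]

lemma ravg_sub (H : Ω → ℝ) (f g : (κ → Ω) → ℝ) :
    ravg H (fun σ => f σ - g σ) = ravg H f - ravg H g := by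
  simp [ravg, sub_mul, Finset.sum_sub_distrib]

lemma ravg_const_mul (H : Ω → ℝ) (c : ℝ) (f : (κ → Ω) → ℝ) :
    ravg H (fun σ => c * f σ) = c * ravg H f := by
  simp [ravg, Finset.mul_sum, mul_assoc]

lemma ravg_sum (H : Ω → ℝ) {ι : Type*} (s : Finset ι) (f : ι → (κ → Ω) → ℝ) :
    ravg H (fun σ => ∑ i ∈ s, f i σ) = ∑ i ∈ s, ravg H (f i) := by
  unfold ravg
  rw [Finset.sum_comm]
  simp [Finset.sum_mul]

lemma ravg_mono (H : Ω → ℝ) {f g : (κ → Ω) → ℝ} (h : ∀ σ, f σ ≤ g σ) : ravg H f ≤ ravg H g :=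
  Finset.sum_le_sum fun σ _ => mul_le_mul_of_nonneg_right (h σ) (prod_boltz_nonneg H σ)

lemma abs_ravg_le [Nonempty Ω] (H : Ω → ℝ) {f : (κ → Ω) → ℝ} {B : ℝ} (h : ∀ σ, |f σ| ≤ B) :
    |ravg H f| ≤ B := by
  refine abs_le.2 ⟨?_, ?_⟩
  · rw [← ravg_const (κ := κ) H (-B)]
    exact ravg_mono H fun σ => (abs_le.1 (h σ)).1
  · rw [← ravg_const (κ := κ) H B]
    exact ravg_mono H fun σ => (abs_le.1 (h σ)).2

lemma ravg_comp_equiv (H : Ω → ℝ) (e : κ ≃ κ') (f : (κ → Ω) → ℝ) :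
    ravg H (fun σ : κ' → Ω => f (σ ∘ e)) = ravg H f := by
  unfold ravg
  refine Fintype.sum_equiv (Equiv.arrowCongr e.symm (Equiv.refl Ω)) _ _ fun σ => ?_
  have : (Equiv.arrowCongr e.symm (Equiv.refl Ω)) σ = σ ∘ e := by
    funext k; simp
  rw [this]
  congr 1
  exact (Fintype.prod_equiv e _ _ fun k => rfl).symm

/-- Independence of two groups of replicas. -/
lemma ravg_sumType (H : Ω → ℝ) (F : (κ ⊕ κ' → Ω) → ℝ) :
    ravg H F = ravg H fun σ : κ → Ω => ravg H fun τ : κ' → Ω => F (Sum.elim σ τ) := by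
  unfold ravg
  rw [← (Equiv.sumArrowEquivProdArrow κ κ' Ω).symm.sum_comp, Fintype.sum_prod_type]
  refine Finset.sum_congr rfl fun σ _ => ?_
  rw [Finset.sum_mul]
  refine Finset.sum_congr rfl fun τ _ => ?_
  have : (Equiv.sumArrowEquivProdArrow κ κ' Ω).symm (σ, τ) = Sum.elim σ τ := rfl
  rw [this, Fintype.prod_sum_type]
  simp only [Sum.elim_inl, Sum.elim_inr]
  ring

/-- Replicas that are not looked at can be dropped, and the others can be relabelled. -/
lemma ravg_comp_injective [Nonempty Ω] (H : Ω → ℝ) {j : κ → κ'} (hj : Function.Injective j)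
    (f : (κ → Ω) → ℝ) : ravg H (fun σ : κ' → Ω => f (σ ∘ j)) = ravg H f := by
  classical
  let e : κ ⊕ ((Set.range j)ᶜ : Set κ') ≃ κ' :=
    (Equiv.sumCongr (Equiv.ofInjective j hj) (Equiv.refl _)).trans (Equiv.Set.sumCompl (Set.range j))
  have he : ∀ k, e.symm (j k) = Sum.inl k := fun k => by
    rw [Equiv.symm_apply_eq]; simp [e]
  have h1 := ravg_comp_equiv H e.symm (fun σ : κ' → Ω => f (σ ∘ j))
  rw [← h1, ravg_sumType]
  unfold ravg
  refine Finset.sum_congr rfl fun σ _ => ?_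
  have : ∀ τ : ((Set.range j)ᶜ : Set κ') → Ω, (Sum.elim σ τ ∘ ⇑e.symm) ∘ j = σ := fun τ => by
    funext k; simp [he]
  simp only [this]
  rw [← Finset.mul_sum, sum_prod_boltz, mul_one]

lemma ravg_option (H : Ω → ℝ) (F : (Option κ → Ω) → ℝ) :
    ravg H F = ravg H fun σ : κ → Ω => ∑ τ, boltz H τ * F (fun o => o.elim τ σ) := by
  unfold ravg
  rw [← (Equiv.piOptionEquivProd (β := fun _ : Option κ => Ω)).symm.sum_comp,
    Fintype.sum_prod_type, Finset.sum_comm]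
  refine Finset.sum_congr rfl fun σ _ => ?_
  rw [Finset.sum_mul]
  refine Finset.sum_congr rfl fun τ _ => ?_
  have : (Equiv.piOptionEquivProd (β := fun _ : Option κ => Ω)).symm (τ, σ)
      = fun o => o.elim τ σ := by
    funext o; cases o <;> rfl
  rw [this, Fintype.prod_option]
  simp only [Option.elim]
  ring

/-- The replica form of a derivative of the Gibbs average of `f`, when the energy is perturbed in
the direction `u`: each replica of `f` contributes `u`, and one new replica compensates the change
of the partition functions. -/
def repDiff (u : Ω → ℝ) (f : (κ → Ω) → ℝ) (σ : Option κ → Ω) : ℝ :=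
  f (fun k => σ (some k)) * (∑ k, u (σ (some k)) - Fintype.card κ * u (σ none))

lemma ravg_repDiff [Nonempty Ω] (H u : Ω → ℝ) (f : (κ → Ω) → ℝ) :
    ravg H (repDiff u f)
      = ravg H fun σ => f σ * ∑ k, (u (σ k) - ∑ τ, boltz H τ * u τ) := by
  rw [ravg_option]
  congr 1
  funext σ
  simp only [repDiff, Option.elim]
  calc ∑ τ, boltz H τ * (f (fun k => σ k) * (∑ k, u (σ k) - Fintype.card κ * u τ))
      = f σ * (∑ k, u (σ k)) * (∑ τ, boltz H τ) - f σ * Fintype.card κ * ∑ τ, boltz H τ * u τ := by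
        have e : ∀ τ, boltz H τ * (f (fun k => σ k) * (∑ k, u (σ k) - Fintype.card κ * u τ))
            = f σ * (∑ k, u (σ k)) * boltz H τ - f σ * Fintype.card κ * (boltz H τ * u τ) :=
          fun τ => by ring
        simp_rw [e, Finset.sum_sub_distrib, ← Finset.mul_sum]
    _ = _ := by
        rw [sum_boltz, Finset.sum_sub_distrib]; simp; ring

lemma hasDerivAt_boltz [Nonempty Ω] {H : ℝ → Ω → ℝ} {H' : Ω → ℝ} {t : ℝ}
    (h : ∀ σ, HasDerivAt (fun s => H s σ) (H' σ) t) (σ : Ω) :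
    HasDerivAt (fun s => boltz (H s) σ)
      (boltz (H t) σ * (H' σ - ∑ τ, boltz (H t) τ * H' τ)) t := by
  have hZ : HasDerivAt (fun s => ∑ τ, Real.exp (H s τ)) (∑ τ, Real.exp (H t τ) * H' τ) t :=
    HasDerivAt.fun_sum fun τ _ => (h τ).exp
  have hz := (sum_exp_pos (H t)).ne'
  refine ((h σ).exp.div hZ hz).congr_deriv ?_
  have : ∑ τ, boltz (H t) τ * H' τ = (∑ τ, Real.exp (H t τ) * H' τ) / ∑ τ, Real.exp (H t τ) := by
    rw [Finset.sum_div]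
    exact Finset.sum_congr rfl fun τ _ => by unfold boltz; ring
  rw [this]
  unfold boltz
  field_simp

lemma hasDerivAt_ravg [Nonempty Ω] {H : ℝ → Ω → ℝ} {H' : Ω → ℝ} {t : ℝ}
    (h : ∀ σ, HasDerivAt (fun s => H s σ) (H' σ) t) (f : (κ → Ω) → ℝ) :
    HasDerivAt (fun s => ravg (H s) f) (ravg (H t) (repDiff H' f)) t := by
  rw [ravg_repDiff]
  unfold ravg
  refine HasDerivAt.fun_sum fun σ _ => ?_
  have := (HasDerivAt.fun_finsetProd (u := Finset.univ) (fun k _ => hasDerivAt_boltz h (σ k))).const_mul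
    (f σ)
  refine this.congr_deriv ?_
  rw [mul_assoc, Finset.sum_mul]
  congr 1
  refine Finset.sum_congr rfl fun k _ => ?_
  rw [← Finset.mul_prod_erase _ _ (Finset.mem_univ k), smul_eq_mul]
  ring

end Gibbs

/-! ### Gibbs measures with Gaussian disorder -/

/-- The energy `∑ j, c j σ * g j + d σ`, linear in the disorder `g`. -/
def linH {Ω J : Type*} [Fintype J] (c : J → Ω → ℝ) (d : Ω → ℝ) (g : J → ℝ) (σ : Ω) : ℝ :=
  ∑ j, c j σ * g j + d σ

/-- The Gibbs average of a function of replicas for the energy `linH c d`, averaged over the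
Gaussian disorder. -/
noncomputable def gnu {Ω J κ : Type*} [Fintype Ω] [Fintype J] [Fintype κ] [DecidableEq κ]
    (c : J → Ω → ℝ) (d : Ω → ℝ) (f : (κ → Ω) → ℝ) : ℝ :=
  ∫ g, ravg (linH c d g) f ∂gauss J

section Disorder

variable {Ω κ κ' J : Type*} [Fintype Ω] [Nonempty Ω] [Fintype κ] [DecidableEq κ]
  [Fintype κ'] [DecidableEq κ'] [Fintype J]

lemma continuous_linH (c : J → Ω → ℝ) (d : Ω → ℝ) (σ : Ω) :
    Continuous fun g => linH c d g σ := by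
  unfold linH; fun_prop

lemma continuous_ravg_linH (c : J → Ω → ℝ) (d : Ω → ℝ) (f : (κ → Ω) → ℝ) :
    Continuous fun g => ravg (linH c d g) f := by
  unfold ravg boltz
  refine continuous_finsetSum _ fun σ _ => continuous_const.mul
    (continuous_finsetProd _ fun k _ => ?_)
  refine ((continuous_linH c d _).rexp).div
    (continuous_finsetSum _ fun τ _ => (continuous_linH c d _).rexp) fun g => (sum_exp_pos _).ne'

lemma abs_le_sum_abs (f : (κ → Ω) → ℝ) (σ : κ → Ω) : |f σ| ≤ ∑ τ, |f τ| :=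
  Finset.single_le_sum (f := fun τ => |f τ|) (fun _ _ => abs_nonneg _) (Finset.mem_univ σ)

lemma integrable_ravg (c : J → Ω → ℝ) (d : Ω → ℝ) (f : (κ → Ω) → ℝ) :
    Integrable (fun g => ravg (linH c d g) f) (gauss J) :=
  Integrable.of_bound (continuous_ravg_linH c d f).aestronglyMeasurable (∑ τ, |f τ|)
    (Filter.Eventually.of_forall fun _ => abs_ravg_le _ (abs_le_sum_abs f))

lemma integrable_coord (j : J) : Integrable (fun g : J → ℝ => g j) (gauss J) :=
  integrable_comp_eval (X := fun _ : J => ℝ) (μ := fun _ : J => gaussianReal 0 1)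
    (f := fun x : ℝ => x) ((memLp_id_gaussianReal 1).integrable le_rfl)

lemma integrable_coord_mul_ravg (c : J → Ω → ℝ) (d : Ω → ℝ) (f : (κ → Ω) → ℝ) (j : J) :
    Integrable (fun g => g j * ravg (linH c d g) f) (gauss J) := by
  refine (integrable_coord j).mul_bdd (c := ∑ τ, |f τ|)
    (continuous_ravg_linH c d f).aestronglyMeasurable ?_
  exact Filter.Eventually.of_forall fun _ => abs_ravg_le _ (abs_le_sum_abs f)

lemma gnu_const (c : J → Ω → ℝ) (d : Ω → ℝ) (a : ℝ) : gnu c d (fun _ : κ → Ω => a) = a := by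
  simp [gnu, ravg_const]

lemma gnu_add (c : J → Ω → ℝ) (d : Ω → ℝ) (f g : (κ → Ω) → ℝ) :
    gnu c d (fun σ => f σ + g σ) = gnu c d f + gnu c d g := by
  simp only [gnu, ravg_add]
  exact integral_add (integrable_ravg c d f) (integrable_ravg c d g)

lemma gnu_sub (c : J → Ω → ℝ) (d : Ω → ℝ) (f g : (κ → Ω) → ℝ) :
    gnu c d (fun σ => f σ - g σ) = gnu c d f - gnu c d g := by
  simp only [gnu, ravg_sub]
  exact integral_sub (integrable_ravg c d f) (integrable_ravg c d g)

lemma gnu_const_mul (c : J → Ω → ℝ) (d : Ω → ℝ) (a : ℝ) (f : (κ → Ω) → ℝ) :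
    gnu c d (fun σ => a * f σ) = a * gnu c d f := by
  simp only [gnu, ravg_const_mul]
  exact integral_const_mul _ _

lemma gnu_sum (c : J → Ω → ℝ) (d : Ω → ℝ) {ι : Type*} (s : Finset ι) (f : ι → (κ → Ω) → ℝ) :
    gnu c d (fun σ => ∑ i ∈ s, f i σ) = ∑ i ∈ s, gnu c d (f i) := by
  simp only [gnu, ravg_sum]
  exact integral_finsetSum _ fun i _ => integrable_ravg c d (f i)

lemma gnu_mono (c : J → Ω → ℝ) (d : Ω → ℝ) {f g : (κ → Ω) → ℝ} (h : ∀ σ, f σ ≤ g σ) :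
    gnu c d f ≤ gnu c d g :=
  integral_mono (integrable_ravg c d f) (integrable_ravg c d g) fun _ => ravg_mono _ h

lemma abs_gnu_le_gnu (c : J → Ω → ℝ) (d : Ω → ℝ) {f g : (κ → Ω) → ℝ} (h : ∀ σ, |f σ| ≤ g σ) :
    |gnu c d f| ≤ gnu c d g := by
  refine abs_le.2 ⟨?_, gnu_mono c d fun σ => (abs_le.1 (h σ)).2⟩
  have := gnu_mono c d (f := fun σ => (-1) * g σ) (g := f) fun σ => by
    have := (abs_le.1 (h σ)).1; linarith
  rw [gnu_const_mul] at this; linarith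

lemma gnu_nonneg (c : J → Ω → ℝ) (d : Ω → ℝ) {f : (κ → Ω) → ℝ} (h : ∀ σ, 0 ≤ f σ) :
    0 ≤ gnu c d f := by
  have := gnu_mono c d (f := fun _ => 0) (g := f) h
  rwa [gnu_const] at this

lemma gnu_comp_injective (c : J → Ω → ℝ) (d : Ω → ℝ) {j : κ → κ'} (hj : Function.Injective j)
    (f : (κ → Ω) → ℝ) : gnu c d (fun σ : κ' → Ω => f (σ ∘ j)) = gnu c d f := by
  simp only [gnu, ravg_comp_injective _ hj]

/-- Gaussian integration by parts for Gibbs averages. -/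
lemma integral_coord_mul_ravg (c : J → Ω → ℝ) (d : Ω → ℝ) (f : (κ → Ω) → ℝ) (j : J) :
    ∫ g, g j * ravg (linH c d g) f ∂gauss J = gnu c d (repDiff (c j) f) := by
  classical
  refine integral_coord_mul_gauss j (F := fun g => ravg (linH c d g) f)
    (F' := fun g => ravg (linH c d g) (repDiff (c j) f)) ?_ (integrable_ravg c d f)
    (integrable_ravg c d _) (integrable_coord_mul_ravg c d f j)
  intro g x
  refine hasDerivAt_ravg (H := fun y => linH c d (Function.update g j y)) (fun σ => ?_) f
  unfold linH
  have : ∀ i ∈ Finset.univ, HasDerivAt (fun y => c i σ * Function.update g j y i)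
      (if i = j then c j σ else 0) x := by
    intro i _
    by_cases h : i = j
    · subst h
      simpa using (hasDerivAt_id x).const_mul (c i σ)
    · simpa [Function.update_of_ne h, h] using hasDerivAt_const x (c i σ * g i)
  simpa using (HasDerivAt.fun_sum this).add_const (d σ)

lemma abs_repDiff_le {u : Ω → ℝ} {f : (κ → Ω) → ℝ} {B : ℝ} (hB : ∀ σ, |u σ| ≤ B)
    (σ : Option κ → Ω) :
    |repDiff u f σ| ≤ |f fun k => σ (some k)| * (2 * Fintype.card κ * B) := by
  unfold repDiff
  rw [abs_mul]
  refine mul_le_mul_of_nonneg_left ?_ (abs_nonneg _)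
  calc |∑ k, u (σ (some k)) - Fintype.card κ * u (σ none)|
      ≤ |∑ k, u (σ (some k))| + |Fintype.card κ * u (σ none)| := abs_sub _ _
    _ ≤ ∑ _k : κ, B + Fintype.card κ * B := by
        refine add_le_add ((Finset.abs_sum_le_sum_abs _ _).trans
          (Finset.sum_le_sum fun k _ => hB _)) ?_
        rw [abs_mul, Nat.abs_cast]
        exact mul_le_mul_of_nonneg_left (hB _) (Nat.cast_nonneg _)
    _ = _ := by simp; ring

/-- Differentiation of an averaged Gibbs expectation along a path of energies: the disorder in the
derivative of the energy is removed by Gaussian integration by parts. -/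
theorem hasDerivAt_gnu {c c' : ℝ → J → Ω → ℝ} {d d' : ℝ → Ω → ℝ}
    (hc : ∀ t j σ, HasDerivAt (fun s => c s j σ) (c' t j σ) t)
    (hd : ∀ t σ, HasDerivAt (fun s => d s σ) (d' t σ) t)
    {B : ℝ} (hcB : ∀ t j σ, |c' t j σ| ≤ B) (hdB : ∀ t σ, |d' t σ| ≤ B)
    (f : (κ → Ω) → ℝ) (t : ℝ) :
    HasDerivAt (fun s => gnu (c s) (d s) f)
      (∑ j, gnu (c t) (d t) (repDiff (c t j) (repDiff (c' t j) f))
        + gnu (c t) (d t) (repDiff (d' t) f)) t := by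
  have hH : ∀ g s σ, HasDerivAt (fun s => linH (c s) (d s) g σ) (linH (c' s) (d' s) g σ) s :=
    fun g s σ => (HasDerivAt.fun_sum fun j _ => (hc s j σ).mul_const (g j)).add (hd s σ)
  have hrep : ∀ g s, ravg (linH (c s) (d s) g) (repDiff (linH (c' s) (d' s) g) f)
      = ∑ j, g j * ravg (linH (c s) (d s) g) (repDiff (c' s j) f)
        + ravg (linH (c s) (d s) g) (repDiff (d' s) f) := by
    intro g s
    simp_rw [← ravg_const_mul]
    rw [← ravg_sum, ← ravg_add]
    congr 1
    funext σ
    simp only [repDiff, linH, Finset.sum_add_distrib]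
    rw [Finset.sum_comm]
    simp_rw [mul_add, mul_sub, mul_add, Finset.mul_sum, Finset.sum_sub_distrib]
    have e1 : ∀ j : J, ∑ x, g j * (f (fun k => σ (some k)) * c' s j (σ (some x)))
        = ∑ x, f (fun k => σ (some k)) * (c' s j (σ (some x)) * g j) := fun j =>
      Finset.sum_congr rfl fun x _ => by ring
    have e2 : ∀ j : J, g j * (f (fun k => σ (some k)) * (Fintype.card κ * c' s j (σ none)))
        = f (fun k => σ (some k)) * (Fintype.card κ * (c' s j (σ none) * g j)) := fun j => by ring
    simp_rw [e1, e2]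
    ring
  set C : ℝ := (∑ τ, |f τ|) * (2 * Fintype.card κ)
  have hC : 0 ≤ C := by positivity
  have key := hasDerivAt_integral_of_dominated_loc_of_deriv_le (μ := gauss J)
    (F := fun s g => ravg (linH (c s) (d s) g) f)
    (F' := fun s g => ravg (linH (c s) (d s) g) (repDiff (linH (c' s) (d' s) g) f))
    (x₀ := t) (s := Set.univ) (bound := fun g => C * (B * ∑ j, |g j| + B)) Filter.univ_mem
    (Filter.Eventually.of_forall fun s => (continuous_ravg_linH _ _ f).aestronglyMeasurable)
    (integrable_ravg _ _ f)
    (by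
      simp_rw [hrep]
      refine Continuous.aestronglyMeasurable ?_
      refine (continuous_finsetSum _ fun j _ => (continuous_apply j).mul
        (continuous_ravg_linH _ _ _)).add (continuous_ravg_linH _ _ _))
    (Filter.Eventually.of_forall fun g s _ => by
      refine abs_ravg_le _ fun σ => ?_
      refine (abs_repDiff_le (B := B * ∑ j, |g j| + B) (fun τ => ?_) σ).trans ?_
      · unfold linH
        refine (abs_add_le _ _).trans (add_le_add ((Finset.abs_sum_le_sum_abs _ _).trans ?_)
          (hdB s τ))
        rw [Finset.mul_sum]
        refine Finset.sum_le_sum fun j _ => ?_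
        rw [abs_mul]
        exact mul_le_mul_of_nonneg_right (hcB s j τ) (abs_nonneg _)
      · have hB0 : 0 ≤ B := (abs_nonneg _).trans (hdB s (σ none))
        have : 0 ≤ B * ∑ j, |g j| + B := by positivity
        calc _ ≤ (∑ τ, |f τ|) * (2 * Fintype.card κ * (B * ∑ j, |g j| + B)) :=
              mul_le_mul_of_nonneg_right (abs_le_sum_abs f _) (by positivity)
          _ = _ := by simp only [C]; ring)
    (by
      refine Integrable.const_mul (Integrable.add (Integrable.const_mul ?_ _)
        (integrable_const _)) _
      exact integrable_finsetSum _ fun j _ => (integrable_coord j).abs)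
    (Filter.Eventually.of_forall fun g s _ => hasDerivAt_ravg (hH g s) f)
  refine key.2.congr_deriv ?_
  simp_rw [hrep]
  rw [integral_add (integrable_finsetSum _ fun j _ => integrable_coord_mul_ravg _ _ _ j)
    (integrable_ravg _ _ _), integral_finsetSum _ fun j _ => integrable_coord_mul_ravg _ _ _ j]
  simp_rw [integral_coord_mul_ravg]
  rfl

end Disorder

/-! ### Interpolation between Gaussian energies -/

/-- The disorder coefficients along an interpolation path: `b` is switched on with amplitude
`sin θ`, while `b'` is switched off with amplitude `cos θ`, and `a` stays. -/
noncomputable def pathC {Ω J₁ J₂ : Type*} (a b : J₁ → Ω → ℝ) (b' : J₂ → Ω → ℝ) (θ : ℝ) :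
    J₁ ⊕ J₂ → Ω → ℝ :=
  Sum.elim (fun j σ => a j σ + Real.sin θ * b j σ) (fun j σ => Real.cos θ * b' j σ)

/-- The deterministic part of the energy along an interpolation path. -/
noncomputable def pathD {Ω : Type*} (d₀ d₁ d₂ : Ω → ℝ) (θ : ℝ) (σ : Ω) : ℝ :=
  d₀ σ + Real.sin θ ^ 2 * d₁ σ + Real.cos θ ^ 2 * d₂ σ

/-- The signed multiplicities with which pairs of replicas enter the derivative along an
interpolation path. The replicas of the differentiated function are labelled by `κ`; the labels
`some none` and `none` are those of two new replicas. -/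
def repW (κ : Type*) [Fintype κ] : Option (Option κ) → Option (Option κ) → ℝ
  | some (some _), some (some _) => 1
  | some (some _), some none => 1
  | some none, some (some _) => -Fintype.card κ
  | some none, some none => -Fintype.card κ
  | some (some _), none => -(Fintype.card κ + 1)
  | some none, none => Fintype.card κ * (Fintype.card κ + 1)
  | none, _ => 0

/-- The operator whose average, multiplied by `sin θ cos θ`, is the derivative along an
interpolation path. `V` is the difference of the covariances of the two energies that are exchanged,
and `δ` that of their deterministic parts, which acts on single replicas only and therefore enters
on the diagonal. -/
def repL {Ω κ : Type*} [Fintype κ] (V : Ω → Ω → ℝ) (δ : Ω → ℝ) [DecidableEq κ]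
    (f : (κ → Ω) → ℝ) (σ : Option (Option κ) → Ω) : ℝ :=
  f (fun k => σ (some (some k))) *
    ∑ x, ∑ y, repW κ x y * (V (σ x) (σ y) + if x = y then 2 * δ (σ x) else 0)

section Path

variable {Ω κ J₁ J₂ : Type*} [Fintype Ω] [Nonempty Ω] [Fintype κ] [DecidableEq κ]
  [Fintype J₁] [Fintype J₂]

lemma sum_repW_mul (u v : Option (Option κ) → ℝ) :
    ∑ x, ∑ y, repW κ x y * (u x * v y)
      = (∑ k, u (some (some k)) - Fintype.card κ * u (some none)) *
        (∑ l : Option κ, v (some l) - (Fintype.card κ + 1) * v none) := by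
  simp only [Fintype.sum_option, repW]
  simp only [one_mul, zero_mul, Finset.sum_const_zero, add_zero, zero_add, Finset.sum_add_distrib,
    mul_assoc, ← Finset.mul_sum, ← Finset.sum_mul]
  ring

lemma sum_repW_diag (u : Option (Option κ) → ℝ) :
    ∑ x, ∑ y, repW κ x y * (if x = y then u x else 0)
      = ∑ k, u (some (some k)) - Fintype.card κ * u (some none) := by
  simp only [mul_ite, mul_zero, Finset.sum_ite_eq, Finset.mem_univ, if_true]
  simp only [Fintype.sum_option, repW]
  ring_nf

/-- The derivative of a Gibbs average along an interpolation path. The derivatives of `sin` and `cos`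
cancel against the amplitudes in the covariance of the energy, so that `sin θ cos θ` factors out; the
hypothesis `hab` makes the cross terms between the fixed and the moving part vanish. -/
theorem hasDerivAt_gnu_path {a b : J₁ → Ω → ℝ} (hab : ∀ j σ τ, a j σ * b j τ = 0)
    (b' : J₂ → Ω → ℝ) (d₀ d₁ d₂ : Ω → ℝ) (f : (κ → Ω) → ℝ) (θ : ℝ) :
    HasDerivAt (fun s => gnu (pathC a b b' s) (pathD d₀ d₁ d₂ s) f)
      (Real.sin θ * Real.cos θ * gnu (pathC a b b' θ) (pathD d₀ d₁ d₂ θ)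
        (repL (fun σ τ => ∑ j, b j σ * b j τ - ∑ j, b' j σ * b' j τ) (fun σ => d₁ σ - d₂ σ) f))
      θ := by
  set c' : ℝ → J₁ ⊕ J₂ → Ω → ℝ := fun s =>
    Sum.elim (fun j σ => Real.cos s * b j σ) (fun j σ => -Real.sin s * b' j σ) with hc'
  set d' : ℝ → Ω → ℝ := fun s σ => Real.sin s * Real.cos s * (2 * (d₁ σ - d₂ σ)) with hd'
  have hc : ∀ t j σ, HasDerivAt (fun s => pathC a b b' s j σ) (c' t j σ) t := by
    rintro t (j | j) σ
    · simpa [pathC, hc'] using ((Real.hasDerivAt_sin t).mul_const (b j σ)).const_add (a j σ)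
    · simpa [pathC, hc'] using (Real.hasDerivAt_cos t).mul_const (b' j σ)
  have hd : ∀ t σ, HasDerivAt (fun s => pathD d₀ d₁ d₂ s σ) (d' t σ) t := by
    intro t σ
    unfold pathD
    refine (((((Real.hasDerivAt_sin t).pow 2).mul_const (d₁ σ)).const_add (d₀ σ)).add
      (((Real.hasDerivAt_cos t).pow 2).mul_const (d₂ σ))).congr_deriv ?_
    simp [hd']; ring
  have hsin := fun t => Real.abs_sin_le_one t
  have hcos := fun t => Real.abs_cos_le_one t
  set B : ℝ := (∑ j, ∑ σ, |b j σ|) + (∑ j, ∑ σ, |b' j σ|) + ∑ σ, |2 * (d₁ σ - d₂ σ)| with hB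
  have n1 : 0 ≤ ∑ j, ∑ σ, |b j σ| := by positivity
  have n2 : 0 ≤ ∑ j, ∑ σ, |b' j σ| := by positivity
  have n3 : 0 ≤ ∑ σ, |2 * (d₁ σ - d₂ σ)| := by positivity
  have hcB : ∀ t j σ, |c' t j σ| ≤ B := by
    rintro t (j | j) σ
    · have h1 : |b j σ| ≤ ∑ j, ∑ σ, |b j σ| :=
        (Finset.single_le_sum (f := fun τ => |b j τ|) (fun _ _ => abs_nonneg _)
          (Finset.mem_univ σ)).trans (Finset.single_le_sum (f := fun j => ∑ τ, |b j τ|)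
            (fun _ _ => by positivity) (Finset.mem_univ j))
      have h2 : |Real.cos t * b j σ| ≤ |b j σ| := by
        rw [abs_mul]; exact mul_le_of_le_one_left (abs_nonneg _) (hcos t)
      simp only [hc', Sum.elim_inl]; linarith
    · have h1 : |b' j σ| ≤ ∑ j, ∑ σ, |b' j σ| :=
        (Finset.single_le_sum (f := fun τ => |b' j τ|) (fun _ _ => abs_nonneg _)
          (Finset.mem_univ σ)).trans (Finset.single_le_sum (f := fun j => ∑ τ, |b' j τ|)
            (fun _ _ => by positivity) (Finset.mem_univ j))
      have h2 : |-Real.sin t * b' j σ| ≤ |b' j σ| := by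
        rw [abs_mul, abs_neg]; exact mul_le_of_le_one_left (abs_nonneg _) (hsin t)
      simp only [hc', Sum.elim_inr]; linarith
  have hdB : ∀ t σ, |d' t σ| ≤ B := by
    intro t σ
    have h1 : |2 * (d₁ σ - d₂ σ)| ≤ ∑ σ, |2 * (d₁ σ - d₂ σ)| :=
      Finset.single_le_sum (f := fun σ => |2 * (d₁ σ - d₂ σ)|) (fun _ _ => abs_nonneg _)
        (Finset.mem_univ σ)
    have h2 : |d' t σ| ≤ |2 * (d₁ σ - d₂ σ)| := by
      simp only [hd']
      rw [abs_mul]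
      refine mul_le_of_le_one_left (abs_nonneg _) ?_
      rw [abs_mul]
      exact mul_le_one₀ (hsin t) (abs_nonneg _) (hcos t)
    linarith
  refine (hasDerivAt_gnu hc hd hcB hdB f θ).congr_deriv ?_
  rw [← gnu_comp_injective _ _ (Option.some_injective (Option κ)) (repDiff (d' θ) f), ← gnu_sum,
    ← gnu_add, ← gnu_const_mul]
  congr 1
  funext σ
  have e1 : ∀ j, repDiff (pathC a b b' θ j) (repDiff (c' θ j) f) σ
      = f (fun k => σ (some (some k))) *
        ∑ x, ∑ y, repW κ x y * (c' θ j (σ x) * pathC a b b' θ j (σ y)) := by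
    intro j
    rw [sum_repW_mul (fun x => c' θ j (σ x)) (fun y => pathC a b b' θ j (σ y))]
    simp only [repDiff, Fintype.card_option, Nat.cast_add, Nat.cast_one]
    ring
  have e2 : repDiff (d' θ) f (σ ∘ some) = f (fun k => σ (some (some k))) *
      ∑ x, ∑ y, repW κ x y * (if x = y then d' θ (σ x) else 0) := by
    rw [sum_repW_diag (fun x => d' θ (σ x))]
    rfl
  simp_rw [e1, e2, ← Finset.mul_sum]
  rw [← mul_add]
  unfold repL
  rw [mul_left_comm]
  congr 1
  rw [Finset.sum_comm, ← Finset.sum_add_distrib, Finset.mul_sum]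
  refine Finset.sum_congr rfl fun x _ => ?_
  rw [Finset.sum_comm, ← Finset.sum_add_distrib, Finset.mul_sum]
  refine Finset.sum_congr rfl fun y _ => ?_
  rw [← Finset.mul_sum, ← mul_add, mul_left_comm]
  congr 1
  rw [mul_add]
  congr 1
  · simp only [Fintype.sum_sum_type, hc', pathC, Sum.elim_inl, Sum.elim_inr]
    rw [mul_sub, Finset.mul_sum, Finset.mul_sum, sub_eq_add_neg, ← Finset.sum_neg_distrib]
    congr 1
    · refine Finset.sum_congr rfl fun j _ => ?_
      linear_combination Real.cos θ * hab j (σ y) (σ x)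
    · exact Finset.sum_congr rfl fun j _ => by ring
  · split_ifs
    · rfl
    · simp

end Path

/-! ### Endpoints of an interpolation path -/

section Endpoints

variable {Ω κ J₁ J₂ : Type*} [Fintype Ω] [Nonempty Ω] [Fintype κ] [DecidableEq κ]
  [Fintype J₁] [Fintype J₂]

lemma integral_gauss_sumType {F : (J₁ ⊕ J₂ → ℝ) → ℝ} (hF : Integrable F (gauss (J₁ ⊕ J₂))) :
    ∫ g, F g ∂gauss (J₁ ⊕ J₂) = ∫ g₁, ∫ g₂, F (Sum.elim g₁ g₂) ∂gauss J₂ ∂gauss J₁ := by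
  have mp := measurePreserving_sumPiEquivProdPi_symm (X := fun _ : J₁ ⊕ J₂ => ℝ)
    (fun _ : J₁ ⊕ J₂ => gaussianReal 0 1)
  have h1 := mp.integral_comp' (g := F)
  rw [← h1]
  exact integral_prod _ (mp.integrable_comp_of_integrable hF)

lemma linH_sumElim (c₁ : J₁ → Ω → ℝ) (c₂ : J₂ → Ω → ℝ) (d : Ω → ℝ) (g₁ : J₁ → ℝ)
    (g₂ : J₂ → ℝ) (σ : Ω) :
    linH (Sum.elim c₁ c₂) d (Sum.elim g₁ g₂) σ
      = ∑ j, c₁ j σ * g₁ j + ∑ j, c₂ j σ * g₂ j + d σ := by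
  simp [linH, Fintype.sum_sum_type]

lemma gnu_sumElim (c₁ : J₁ → Ω → ℝ) (c₂ : J₂ → Ω → ℝ) (d : Ω → ℝ) (f : (κ → Ω) → ℝ) :
    gnu (Sum.elim c₁ c₂) d f = ∫ g₁, ∫ g₂,
      ravg (fun σ => ∑ j, c₁ j σ * g₁ j + ∑ j, c₂ j σ * g₂ j + d σ) f ∂gauss J₂ ∂gauss J₁ := by
  unfold gnu
  rw [integral_gauss_sumType (integrable_ravg _ d f)]
  have : ∀ g₁ g₂, linH (Sum.elim c₁ c₂) d (Sum.elim g₁ g₂)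
      = fun σ => ∑ j, c₁ j σ * g₁ j + ∑ j, c₂ j σ * g₂ j + d σ :=
    fun g₁ g₂ => funext fun σ => linH_sumElim c₁ c₂ d g₁ g₂ σ
  simp_rw [this]

lemma gnu_sumElim_zero_right (c : J₁ → Ω → ℝ) (d : Ω → ℝ) (f : (κ → Ω) → ℝ) :
    gnu (Sum.elim c (fun (_ : J₂) _ => 0)) d f = gnu c d f := by
  rw [gnu_sumElim]
  simp [gnu]
  rfl

lemma gnu_sumElim_zero_left (c : J₂ → Ω → ℝ) (d : Ω → ℝ) (f : (κ → Ω) → ℝ) :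
    gnu (Sum.elim (fun (_ : J₁) _ => 0) c) d f = gnu c d f := by
  rw [gnu_sumElim]
  simp [gnu]
  rfl

lemma gnu_path_pi_div_two (a b : J₁ → Ω → ℝ) (b' : J₂ → Ω → ℝ) (d₀ d₁ d₂ : Ω → ℝ)
    (f : (κ → Ω) → ℝ) :
    gnu (pathC a b b' (Real.pi / 2)) (pathD d₀ d₁ d₂ (Real.pi / 2)) f
      = gnu (fun j σ => a j σ + b j σ) (fun σ => d₀ σ + d₁ σ) f := by
  rw [← gnu_sumElim_zero_right (J₂ := J₂) (fun j σ => a j σ + b j σ)]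
  congr 1
  · funext j; cases j <;> simp [pathC]
  · funext σ; simp [pathD]

lemma gnu_path_zero (a b : J₁ → Ω → ℝ) (b' : J₂ → Ω → ℝ) (d₀ d₁ d₂ : Ω → ℝ)
    (f : (κ → Ω) → ℝ) :
    gnu (pathC a b b' 0) (pathD d₀ d₁ d₂ 0) f
      = gnu (Sum.elim a b') (fun σ => d₀ σ + d₂ σ) f := by
  congr 1
  · funext j; cases j <;> simp [pathC]
  · funext σ; simp [pathD]

end Endpoints

lemma abs_sin_mul_cos_le (θ : ℝ) : |Real.sin θ * Real.cos θ| ≤ 1 / 2 := by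
  have h := Real.sin_two_mul θ
  have := Real.abs_sin_le_one (2 * θ)
  rw [h, mul_assoc, abs_mul, abs_two] at this
  linarith

/-- The bound uses `|sin θ cos θ| ≤ 1 / 2` and `π / 2 ≤ 2`. -/
lemma path_first_order {v D : ℝ → ℝ}
    (hv : ∀ θ, HasDerivAt v (Real.sin θ * Real.cos θ * D θ) θ) {C : ℝ}
    (hC : ∀ θ ∈ Set.Icc 0 (Real.pi / 2), |D θ| ≤ C) {θ : ℝ} (hθ : θ ∈ Set.Icc 0 (Real.pi / 2)) :
    |v θ - v 0| ≤ C := by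
  have hpi := Real.pi_pos
  have h0 : (0 : ℝ) ∈ Set.Icc 0 (Real.pi / 2) := ⟨le_rfl, by positivity⟩
  have hC0 : 0 ≤ C := (abs_nonneg _).trans (hC 0 h0)
  have := (convex_Icc 0 (Real.pi / 2)).norm_image_sub_le_of_norm_hasDerivWithin_le (f := v)
    (C := C / 2) (fun x _ => (hv x).hasDerivWithinAt) (fun x hx => by
      rw [Real.norm_eq_abs, abs_mul]
      have h1 := abs_sin_mul_cos_le x
      have h2 := hC x hx
      calc _ ≤ 1 / 2 * C := mul_le_mul h1 h2 (abs_nonneg _) (by norm_num)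
        _ = C / 2 := by ring) h0 hθ
  rw [Real.norm_eq_abs, Real.norm_eq_abs, sub_zero, abs_of_nonneg hθ.1] at this
  have h4 : θ ≤ 2 := hθ.2.trans (by linarith [Real.pi_le_four])
  nlinarith

/-- Since `sin θ cos θ` integrates to `1 / 2` over the path, `1 / 2 * D 0` is the leading term of the
increment of `v`. -/
lemma path_second_order {v D : ℝ → ℝ}
    (hv : ∀ θ, HasDerivAt v (Real.sin θ * Real.cos θ * D θ) θ) {C : ℝ}
    (hC : ∀ θ ∈ Set.Icc 0 (Real.pi / 2), |D θ - D 0| ≤ C) :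
    |v (Real.pi / 2) - v 0 - 1 / 2 * D 0| ≤ C := by
  have hpi := Real.pi_pos
  have := path_first_order (v := fun θ => v θ - 1 / 2 * D 0 * Real.sin θ ^ 2)
    (D := fun θ => D θ - D 0) (fun θ => by
      refine ((hv θ).sub (((Real.hasDerivAt_sin θ).pow 2).const_mul (1 / 2 * D 0))).congr_deriv ?_
      simp; ring) hC (θ := Real.pi / 2) ⟨by positivity, le_rfl⟩
  simp at this
  convert this using 2
  ring

/-- Along an interpolation path, a nonnegative quantity whose derivative it dominates is
controlled by its final value. -/
lemma path_gronwall {v D : ℝ → ℝ}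
    (hv : ∀ θ, HasDerivAt v (Real.sin θ * Real.cos θ * D θ) θ) {C : ℝ} (h0 : 0 ≤ C)
    (hpos : ∀ θ, 0 ≤ v θ) (hC : ∀ θ, |D θ| ≤ C * v θ) {θ : ℝ}
    (hθ : θ ∈ Set.Icc 0 (Real.pi / 2)) :
    v θ ≤ Real.exp (2 * C) * v (Real.pi / 2) := by
  have hpi := Real.pi_pos
  have hm : Monotone fun θ => Real.exp (C * θ) * v θ := by
    refine monotone_of_hasDerivAt_nonneg (f' := fun θ => Real.exp (C * θ) *
      (C * v θ + Real.sin θ * Real.cos θ * D θ)) (fun x => ?_) (fun x => ?_)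
    · refine ((((hasDerivAt_id x).const_mul C).exp).mul (hv x)).congr_deriv ?_
      simp; ring
    · refine mul_nonneg (Real.exp_pos _).le ?_
      have h1 := abs_sin_mul_cos_le x
      have h2 : |Real.sin x * Real.cos x * D x| ≤ 1 / 2 * (C * v x) := by
        rw [abs_mul]; exact mul_le_mul h1 (hC x) (abs_nonneg _) (by norm_num)
      have h3 := (abs_le.1 h2).1
      have h4 : 0 ≤ C * v x := mul_nonneg h0 (hpos x)
      linarith
  have h1 : Real.exp (C * θ) * v θ ≤ Real.exp (C * (Real.pi / 2)) * v (Real.pi / 2) := hm hθ.2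
  have h2 : v θ ≤ Real.exp (C * θ) * v θ :=
    le_mul_of_one_le_left (hpos θ) (Real.one_le_exp (mul_nonneg h0 hθ.1))
  refine h2.trans (h1.trans (mul_le_mul_of_nonneg_right (Real.exp_le_exp.2 ?_) (hpos _)))
  have : Real.pi / 2 ≤ 2 := by linarith [Real.pi_le_four]
  nlinarith

lemma abs_repL_le {Ω κ : Type*} [Fintype κ] [DecidableEq κ] {V : Ω → Ω → ℝ} {δ : Ω → ℝ}
    {C : ℝ} (f : (κ → Ω) → ℝ) (σ : Option (Option κ) → Ω)
    (h : ∀ x y, |V (σ x) (σ y) + if x = y then 2 * δ (σ x) else 0| ≤ C) :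
    |repL V δ f σ| ≤ |f fun k => σ (some (some k))| * ((∑ x, ∑ y, |repW κ x y|) * C) := by
  unfold repL
  rw [abs_mul]
  refine mul_le_mul_of_nonneg_left ?_ (abs_nonneg _)
  refine (Finset.abs_sum_le_sum_abs _ _).trans ?_
  rw [Finset.sum_mul]
  refine Finset.sum_le_sum fun x _ => (Finset.abs_sum_le_sum_abs _ _).trans ?_
  rw [Finset.sum_mul]
  refine Finset.sum_le_sum fun y _ => ?_
  rw [abs_mul]
  exact mul_le_mul_of_nonneg_left (h x y) (abs_nonneg _)

/-! ### The replica-symmetric equations -/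

lemma Spin.abs_val_le {S : ℕ} (x : Spin S) : |x.val| ≤ S := by
  have h := Finset.mem_Icc.1 x.2
  unfold Spin.val
  rw [abs_le]
  exact ⟨by exact_mod_cast h.1, by exact_mod_cast h.2⟩

instance (S : ℕ) : Nonempty (Spin S) := ⟨⟨0, by simp⟩⟩

/-- The average `ν₀` over the last spins of the replicas labelled by `κ`. -/
noncomputable def nuZ (P : Params) (p q : ℝ) {κ : Type*} [Fintype κ] [DecidableEq κ]
    (f : (κ → Spin P.S) → ℝ) : ℝ :=
  gnu (fun (_ : Unit) ε => P.β * Real.sqrt q * ε.val)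
    (fun ε => P.D * ε.val ^ 2 + P.h * ε.val + P.β ^ 2 / 2 * (p - q) * ε.val ^ 2) f

lemma nuZero_eq (P : Params) (p q : ℝ) {m : ℕ} (f : (Fin m → ℝ) → ℝ) :
    nuZero P p q f = nuZ P p q fun ε : Fin m → Spin P.S => f fun k => (ε k).val := by
  unfold nuZero nuZ gnu
  have mp := measurePreserving_funUnique (gaussianReal 0 1) Unit
  rw [← mp.integral_comp']
  congr 1
  funext g
  unfold ravg
  refine Finset.sum_congr rfl fun ε _ => ?_
  congr 1
  have : ∀ x : Spin P.S, cavityWeight P p q (g ()) x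
      = Real.exp (linH (fun (_ : Unit) (ε : Spin P.S) => P.β * Real.sqrt q * ε.val)
        (fun ε => P.D * ε.val ^ 2 + P.h * ε.val + P.β ^ 2 / 2 * (p - q) * ε.val ^ 2) g x) := by
    intro x
    simp only [cavityWeight, linH, Finset.univ_unique, PUnit.default_eq_unit, Finset.sum_singleton]
    congr 1; ring
  refine Finset.prod_congr rfl fun k _ => ?_
  unfold boltz
  rw [← this]
  simp_rw [← this]
  rfl

/-- The average over the last spins is Lipschitz in `(p, q)`, with a constant of order `β ^ 2`: the two
laws are joined by an interpolation path. Nothing is assumed about the signs of `q₁` and `q₂`; since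
`√q` vanishes for negative `q`, the covariance of the field is governed by `max q 0`. -/
lemma nuZ_dist_le (P : Params) {p₁ q₁ p₂ q₂ R : ℝ} (hp : |p₁ - p₂| ≤ R) (hq : |q₁ - q₂| ≤ R)
    {κ : Type*} [Fintype κ] [DecidableEq κ] {f : (κ → Spin P.S) → ℝ} {B : ℝ}
    (hf : ∀ σ, |f σ| ≤ B) :
    |nuZ P p₁ q₁ f - nuZ P p₂ q₂ f|
      ≤ B * ((∑ x, ∑ y, |repW κ x y|) * (3 * P.β ^ 2 * P.S ^ 2 * R)) := by
  have hR : 0 ≤ R := (abs_nonneg _).trans hp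
  set a : Unit → Spin P.S → ℝ := fun _ _ => 0
  set b : Unit → Spin P.S → ℝ := fun _ ε => P.β * Real.sqrt q₁ * ε.val with hb
  set b' : Unit → Spin P.S → ℝ := fun _ ε => P.β * Real.sqrt q₂ * ε.val with hb'
  set d₀ : Spin P.S → ℝ := fun ε => P.D * ε.val ^ 2 + P.h * ε.val
  set d₁ : Spin P.S → ℝ := fun ε => P.β ^ 2 / 2 * (p₁ - q₁) * ε.val ^ 2 with hd₁
  set d₂ : Spin P.S → ℝ := fun ε => P.β ^ 2 / 2 * (p₂ - q₂) * ε.val ^ 2 with hd₂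
  have key := path_first_order (fun θ => hasDerivAt_gnu_path (a := a) (b := b)
    (by simp [a]) b' d₀ d₁ d₂ f θ)
    (C := B * ((∑ x, ∑ y, |repW κ x y|) * (3 * P.β ^ 2 * P.S ^ 2 * R))) (fun θ _ => by
      refine (abs_gnu_le_gnu _ _ (g := fun _ =>
        B * ((∑ x, ∑ y, |repW κ x y|) * (3 * P.β ^ 2 * P.S ^ 2 * R))) fun σ => ?_).trans
        (gnu_const _ _ _).le
      refine (abs_repL_le (C := 3 * P.β ^ 2 * P.S ^ 2 * R) f σ fun x y => ?_).trans
        (mul_le_mul_of_nonneg_right (hf _) (by positivity))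
      have hsq : ∀ q : ℝ, Real.sqrt q * Real.sqrt q = max q 0 := fun q => by
        rcases le_total 0 q with h | h
        · rw [Real.mul_self_sqrt h, max_eq_left h]
        · rw [Real.sqrt_eq_zero_of_nonpos h, max_eq_right h, mul_zero]
      have hv : ∀ x y, |(σ x).val * (σ y).val| ≤ (P.S : ℝ) ^ 2 := fun x y => by
        rw [abs_mul, sq]
        exact mul_le_mul (σ x).abs_val_le (σ y).abs_val_le (abs_nonneg _) (Nat.cast_nonneg _)
      have e1 : (∑ j, b j (σ x) * b j (σ y) - ∑ j, b' j (σ x) * b' j (σ y))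
          = P.β ^ 2 * (max q₁ 0 - max q₂ 0) * ((σ x).val * (σ y).val) := by
        simp only [hb, hb', Finset.univ_unique, Finset.sum_singleton]
        rw [← hsq, ← hsq]; ring
      have h1 : |max q₁ 0 - max q₂ 0| ≤ R := (abs_max_sub_max_le_abs _ _ _).trans hq
      have b1 : |P.β ^ 2 * (max q₁ 0 - max q₂ 0) * ((σ x).val * (σ y).val)|
          ≤ P.β ^ 2 * P.S ^ 2 * R := by
        rw [abs_mul, abs_mul, abs_of_nonneg (sq_nonneg P.β)]
        calc _ ≤ P.β ^ 2 * R * (P.S : ℝ) ^ 2 :=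
              mul_le_mul (mul_le_mul_of_nonneg_left h1 (sq_nonneg _)) (hv x y) (abs_nonneg _)
                (by positivity)
          _ = _ := by ring
      have b2 : |if x = y then 2 * (d₁ (σ x) - d₂ (σ x)) else 0| ≤ 2 * P.β ^ 2 * P.S ^ 2 * R := by
        split_ifs with hxy
        · have : 2 * (d₁ (σ x) - d₂ (σ x))
              = P.β ^ 2 * ((p₁ - p₂) - (q₁ - q₂)) * ((σ x).val * (σ x).val) := by
            simp only [hd₁, hd₂]; ring
          rw [this, abs_mul, abs_mul, abs_of_nonneg (sq_nonneg P.β)]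
          have h2 : |(p₁ - p₂) - (q₁ - q₂)| ≤ 2 * R := (abs_sub _ _).trans (by linarith)
          calc _ ≤ P.β ^ 2 * (2 * R) * (P.S : ℝ) ^ 2 :=
                mul_le_mul (mul_le_mul_of_nonneg_left h2 (sq_nonneg _)) (hv x x) (abs_nonneg _)
                  (by positivity)
            _ = _ := by ring
        · rw [abs_zero]; positivity
      rw [e1]
      exact (abs_add_le _ _).trans (by linarith))
    (θ := Real.pi / 2) ⟨by positivity, le_rfl⟩
  rw [gnu_path_pi_div_two, gnu_path_zero] at key
  simp only [a, zero_add] at key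
  rwa [gnu_sumElim_zero_left] at key

/-- At high temperature the replica-symmetric equations have exactly one solution, because their
right-hand sides define a contraction of the plane. -/
theorem exists_unique_isReplicaSymmetric (P : Params)
    (hβ : (P.S : ℝ) ^ 2 * ((∑ x, ∑ y, |repW (Fin 2) x y|) * (3 * P.β ^ 2 * P.S ^ 2)) < 1) :
    ∃ p q : ℝ, IsReplicaSymmetric P p q ∧
      ∀ p' q' : ℝ, IsReplicaSymmetric P p' q' → p' = p ∧ q' = q := by
  set L : ℝ := (P.S : ℝ) ^ 2 * ((∑ x, ∑ y, |repW (Fin 2) x y|) * (3 * P.β ^ 2 * P.S ^ 2)) with hL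
  have hL0 : 0 ≤ L := by positivity
  set Φ : ℝ × ℝ → ℝ × ℝ := fun z => (nuZero P z.1 z.2 (fun ε : Fin 2 → ℝ => ε 0 * ε 0),
    nuZero P z.1 z.2 (fun ε : Fin 2 → ℝ => ε 0 * ε 1)) with hΦ
  have hb : ∀ (i j : Fin 2) (σ : Fin 2 → Spin P.S), |(σ i).val * (σ j).val| ≤ (P.S : ℝ) ^ 2 :=
    fun i j σ => by
      rw [abs_mul, sq]
      exact mul_le_mul (σ i).abs_val_le (σ j).abs_val_le (abs_nonneg _) (Nat.cast_nonneg _)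
  have hlip : LipschitzWith L.toNNReal Φ := by
    refine LipschitzWith.of_dist_le_mul fun z z' => ?_
    have h1 : |z.1 - z'.1| ≤ dist z z' := by
      rw [← Real.dist_eq]; exact le_max_left _ _
    have h2 : |z.2 - z'.2| ≤ dist z z' := by
      rw [← Real.dist_eq]; exact le_max_right _ _
    rw [Prod.dist_eq, Real.dist_eq, Real.dist_eq]
    simp only [hΦ, nuZero_eq, Real.coe_toNNReal L hL0]
    refine max_le ((nuZ_dist_le P h1 h2 (hb 0 0)).trans (le_of_eq ?_))
      ((nuZ_dist_le P h1 h2 (hb 0 1)).trans (le_of_eq ?_)) <;>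
    · simp only [hL]; ring
  have hc : ContractingWith L.toNNReal Φ := ⟨Real.toNNReal_lt_one.2 hβ, hlip⟩
  have hiff : ∀ p q, IsReplicaSymmetric P p q ↔ Function.IsFixedPt Φ (p, q) := by
    intro p q
    simp only [IsReplicaSymmetric, Function.IsFixedPt, hΦ, Prod.mk.injEq]
    exact and_congr eq_comm eq_comm
  refine ⟨(hc.fixedPoint Φ).1, (hc.fixedPoint Φ).2, (hiff _ _).2 hc.fixedPoint_isFixedPt, ?_⟩
  intro p' q' h
  have := hc.fixedPoint_unique ((hiff _ _).1 h)
  exact ⟨congrArg Prod.fst this, congrArg Prod.snd this⟩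

/-! ### Product structure of Gibbs averages -/

section Product

variable {κ : Type*} [Fintype κ] [DecidableEq κ]

lemma boltz_prodEquiv {Ω A B : Type*} [Fintype Ω] [Fintype A] [Fintype B] (e : Ω ≃ A × B)
    {H : Ω → ℝ} {hA : A → ℝ} {hB : B → ℝ} (hH : ∀ σ, H σ = hA (e σ).1 + hB (e σ).2) (σ : Ω) :
    boltz H σ = boltz hA (e σ).1 * boltz hB (e σ).2 := by
  unfold boltz
  have : ∑ τ, Real.exp (H τ) = (∑ a, Real.exp (hA a)) * ∑ b, Real.exp (hB b) := by
    rw [Fintype.sum_mul_sum, ← Fintype.sum_prod_type', ← e.sum_comp]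
    exact Finset.sum_congr rfl fun τ _ => by rw [hH, Real.exp_add]
  rw [this, hH, Real.exp_add, mul_div_mul_comm]

/-- Replicas of two independent systems. -/
lemma ravg_prodEquiv {Ω A B : Type*} [Fintype Ω] [Fintype A] [Fintype B] (e : Ω ≃ A × B)
    {H : Ω → ℝ} {hA : A → ℝ} {hB : B → ℝ} (hH : ∀ σ, H σ = hA (e σ).1 + hB (e σ).2)
    (F : (κ → A) → ℝ) (G : (κ → B) → ℝ) :
    ravg H (fun σ => F (fun k => (e (σ k)).1) * G (fun k => (e (σ k)).2))
      = ravg hA F * ravg hB G := by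
  unfold ravg
  rw [Fintype.sum_mul_sum, ← Fintype.sum_prod_type']
  refine Fintype.sum_equiv ((Equiv.arrowCongr (Equiv.refl κ) e).trans
    (Equiv.arrowProdEquivProdArrow κ (fun _ => A) (fun _ => B))) _ _ fun σ => ?_
  simp_rw [boltz_prodEquiv e hH, Finset.prod_mul_distrib]
  simp only [Equiv.trans_apply, Equiv.arrowProdEquivProdArrow, Equiv.coe_fn_mk,
    Equiv.arrowCongr_apply, Equiv.coe_refl, Function.comp_apply, Equiv.refl_symm, id_eq]
  ring

lemma boltz_pi {I A : Type*} [Fintype I] [DecidableEq I] [Fintype A] (h : I → A → ℝ) (σ : I → A) :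
    boltz (fun σ : I → A => ∑ i, h i (σ i)) σ = ∏ i, boltz (h i) (σ i) := by
  unfold boltz
  simp_rw [Real.exp_sum]
  rw [← Fintype.prod_sum (fun i a => Real.exp (h i a)), Finset.prod_div_distrib]

/-- Replicas of a family of independent systems. -/
lemma ravg_pi {I A : Type*} [Fintype I] [DecidableEq I] [Fintype A] (h : I → A → ℝ)
    (F : I → (κ → A) → ℝ) :
    ravg (fun σ : I → A => ∑ i, h i (σ i)) (fun σ : κ → I → A => ∏ i, F i fun k => σ k i)
      = ∏ i, ravg (h i) (F i) := by
  unfold ravg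
  rw [Fintype.prod_sum]
  refine Fintype.sum_equiv (Equiv.piComm fun (_ : κ) (_ : I) => A) _ _ fun σ => ?_
  simp_rw [boltz_pi, Finset.prod_mul_distrib]
  congr 1
  exact Finset.prod_comm

end Product

/-! ### The overlaps -/

/-- The replica-symmetric value of the overlap of the replicas `x` and `y`. -/
def mu (p q : ℝ) {K : Type*} [DecidableEq K] (x y : K) : ℝ := if x = y then p else q

/-- The overlap of the replicas `x` and `y`, centered at its replica-symmetric value. -/
noncomputable def ov (p q : ℝ) {S N : ℕ} {K : Type*} [DecidableEq K] (σ : K → Config S N)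
    (x y : K) : ℝ :=
  1 / (N : ℝ) * ∑ i, (σ x i).val * (σ y i).val - mu p q x y

/-- The coefficients of the couplings in the Hamiltonian. -/
noncomputable def coupC (P : Params) (N : ℕ) (e : Pair N) (σ : Config P.S N) : ℝ :=
  P.β / Real.sqrt N * ((σ e.1.1).val * (σ e.1.2).val)

/-- The part of the Hamiltonian that does not depend on the couplings. -/
noncomputable def fieldD (P : Params) (N : ℕ) (σ : Config P.S N) : ℝ :=
  P.D * ∑ i, (σ i).val ^ 2 + P.h * ∑ i, (σ i).val

lemma hamiltonian_eq (P : Params) {N : ℕ} (g : Disorder N) :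
    hamiltonian P g = linH (coupC P N) (fieldD P N) g := by
  funext σ
  simp only [hamiltonian, linH, coupC, fieldD, Finset.mul_sum]
  rw [add_assoc]
  congr 1
  exact Finset.sum_congr rfl fun e _ => by ring

/-- The average `ν` of a function of the replicas labelled by `κ`. -/
noncomputable def nuK (P : Params) (N : ℕ) {κ : Type*} [Fintype κ] [DecidableEq κ]
    (f : (κ → Config P.S N) → ℝ) : ℝ :=
  gnu (coupC P N) (fieldD P N) f

lemma gibbsAvg_eq (P : Params) {N n : ℕ} (g : Disorder N) (f : (Fin n → Config P.S N) → ℝ) :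
    gibbsAvg P g f = ravg (linH (coupC P N) (fieldD P N) g) f := by
  rw [← hamiltonian_eq]
  rfl

lemma ov_comm (p q : ℝ) {S N : ℕ} {K : Type*} [DecidableEq K] (σ : K → Config S N) (x y : K) :
    ov p q σ x y = ov p q σ y x := by
  unfold ov mu
  simp_rw [mul_comm (σ x _).val, eq_comm (a := x)]

lemma ov_comp (p q : ℝ) {S N : ℕ} {K K' : Type*} [DecidableEq K] [DecidableEq K']
    (σ : K' → Config S N) {j : K → K'} (hj : Function.Injective j) (x y : K) :
    ov p q (σ ∘ j) x y = ov p q σ (j x) (j y) := by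
  simp [ov, mu, hj.eq_iff]

lemma sum_pair {N : ℕ} (x : Fin N → ℝ) :
    ∑ e : Pair N, x e.1.1 * x e.1.2 = 1 / 2 * ((∑ i, x i) ^ 2 - ∑ i, x i ^ 2) := by
  have h1 : ∑ e : Pair N, x e.1.1 * x e.1.2
      = ∑ i, ∑ j, if i < j then x i * x j else 0 := by
    rw [← Fintype.sum_prod_type' (f := fun i j => if i < j then x i * x j else 0),
      ← Finset.sum_filter]
    exact (Finset.sum_subtype (Finset.univ.filter fun e : Fin N × Fin N => e.1 < e.2)
      (by simp) fun e => x e.1 * x e.2).symm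
  have h2 : ∑ i, ∑ j, (if j < i then x i * x j else 0)
      = ∑ i, ∑ j, if i < j then x i * x j else 0 := by
    rw [Finset.sum_comm]
    exact Finset.sum_congr rfl fun i _ => Finset.sum_congr rfl fun j _ => by
      rw [mul_comm]
  have h3 : ∑ i, x i ^ 2 = ∑ i, ∑ j, if i = j then x i * x j else 0 :=
    Finset.sum_congr rfl fun i _ => by simp [sq]
  have h4 : (∑ i, x i) ^ 2 = ∑ i, ∑ j, (if i < j then x i * x j else 0)
      + ∑ i, ∑ j, (if j < i then x i * x j else 0) + ∑ i, ∑ j, if i = j then x i * x j else 0 := by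
    rw [sq, Finset.sum_mul_sum, ← Finset.sum_add_distrib, ← Finset.sum_add_distrib]
    refine Finset.sum_congr rfl fun i _ => ?_
    rw [← Finset.sum_add_distrib, ← Finset.sum_add_distrib]
    refine Finset.sum_congr rfl fun j _ => ?_
    rcases lt_trichotomy i j with h | h | h
    · simp [h, h.ne, h.not_gt]
    · simp [h]
    · simp [h, h.ne', h.not_gt]
  rw [h4, h1, h2, h3]; ring

/-! ### Exponential concentration of the overlaps -/

lemma integrable_exp_sq_gaussianReal :
    Integrable (fun z : ℝ => Real.exp (z ^ 2 / 4)) (gaussianReal 0 1) := by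
  rw [gaussianReal_of_var_ne_zero _ one_ne_zero,
    integrable_withDensity_iff_integrable_smul₀' (measurable_gaussianPDF 0 1).aemeasurable
      (by simp [gaussianPDF_lt_top])]
  simp only [toReal_gaussianPDF, smul_eq_mul]
  refine ((integrable_exp_neg_mul_sq (b := 1 / 4) (by norm_num)).const_mul
    (Real.sqrt (2 * Real.pi))⁻¹).congr (Filter.Eventually.of_forall fun z => ?_)
  simp only [gaussianPDFReal]
  rw [mul_assoc, ← Real.exp_add]
  simp only [NNReal.coe_one, mul_one, sub_zero]
  congr 2
  ring

lemma exp_sq_eq_integral (t : ℝ) :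
    Real.exp (t ^ 2 / 2) = ∫ z, Real.exp (t * z) ∂gaussianReal 0 1 := by
  have := congrFun (mgf_id_gaussianReal (μ := 0) (v := 1)) t
  simp only [mgf, id_eq] at this
  rw [this]; simp

/-- A centered bounded variable has sub-Gaussian exponential moments. -/
lemma gnu_exp_le {Ω κ J : Type*} [Fintype Ω] [Nonempty Ω] [Fintype κ] [DecidableEq κ] [Fintype J]
    (c : J → Ω → ℝ) (d : Ω → ℝ) {X : (κ → Ω) → ℝ} {B : ℝ} (hB : 0 < B) (hX : ∀ σ, |X σ| ≤ B)
    (h0 : gnu c d X = 0) (s : ℝ) :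
    gnu c d (fun σ => Real.exp (s * X σ)) ≤ Real.exp ((s * B) ^ 2 / 2) := by
  have hconv : ∀ σ, Real.exp (s * X σ) ≤ Real.cosh (s * B) + Real.sinh (s * B) / B * X σ := by
    intro σ
    have h := abs_le.1 (hX σ)
    have w1 : 0 ≤ (1 + X σ / B) / 2 := by
      have : -1 ≤ X σ / B := by rw [le_div_iff₀ hB]; linarith
      linarith
    have w2 : 0 ≤ (1 - X σ / B) / 2 := by
      have : X σ / B ≤ 1 := by rw [div_le_iff₀ hB]; linarith
      linarith
    have hcv := convexOn_exp.2
    have := hcv (Set.mem_univ (s * B)) (Set.mem_univ (-(s * B))) w1 w2 (by ring)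
    simp only [smul_eq_mul] at this
    have e : (1 + X σ / B) / 2 * (s * B) + (1 - X σ / B) / 2 * -(s * B) = s * X σ := by
      field_simp; ring
    rw [e] at this
    refine this.trans (le_of_eq ?_)
    rw [Real.cosh_eq, Real.sinh_eq]; ring
  refine (gnu_mono c d hconv).trans ?_
  rw [gnu_add, gnu_const, gnu_const_mul, h0, mul_zero, add_zero]
  exact Real.cosh_le_exp_half_sq _

/-- The average of a product over sites when the sites are independent. -/
lemma gnu_pi {κ : Type*} [Fintype κ] [DecidableEq κ] {I A : Type*} [Fintype I] [DecidableEq I]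
    [Fintype A] [Nonempty A] (c d : A → ℝ) (F : I → (κ → A) → ℝ) :
    gnu (fun (i : I) (σ : I → A) => c (σ i)) (fun σ => ∑ i, d (σ i))
      (fun σ : κ → I → A => ∏ i, F i fun k => σ k i)
      = ∏ i, gnu (fun (_ : Unit) a => c a) d (F i) := by
  unfold gnu
  have h1 : ∀ g : I → ℝ, linH (fun (i : I) (σ : I → A) => c (σ i)) (fun σ => ∑ i, d (σ i)) g
      = fun σ => ∑ i, (c (σ i) * g i + d (σ i)) := by
    intro g; funext σ; simp [linH, Finset.sum_add_distrib]
  simp_rw [h1]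
  have h2 : ∀ g : I → ℝ, ravg (fun σ : I → A => ∑ i, (c (σ i) * g i + d (σ i)))
      (fun σ : κ → I → A => ∏ i, F i fun k => σ k i)
      = ∏ i, ravg (fun a => c a * g i + d a) (F i) := fun g =>
    ravg_pi (fun i a => c a * g i + d a) F
  simp_rw [h2]
  rw [integral_fintype_prod_eq_prod (μ := fun _ : I => gaussianReal 0 1)
    (fun i x => ravg (fun a => c a * x + d a) (F i))]
  refine Finset.prod_congr rfl fun i _ => ?_
  rw [← (measurePreserving_funUnique (gaussianReal 0 1) Unit).integral_comp']
  congr 1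
  funext g
  congr 1
  funext a
  simp [linH, MeasurableEquiv.funUnique]

/-- When the sites are independent, the overlaps have Gaussian concentration. -/
lemma gnu_exp_ov_sq_le {κ : Type*} [Fintype κ] [DecidableEq κ] {S N : ℕ} (hN : 1 ≤ N)
    (c d : Spin S → ℝ) {p q : ℝ} {x y : κ} {B : ℝ} (hB : 0 < B)
    (hX : ∀ ε : κ → Spin S, |(ε x).val * (ε y).val - mu p q x y| ≤ B)
    (h0 : gnu (fun (_ : Unit) a => c a) d
      (fun ε : κ → Spin S => (ε x).val * (ε y).val - mu p q x y) = 0)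
    {l : ℝ} (hl : 0 ≤ l) (hlB : l * B ^ 2 ≤ 1 / 4) :
    gnu (fun (i : Fin N) (σ : Config S N) => c (σ i)) (fun σ => ∑ i, d (σ i))
      (fun σ : κ → Config S N => Real.exp (l * N * ov p q σ x y ^ 2))
      ≤ ∫ z, Real.exp (z ^ 2 / 4) ∂gaussianReal 0 1 := by
  have hN0 : (0 : ℝ) < N := by exact_mod_cast hN
  set X : (κ → Spin S) → ℝ := fun ε => (ε x).val * (ε y).val - mu p q x y with hXdef
  set C := fun (i : Fin N) (σ : Config S N) => c (σ i)
  set D := fun σ : Config S N => ∑ i, d (σ i)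
  set s : ℝ := Real.sqrt (2 * l / N) with hs
  have hs2 : s ^ 2 = 2 * l / N := Real.sq_sqrt (by positivity)
  have hov : ∀ σ : κ → Config S N, N * ov p q σ x y = ∑ i, X fun k => σ k i := by
    intro σ
    simp only [ov, hXdef, Finset.sum_sub_distrib]
    simp; field_simp
  have hexp : ∀ σ : κ → Config S N, Real.exp (l * N * ov p q σ x y ^ 2)
      = ∫ z, ∏ i, Real.exp (s * z * X fun k => σ k i) ∂gaussianReal 0 1 := by
    intro σ
    have : l * N * ov p q σ x y ^ 2 = (s * ∑ i, X fun k => σ k i) ^ 2 / 2 := by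
      rw [← hov, mul_pow, hs2]; field_simp
    rw [this, exp_sq_eq_integral]
    congr 1; funext z
    rw [← Real.exp_sum, ← Finset.mul_sum]; congr 1; ring
  have hint : ∀ σ : κ → Config S N,
      Integrable (fun z => ∏ i, Real.exp (s * z * X fun k => σ k i)) (gaussianReal 0 1) := by
    intro σ
    have : (fun z => ∏ i, Real.exp (s * z * X fun k => σ k i))
        = fun z => Real.exp ((s * ∑ i, X fun k => σ k i) * z) := by
      funext z; rw [← Real.exp_sum, ← Finset.mul_sum]; congr 1; ring
    rw [this]
    exact integrable_exp_mul_gaussianReal _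
  -- the finite sum over configurations is taken out of the integral over `z`
  have hdelta : ∀ f : (κ → Config S N) → ℝ, gnu C D f
      = ∑ τ, f τ * gnu C D (fun σ => if σ = τ then 1 else 0) := by
    intro f
    simp_rw [← gnu_const_mul]
    rw [← gnu_sum]
    congr 1; funext σ; simp
  have hswap : gnu C D (fun σ : κ → Config S N => Real.exp (l * N * ov p q σ x y ^ 2))
      = ∫ z, gnu C D (fun σ : κ → Config S N => ∏ i, Real.exp (s * z * X fun k => σ k i))
        ∂gaussianReal 0 1 := by
    rw [hdelta]
    simp_rw [hexp]
    conv_rhs => enter [2, z]; rw [hdelta]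
    rw [integral_finsetSum _ fun τ _ => (hint τ).mul_const _]
    exact Finset.sum_congr rfl fun τ _ => (integral_mul_const _ _).symm
  rw [hswap]
  have hle : ∀ z, gnu C D (fun σ : κ → Config S N => ∏ i, Real.exp (s * z * X fun k => σ k i))
      ≤ Real.exp (z ^ 2 / 4) := by
    intro z
    have := gnu_pi (I := Fin N) c d (fun _ ε => Real.exp (s * z * X ε))
    rw [this, Finset.prod_const, Finset.card_univ, Fintype.card_fin]
    refine (pow_le_pow_left₀ (gnu_nonneg _ _ fun _ => (Real.exp_pos _).le)
      (gnu_exp_le _ d hB hX h0 (s * z)) N).trans ?_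
    rw [← Real.exp_nat_mul, Real.exp_le_exp]
    calc (N : ℝ) * ((s * z * B) ^ 2 / 2) = s ^ 2 * N / 2 * B ^ 2 * z ^ 2 := by ring
      _ = l * B ^ 2 * z ^ 2 := by rw [hs2]; field_simp
      _ ≤ 1 / 4 * z ^ 2 := mul_le_mul_of_nonneg_right hlB (sq_nonneg z)
      _ = z ^ 2 / 4 := by ring
  refine integral_mono_of_nonneg (Filter.Eventually.of_forall fun z =>
    gnu_nonneg _ _ fun σ => Finset.prod_nonneg fun _ _ => (Real.exp_pos _).le)
    integrable_exp_sq_gaussianReal (Filter.Eventually.of_forall hle)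

/-! ### Moments of the last spins -/

lemma ravg_prod {Ω κ : Type*} [Fintype Ω] [Fintype κ] [DecidableEq κ] (H : Ω → ℝ)
    (F : κ → Ω → ℝ) :
    ravg H (fun ε => ∏ k, F k (ε k)) = ∏ k, ∑ x, F k x * boltz H x := by
  unfold ravg
  rw [Fintype.prod_sum]
  simp_rw [Finset.prod_mul_distrib]

/-- The moment of order `a` of the last spin, for a given value of its Gaussian field. -/
noncomputable def siteMom (P : Params) (p q : ℝ) (a : ℕ) (g : Unit → ℝ) : ℝ :=
  ∑ x : Spin P.S, x.val ^ a * boltz (linH (fun (_ : Unit) ε => P.β * Real.sqrt q * ε.val)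
    (fun ε => P.D * ε.val ^ 2 + P.h * ε.val + P.β ^ 2 / 2 * (p - q) * ε.val ^ 2) g) x

/-- The joint moment of four independent last spins in the same Gaussian field. -/
noncomputable def mom (P : Params) (p q : ℝ) (a b c d : ℕ) : ℝ :=
  ∫ g, siteMom P p q a g * siteMom P p q b g * siteMom P p q c g * siteMom P p q d g ∂gauss Unit

section Moments

variable {P : Params} {p q : ℝ} {κ : Type*} [Fintype κ] [DecidableEq κ]

lemma siteMom_zero (g : Unit → ℝ) : siteMom P p q 0 g = 1 := by
  simp only [siteMom, pow_zero, one_mul]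
  exact sum_boltz _

lemma nuZ_prod_pow {m : ℕ} (e : Fin m → ℕ) {j : Fin m → κ} (hj : Function.Injective j) :
    nuZ P p q (fun ε : κ → Spin P.S => ∏ k, (ε (j k)).val ^ e k)
      = ∫ g, ∏ k, siteMom P p q (e k) g ∂gauss Unit := by
  have := gnu_comp_injective (fun (_ : Unit) ε => P.β * Real.sqrt q * ε.val)
    (fun ε : Spin P.S => P.D * ε.val ^ 2 + P.h * ε.val + P.β ^ 2 / 2 * (p - q) * ε.val ^ 2) hj
    (fun ε => ∏ k, (ε k).val ^ e k)
  unfold nuZ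
  refine this.trans ?_
  unfold gnu
  congr 1
  funext g
  exact ravg_prod _ fun k (x : Spin P.S) => x.val ^ e k

lemma nuZ_pow_one (a : ℕ) (x : κ) :
    nuZ P p q (fun ε : κ → Spin P.S => (ε x).val ^ a) = mom P p q a 0 0 0 := by
  have := nuZ_prod_pow (P := P) (p := p) (q := q) ![a] (j := ![x])
    (Function.injective_of_subsingleton _)
  simpa [mom, siteMom_zero] using this

lemma nuZ_pow_two (a b : ℕ) {x y : κ} (h : x ≠ y) :
    nuZ P p q (fun ε : κ → Spin P.S => (ε x).val ^ a * (ε y).val ^ b) = mom P p q a b 0 0 := by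
  have hj : Function.Injective ![x, y] := by
    intro i j; fin_cases i <;> fin_cases j <;> simp [h, h.symm]
  have := nuZ_prod_pow (P := P) (p := p) (q := q) ![a, b] hj
  simpa [mom, siteMom_zero, Fin.prod_univ_succ] using this

lemma nuZ_pow_three (a b c : ℕ) {x y z : κ} (hxy : x ≠ y) (hxz : x ≠ z) (hyz : y ≠ z) :
    nuZ P p q (fun ε : κ → Spin P.S => (ε x).val ^ a * (ε y).val ^ b * (ε z).val ^ c)
      = mom P p q a b c 0 := by
  have hj : Function.Injective ![x, y, z] := by
    intro i j
    fin_cases i <;> fin_cases j <;> simp [hxy, hxz, hyz, hxy.symm, hxz.symm, hyz.symm]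
  have := nuZ_prod_pow (P := P) (p := p) (q := q) ![a, b, c] hj
  simpa [mom, siteMom_zero, Fin.prod_univ_succ, mul_assoc] using this

lemma nuZ_pow_four (a b c d : ℕ) {x y z w : κ} (hxy : x ≠ y) (hxz : x ≠ z) (hxw : x ≠ w)
    (hyz : y ≠ z) (hyw : y ≠ w) (hzw : z ≠ w) :
    nuZ P p q (fun ε : κ → Spin P.S =>
      (ε x).val ^ a * (ε y).val ^ b * (ε z).val ^ c * (ε w).val ^ d) = mom P p q a b c d := by
  have hj : Function.Injective ![x, y, z, w] := by
    intro i j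
    fin_cases i <;> fin_cases j <;> simp [hxy, hxz, hyz, hxy.symm, hxz.symm, hyz.symm,
      hxw, hyw, hzw, hxw.symm, hyw.symm, hzw.symm]
  have := nuZ_prod_pow (P := P) (p := p) (q := q) ![a, b, c, d] hj
  simpa [mom, Fin.prod_univ_succ, mul_assoc] using this

lemma nuZ_sub (f g : (κ → Spin P.S) → ℝ) :
    nuZ P p q (fun ε => f ε - g ε) = nuZ P p q f - nuZ P p q g := gnu_sub _ _ _ _

lemma nuZ_const_mul (a : ℝ) (f : (κ → Spin P.S) → ℝ) :
    nuZ P p q (fun ε => a * f ε) = a * nuZ P p q f := gnu_const_mul _ _ _ _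

lemma IsReplicaSymmetric.eq_mom (h : IsReplicaSymmetric P p q) :
    p = mom P p q 2 0 0 0 ∧ q = mom P p q 1 1 0 0 := by
  obtain ⟨h1, h2⟩ := h
  rw [nuZero_eq] at h1 h2
  refine ⟨h1.trans ?_, h2.trans ?_⟩
  · rw [← nuZ_pow_one 2 (0 : Fin 2)]; congr 1; funext ε; ring
  · rw [← nuZ_pow_two 1 1 (zero_ne_one : (0 : Fin 2) ≠ 1)]; congr 1; funext ε; ring

lemma IsReplicaSymmetric.nuZ_eq (h : IsReplicaSymmetric P p q) (x y : κ) :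
    nuZ P p q (fun ε : κ → Spin P.S => (ε x).val * (ε y).val) = mu p q x y := by
  by_cases hxy : x = y
  · subst hxy
    rw [mu, if_pos rfl]
    refine Eq.trans ?_ h.eq_mom.1.symm
    rw [← nuZ_pow_one 2 x]; congr 1; funext ε; ring
  · rw [mu, if_neg hxy]
    refine Eq.trans ?_ h.eq_mom.2.symm
    rw [← nuZ_pow_two 1 1 hxy]; congr 1; funext ε; ring

lemma IsReplicaSymmetric.nuZ_sub_mu (h : IsReplicaSymmetric P p q) (x y : κ) :
    nuZ P p q (fun ε : κ → Spin P.S => (ε x).val * (ε y).val - mu p q x y) = 0 := by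
  rw [nuZ_sub, h.nuZ_eq]
  unfold nuZ
  rw [gnu_const, sub_self]

lemma abs_val_mul_val_le {S : ℕ} (x y : Spin S) : |x.val * y.val| ≤ (S : ℝ) ^ 2 := by
  rw [abs_mul, sq]
  exact mul_le_mul x.abs_val_le y.abs_val_le (abs_nonneg _) (Nat.cast_nonneg _)

lemma IsReplicaSymmetric.abs_mu_le (h : IsReplicaSymmetric P p q) (x y : κ) :
    |mu p q x y| ≤ (P.S : ℝ) ^ 2 := by
  rw [← h.nuZ_eq x y]
  refine (abs_gnu_le_gnu _ _ (g := fun _ => (P.S : ℝ) ^ 2) fun ε => ?_).trans (gnu_const _ _ _).le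
  exact abs_val_mul_val_le _ _

lemma IsReplicaSymmetric.abs_sub_mu_le (h : IsReplicaSymmetric P p q) (x y : κ)
    (ε : κ → Spin P.S) : |(ε x).val * (ε y).val - mu p q x y| ≤ 2 * (P.S : ℝ) ^ 2 := by
  refine (abs_sub _ _).trans ?_
  linarith [abs_val_mul_val_le (ε x) (ε y), h.abs_mu_le x y]

lemma IsReplicaSymmetric.q_nonneg (h : IsReplicaSymmetric P p q) : 0 ≤ q := by
  rw [h.eq_mom.2]
  refine integral_nonneg fun g => ?_
  simp only [siteMom_zero, mul_one]
  exact mul_self_nonneg _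

/-! ### The constants in terms of the moments of the last spins -/

lemma cA_eq : cA P p q = mom P p q 2 2 0 0 - 2 * mom P p q 2 1 1 0 + mom P p q 1 1 1 1 := by
  unfold cA
  rw [nuZero_eq]
  have : (fun ε : Fin 4 → Spin P.S => ((ε 0).val - (ε 2).val) * ((ε 1).val - (ε 3).val) *
      ((ε 0).val * (ε 1).val)) = fun ε => ((ε 0).val ^ 2 * (ε 1).val ^ 2
      - (ε 1).val ^ 2 * (ε 0).val ^ 1 * (ε 2).val ^ 1)
      - ((ε 0).val ^ 2 * (ε 1).val ^ 1 * (ε 3).val ^ 1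
      - (ε 0).val ^ 1 * (ε 1).val ^ 1 * (ε 2).val ^ 1 * (ε 3).val ^ 1) := by
    funext ε; ring
  rw [this, nuZ_sub, nuZ_sub, nuZ_sub, nuZ_pow_two, nuZ_pow_three, nuZ_pow_three, nuZ_pow_four]
  · ring
  all_goals decide

lemma cD_eq : cD P p q = mom P p q 4 0 0 0 - mom P p q 2 2 0 0 := by
  unfold cD
  rw [nuZero_eq]
  have : (fun ε : Fin 4 → Spin P.S => ((ε 0).val ^ 2 - (ε 1).val ^ 2) * (ε 0).val ^ 2)
      = fun ε => (ε 0).val ^ 4 - (ε 1).val ^ 2 * (ε 0).val ^ 2 := by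
    funext ε; ring
  rw [this, nuZ_sub, nuZ_pow_two, nuZ_pow_one]
  decide

lemma cE_eq : cE P p q = mom P p q 3 1 0 0 - mom P p q 2 1 1 0 := by
  unfold cE
  rw [nuZero_eq]
  have : (fun ε : Fin 4 → Spin P.S => ((ε 0).val ^ 2 - (ε 1).val ^ 2) * ((ε 0).val * (ε 2).val))
      = fun ε => (ε 0).val ^ 3 * (ε 2).val ^ 1
        - (ε 1).val ^ 2 * (ε 0).val ^ 1 * (ε 2).val ^ 1 := by
    funext ε; ring
  rw [this, nuZ_sub, nuZ_pow_two, nuZ_pow_three]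
  all_goals decide

lemma cF_eq : cF P p q = mom P p q 2 2 0 0 - mom P p q 2 1 1 0 := by
  unfold cF
  rw [nuZero_eq]
  have : (fun ε : Fin 4 → Spin P.S => ((ε 0).val * (ε 2).val - (ε 1).val * (ε 2).val) *
        ((ε 0).val * (ε 2).val))
      = fun ε => (ε 0).val ^ 2 * (ε 2).val ^ 2
        - (ε 2).val ^ 2 * (ε 0).val ^ 1 * (ε 1).val ^ 1 := by
    funext ε; ring
  rw [this, nuZ_sub, nuZ_pow_two, nuZ_pow_three]
  all_goals decide

lemma cG_eq : cG P p q = mom P p q 2 1 1 0 - mom P p q 1 1 1 1 := by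
  unfold cG
  rw [nuZero_eq]
  have : (fun ε : Fin 4 → Spin P.S => ((ε 0).val * (ε 2).val - (ε 1).val * (ε 2).val) *
        ((ε 0).val * (ε 3).val))
      = fun ε => (ε 0).val ^ 2 * (ε 2).val ^ 1 * (ε 3).val ^ 1
        - (ε 0).val ^ 1 * (ε 1).val ^ 1 * (ε 2).val ^ 1 * (ε 3).val ^ 1 := by
    funext ε; ring
  rw [this, nuZ_sub, nuZ_pow_three, nuZ_pow_four]
  all_goals decide

lemma IsReplicaSymmetric.cI3_eq (h : IsReplicaSymmetric P p q) :
    cI3 P p q = mom P p q 1 1 1 1 - q * q := by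
  unfold cI3
  rw [nuZero_eq]
  have : (fun ε : Fin 4 → Spin P.S => ((ε 0).val * (ε 1).val - q) * ((ε 2).val * (ε 3).val))
      = fun ε => (ε 0).val ^ 1 * (ε 1).val ^ 1 * (ε 2).val ^ 1 * (ε 3).val ^ 1
        - q * ((ε 2).val * (ε 3).val) := by
    funext ε; ring
  rw [this, nuZ_sub, nuZ_const_mul, h.nuZ_eq, nuZ_pow_four]
  · simp [mu]
  all_goals decide

lemma IsReplicaSymmetric.cI5_eq (h : IsReplicaSymmetric P p q) :
    cI5 P p q = mom P p q 2 1 1 0 - q * p := by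
  unfold cI5
  rw [nuZero_eq]
  have : (fun ε : Fin 4 → Spin P.S => ((ε 0).val * (ε 1).val - q) * (ε 2).val ^ 2)
      = fun ε => (ε 2).val ^ 2 * (ε 0).val ^ 1 * (ε 1).val ^ 1
        - q * ((ε 2).val * (ε 2).val) := by
    funext ε; ring
  rw [this, nuZ_sub, nuZ_const_mul, h.nuZ_eq, nuZ_pow_three]
  · simp [mu]
  all_goals decide

lemma IsReplicaSymmetric.cK3_eq (h : IsReplicaSymmetric P p q) :
    cK3 P p q = mom P p q 2 1 1 0 - p * q := by
  unfold cK3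
  rw [nuZero_eq]
  have : (fun ε : Fin 4 → Spin P.S => ((ε 0).val ^ 2 - p) * ((ε 1).val * (ε 2).val))
      = fun ε => (ε 0).val ^ 2 * (ε 1).val ^ 1 * (ε 2).val ^ 1
        - p * ((ε 1).val * (ε 2).val) := by
    funext ε; ring
  rw [this, nuZ_sub, nuZ_const_mul, h.nuZ_eq, nuZ_pow_three]
  · simp [mu]
  all_goals decide

lemma IsReplicaSymmetric.cK4_eq (h : IsReplicaSymmetric P p q) :
    cK4 P p q = mom P p q 2 2 0 0 - p * p := by
  unfold cK4
  rw [nuZero_eq]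
  have : (fun ε : Fin 4 → Spin P.S => ((ε 0).val ^ 2 - p) * (ε 1).val ^ 2)
      = fun ε => (ε 0).val ^ 2 * (ε 1).val ^ 2 - p * ((ε 1).val * (ε 1).val) := by
    funext ε; ring
  rw [this, nuZ_sub, nuZ_const_mul, h.nuZ_eq, nuZ_pow_two]
  · simp [mu]
  all_goals decide

/-- The covariances under `ν₀` of products of two last spins, off-diagonal case. -/
lemma IsReplicaSymmetric.nuZ_offDiag (h : IsReplicaSymmetric P p q) {x y : κ} (hxy : x ≠ y)
    (u w : κ) :
    nuZ P p q (fun ε : κ → Spin P.S =>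
        ((ε x).val * (ε y).val - mu p q x y) * ((ε u).val * (ε w).val))
      = if u = w then cI5 P p q + cE P p q * ((if u = x then 1 else 0) + if u = y then 1 else 0)
        else cI3 P p q + cG P p q * ((if u = x then 1 else 0) + (if w = x then 1 else 0)
          + (if u = y then 1 else 0) + (if w = y then 1 else 0))
          + cA P p q * ((if u = x ∧ w = y then 1 else 0) + if u = y ∧ w = x then 1 else 0) := by
  have e : (fun ε : κ → Spin P.S =>
      ((ε x).val * (ε y).val - mu p q x y) * ((ε u).val * (ε w).val))
      = fun ε => (ε x).val * (ε y).val * ((ε u).val * (ε w).val)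
        - mu p q x y * ((ε u).val * (ε w).val) := by
    funext ε; ring
  rw [e, nuZ_sub, nuZ_const_mul, h.nuZ_eq, cA_eq, cE_eq, cG_eq, h.cI3_eq, h.cI5_eq]
  simp only [mu, if_neg hxy]
  by_cases huw : u = w
  · subst huw
    by_cases hux : u = x
    · subst hux
      have : (fun ε : κ → Spin P.S => (ε u).val * (ε y).val * ((ε u).val * (ε u).val))
          = fun ε => (ε u).val ^ 3 * (ε y).val ^ 1 := by funext ε; ring
      rw [this, nuZ_pow_two _ _ hxy]
      simp [hxy]
    · by_cases huy : u = y
      · subst huy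
        have : (fun ε : κ → Spin P.S => (ε x).val * (ε u).val * ((ε u).val * (ε u).val))
            = fun ε => (ε u).val ^ 3 * (ε x).val ^ 1 := by funext ε; ring
        rw [this, nuZ_pow_two _ _ hux]
        simp [hux]
      · have : (fun ε : κ → Spin P.S => (ε x).val * (ε y).val * ((ε u).val * (ε u).val))
            = fun ε => (ε u).val ^ 2 * (ε x).val ^ 1 * (ε y).val ^ 1 := by funext ε; ring
        rw [this, nuZ_pow_three _ _ _ hux huy hxy]
        simp [hux, huy]
  · have key : ∀ a b c d : κ, a ≠ b → c ≠ d → a ≠ d → b ≠ c → a ≠ c → b ≠ d →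
        nuZ P p q (fun ε : κ → Spin P.S => (ε a).val * (ε b).val * ((ε c).val * (ε d).val))
          = mom P p q 1 1 1 1 := by
      intro a b c d h1 h2 h3 h4 h5 h6
      rw [← nuZ_pow_four 1 1 1 1 h1 h5 h3 h4 h6 h2]
      congr 1; funext ε; ring
    have key3 : ∀ (f : (κ → Spin P.S) → ℝ) (a b c : κ), a ≠ b → a ≠ c → b ≠ c →
        (∀ ε, f ε = (ε a).val ^ 2 * (ε b).val ^ 1 * (ε c).val ^ 1) →
        nuZ P p q f = mom P p q 2 1 1 0 := by
      intro f a b c h1 h2 h3 hf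
      rw [← nuZ_pow_three 2 1 1 h1 h2 h3, ← funext hf]
    have key2 : ∀ (f : (κ → Spin P.S) → ℝ), (∀ ε, f ε = (ε x).val ^ 2 * (ε y).val ^ 2) →
        nuZ P p q f = mom P p q 2 2 0 0 := by
      intro f hf
      rw [← nuZ_pow_two 2 2 hxy, ← funext hf]
    rw [if_neg huw, if_neg huw]
    by_cases hux : u = x
    · subst hux
      by_cases hwy : w = y
      · subst hwy
        rw [key2 _ fun ε => by ring]
        simp [huw, Ne.symm huw]; ring
      · rw [key3 _ u y w hxy huw (Ne.symm hwy) fun ε => by ring]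
        simp [Ne.symm huw, hwy, hxy]
    · by_cases huy : u = y
      · subst huy
        by_cases hwx : w = x
        · subst hwx
          rw [key2 _ fun ε => by ring]
          simp [huw, Ne.symm huw]; ring
        · rw [key3 _ u x w hux huw (Ne.symm hwx) fun ε => by ring]
          simp [Ne.symm huw, hwx, hux]
      · by_cases hwx : w = x
        · subst hwx
          rw [key3 _ w y u hxy (Ne.symm huw) (Ne.symm huy) fun ε => by ring]
          simp [huw, huy, hxy]
        · by_cases hwy : w = y
          · subst hwy
            rw [key3 _ w x u hwx (Ne.symm huw) (Ne.symm hux) fun ε => by ring]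
            simp [huw, hux, hwx]
          · rw [key x y u w hxy huw (Ne.symm hwx) (Ne.symm huy) (Ne.symm hux) (Ne.symm hwy)]
            simp [hux, huy, hwx, hwy]

/-- The covariances under `ν₀` of products of two last spins, diagonal case. -/
lemma IsReplicaSymmetric.nuZ_diag (h : IsReplicaSymmetric P p q) (x u w : κ) :
    nuZ P p q (fun ε : κ → Spin P.S =>
        ((ε x).val * (ε x).val - mu p q x x) * ((ε u).val * (ε w).val))
      = if u = w then cK4 P p q + cD P p q * (if u = x then 1 else 0)
        else cK3 P p q + cE P p q * ((if u = x then 1 else 0) + if w = x then 1 else 0) := by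
  have e : (fun ε : κ → Spin P.S =>
      ((ε x).val * (ε x).val - mu p q x x) * ((ε u).val * (ε w).val))
      = fun ε => (ε x).val * (ε x).val * ((ε u).val * (ε w).val)
        - mu p q x x * ((ε u).val * (ε w).val) := by
    funext ε; ring
  rw [e, nuZ_sub, nuZ_const_mul, h.nuZ_eq, cD_eq, cE_eq, h.cK3_eq, h.cK4_eq]
  simp only [mu, if_true]
  by_cases huw : u = w
  · subst huw
    by_cases hux : u = x
    · subst hux
      have : (fun ε : κ → Spin P.S => (ε u).val * (ε u).val * ((ε u).val * (ε u).val))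
          = fun ε => (ε u).val ^ 4 := by funext ε; ring
      rw [this, nuZ_pow_one]
      simp
    · have : (fun ε : κ → Spin P.S => (ε x).val * (ε x).val * ((ε u).val * (ε u).val))
            = fun ε => (ε x).val ^ 2 * (ε u).val ^ 2 := by funext ε; ring
      rw [this, nuZ_pow_two _ _ (Ne.symm hux)]
      simp [hux]
  · rw [if_neg huw, if_neg huw]
    by_cases hux : u = x
    · subst hux
      have : (fun ε : κ → Spin P.S => (ε u).val * (ε u).val * ((ε u).val * (ε w).val))
          = fun ε => (ε u).val ^ 3 * (ε w).val ^ 1 := by funext ε; ring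
      rw [this, nuZ_pow_two _ _ huw]
      simp [Ne.symm huw]
    · by_cases hwx : w = x
      · subst hwx
        have : (fun ε : κ → Spin P.S => (ε w).val * (ε w).val * ((ε u).val * (ε w).val))
            = fun ε => (ε w).val ^ 3 * (ε u).val ^ 1 := by funext ε; ring
        rw [this, nuZ_pow_two _ _ (Ne.symm huw)]
        simp [huw]
      · have : (fun ε : κ → Spin P.S => (ε x).val * (ε x).val * ((ε u).val * (ε w).val))
            = fun ε => (ε x).val ^ 2 * (ε u).val ^ 1 * (ε w).val ^ 1 := by funext ε; ring
        rw [this, nuZ_pow_three _ _ _ (Ne.symm hux) (Ne.symm hwx) huw]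
        simp [hux, hwx]

end Moments

/-! ### Concentration along the path from independent sites -/

lemma gnu_eq_sum_indicator {Ω κ J : Type*} [Fintype Ω] [Nonempty Ω] [Fintype κ] [DecidableEq κ]
    [Fintype J] [DecidableEq Ω] (c : J → Ω → ℝ) (d : Ω → ℝ) (f : (κ → Ω) → ℝ) :
    gnu c d f = ∑ τ, f τ * gnu c d (fun σ => if σ = τ then 1 else 0) := by
  simp_rw [← gnu_const_mul]
  rw [← gnu_sum]
  congr 1; funext σ; simp

/-- The derivative along an interpolation path when the averaged function moves as well. -/
theorem hasDerivAt_gnu_path_param {Ω κ J₁ J₂ : Type*} [Fintype Ω] [Nonempty Ω] [Fintype κ]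
    [DecidableEq κ] [Fintype J₁] [Fintype J₂] {a b : J₁ → Ω → ℝ}
    (hab : ∀ j σ τ, a j σ * b j τ = 0) (b' : J₂ → Ω → ℝ) (d₀ d₁ d₂ : Ω → ℝ)
    {f : ℝ → (κ → Ω) → ℝ} {f' : (κ → Ω) → ℝ} {θ : ℝ}
    (hf : ∀ σ, HasDerivAt (fun s => f s σ) (f' σ) θ) :
    HasDerivAt (fun s => gnu (pathC a b b' s) (pathD d₀ d₁ d₂ s) (f s))
      (gnu (pathC a b b' θ) (pathD d₀ d₁ d₂ θ) f' +
        Real.sin θ * Real.cos θ * gnu (pathC a b b' θ) (pathD d₀ d₁ d₂ θ)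
        (repL (fun σ τ => ∑ j, b j σ * b j τ - ∑ j, b' j σ * b' j τ) (fun σ => d₁ σ - d₂ σ) (f θ)))
      θ := by
  classical
  have h1 : ∀ s, gnu (pathC a b b' s) (pathD d₀ d₁ d₂ s) (f s) = ∑ τ, f s τ *
      gnu (pathC a b b' s) (pathD d₀ d₁ d₂ s) (fun σ => if σ = τ then 1 else 0) :=
    fun s => gnu_eq_sum_indicator _ _ _
  simp_rw [h1]
  refine (HasDerivAt.fun_sum fun τ _ =>
    (hf τ).mul (hasDerivAt_gnu_path hab b' d₀ d₁ d₂ (fun σ => if σ = τ then 1 else 0) θ)).congr_deriv ?_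
  rw [Finset.sum_add_distrib, ← gnu_eq_sum_indicator]
  congr 1
  simp_rw [mul_left_comm (f θ _), ← Finset.mul_sum]
  congr 1
  simp_rw [← gnu_const_mul]
  rw [← gnu_sum]
  congr 1
  funext σ
  unfold repL
  simp_rw [← mul_assoc, ← Finset.sum_mul]
  congr 1
  simp

section Concentration

variable {P : Params} {p q : ℝ} {N : ℕ} {K : Type*} [Fintype K] [DecidableEq K]

/-- The fields of the decoupled sites. -/
noncomputable def freeC (P : Params) (q : ℝ) (N : ℕ) (i : Fin N) (σ : Config P.S N) : ℝ :=
  P.β * Real.sqrt q * (σ i).val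

/-- The correction to the self-overlap for decoupled sites. -/
noncomputable def freeD (P : Params) (p q : ℝ) (N : ℕ) (σ : Config P.S N) : ℝ :=
  ∑ i, P.β ^ 2 / 2 * (p - q) * (σ i).val ^ 2

/-- The derivative along the path from decoupled sites to the full Hamiltonian is governed by the
squares of the centered overlaps, up to a bounded term and a term that is constant on the diagonal
and off it. -/
lemma vhat_global (hq : 0 ≤ q) (hN : 1 ≤ N) (σ : K → Config P.S N) (x y : K) :
    (∑ e, coupC P N e (σ x) * coupC P N e (σ y) - ∑ i, freeC P q N i (σ x) * freeC P q N i (σ y))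
      + (if x = y then 2 * (0 - freeD P p q N (σ x)) else 0)
      = P.β ^ 2 / 2 * (N * ov p q σ x y ^ 2 - 1 / (N : ℝ) *
          ∑ i, ((σ x i).val * (σ y i).val) ^ 2) - P.β ^ 2 / 2 * N * mu p q x y ^ 2 := by
  have hN0 : (0 : ℝ) < N := by exact_mod_cast hN
  have hsq : Real.sqrt q ^ 2 = q := Real.sq_sqrt hq
  have h1 : ∑ e, coupC P N e (σ x) * coupC P N e (σ y) = P.β ^ 2 / N *
      ∑ e : Pair N, ((σ x e.1.1).val * (σ y e.1.1).val) * ((σ x e.1.2).val * (σ y e.1.2).val) := by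
    rw [Finset.mul_sum]
    refine Finset.sum_congr rfl fun e _ => ?_
    unfold coupC
    rw [show P.β ^ 2 / (N : ℝ) = P.β / Real.sqrt N * (P.β / Real.sqrt N) by
      rw [div_mul_div_comm, ← sq, Real.mul_self_sqrt hN0.le]]
    ring
  have h2 : ∑ i, freeC P q N i (σ x) * freeC P q N i (σ y)
      = P.β ^ 2 * q * ∑ i, (σ x i).val * (σ y i).val := by
    rw [Finset.mul_sum]
    refine Finset.sum_congr rfl fun i _ => ?_
    unfold freeC
    linear_combination (P.β ^ 2 * (σ x i).val * (σ y i).val) * hsq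
  rw [h1, h2, sum_pair (fun i => (σ x i).val * (σ y i).val)]
  unfold ov mu
  split_ifs with hxy
  · subst hxy
    have h3 : freeD P p q N (σ x) = P.β ^ 2 / 2 * (p - q) * ∑ i, (σ x i).val * (σ x i).val := by
      unfold freeD
      rw [Finset.mul_sum]
      exact Finset.sum_congr rfl fun i _ => by ring
    rw [h3]
    field_simp
    ring
  · field_simp
    ring

/-- The term of order `N` in `vhat_global` depends on a pair of replicas only through whether they are
equal, and contributes nothing to the derivative along the path. -/
lemma sum_repW_mu_sq {κ : Type*} [Fintype κ] [DecidableEq κ] (p q : ℝ) :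
    ∑ x, ∑ y, repW κ x y * mu p q x y ^ 2 = 0 := by
  have h : ∀ x y : Option (Option κ), mu p q x y ^ 2
      = 1 * q ^ 2 + if x = y then p ^ 2 - q ^ 2 else 0 := by
    intro x y; unfold mu; split_ifs <;> ring
  simp_rw [h, mul_add, Finset.sum_add_distrib]
  have h1 := sum_repW_mul (κ := κ) (fun _ => 1) (fun _ => q ^ 2)
  have h2 := sum_repW_diag (κ := κ) (fun _ => p ^ 2 - q ^ 2)
  rw [h1, h2]
  simp
  ring

/-- The total multiplicity of the pairs of replicas in the derivative along a path. -/
noncomputable def wbar (κ : Type*) [Fintype κ] [DecidableEq κ] : ℝ := ∑ x, ∑ y, |repW κ x y|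

lemma wbar_nonneg (κ : Type*) [Fintype κ] [DecidableEq κ] : 0 ≤ wbar κ := by
  unfold wbar; positivity

lemma abs_repW_le {κ : Type*} [Fintype κ] [DecidableEq κ] (x y : Option (Option κ)) :
    |repW κ x y| ≤ wbar κ :=
  (Finset.single_le_sum (f := fun y => |repW κ x y|) (fun _ _ => abs_nonneg _)
    (Finset.mem_univ y)).trans (Finset.single_le_sum (f := fun x => ∑ y, |repW κ x y|)
      (fun _ _ => by positivity) (Finset.mem_univ x))

lemma abs_repL_global_le {κ : Type*} [Fintype κ] [DecidableEq κ] (hq : 0 ≤ q) (hN : 1 ≤ N)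
    (f : (κ → Config P.S N) → ℝ) (σ : Option (Option κ) → Config P.S N) :
    |repL (fun σ τ => ∑ e, coupC P N e σ * coupC P N e τ - ∑ i, freeC P q N i σ * freeC P q N i τ)
        (fun σ => 0 - freeD P p q N σ) f σ|
      ≤ P.β ^ 2 / 2 * wbar κ * (|f fun k => σ (some (some k))| *
        ∑ x, ∑ y, (N * ov p q σ x y ^ 2 + (P.S : ℝ) ^ 4)) := by
  have hN0 : (0 : ℝ) < N := by exact_mod_cast hN
  unfold repL
  simp_rw [vhat_global hq hN σ, mul_sub, Finset.sum_sub_distrib]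
  have h0 : ∑ x, ∑ y, repW κ x y * (P.β ^ 2 / 2 * N * mu p q x y ^ 2) = 0 := by
    simp_rw [mul_left_comm (repW κ _ _), ← Finset.mul_sum]
    rw [sum_repW_mu_sq, mul_zero]
  rw [h0, sub_zero, abs_mul]
  rw [mul_left_comm]
  refine mul_le_mul_of_nonneg_left ?_ (abs_nonneg _)
  rw [← Finset.sum_sub_distrib, Finset.mul_sum]
  refine (Finset.abs_sum_le_sum_abs _ _).trans (Finset.sum_le_sum fun x _ => ?_)
  rw [← Finset.sum_sub_distrib, Finset.mul_sum]
  refine (Finset.abs_sum_le_sum_abs _ _).trans (Finset.sum_le_sum fun y _ => ?_)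
  rw [← mul_sub, ← mul_sub, abs_mul, abs_mul, abs_of_nonneg (by positivity : 0 ≤ P.β ^ 2 / 2)]
  have h1 : 0 ≤ 1 / (N : ℝ) * ∑ i, ((σ x i).val * (σ y i).val) ^ 2 := by positivity
  have h2 : 1 / (N : ℝ) * ∑ i, ((σ x i).val * (σ y i).val) ^ 2 ≤ (P.S : ℝ) ^ 4 := by
    have : ∑ i, ((σ x i).val * (σ y i).val) ^ 2 ≤ ∑ _i : Fin N, (P.S : ℝ) ^ 4 := by
      refine Finset.sum_le_sum fun i _ => ?_
      rw [← sq_abs]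
      calc _ ≤ ((P.S : ℝ) ^ 2) ^ 2 :=
            pow_le_pow_left₀ (abs_nonneg _) (abs_val_mul_val_le _ _) 2
        _ = _ := by ring
    simp only [Finset.sum_const, Finset.card_univ, Fintype.card_fin, nsmul_eq_mul] at this
    rw [one_div, inv_mul_le_iff₀ hN0]
    exact this
  have h3 : |N * ov p q σ x y ^ 2 - 1 / (N : ℝ) * ∑ i, ((σ x i).val * (σ y i).val) ^ 2|
      ≤ N * ov p q σ x y ^ 2 + (P.S : ℝ) ^ 4 := by
    refine (abs_sub _ _).trans ?_
    rw [abs_of_nonneg h1, abs_of_nonneg (by positivity)]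
    linarith
  calc |repW κ x y| * (P.β ^ 2 / 2 * _) ≤ wbar κ * (P.β ^ 2 / 2 * _) :=
        mul_le_mul (abs_repW_le x y) (mul_le_mul_of_nonneg_left h3 (by positivity))
          (by positivity) (wbar_nonneg κ)
    _ = _ := by ring

/-- Rearrangement: with the new overlap `x` and the old one `y`, a mixed term is dominated by two
unmixed ones. -/
lemma mul_exp_le {x y l : ℝ} (hl : 0 ≤ l) (hx : 0 ≤ x) (hy : 0 ≤ y) :
    x * Real.exp (l * y) ≤ x * Real.exp (l * x) + y * Real.exp (l * y) := by
  rcases le_total x y with h | h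
  · have := mul_le_mul_of_nonneg_right h (Real.exp_pos (l * y)).le
    have : 0 ≤ x * Real.exp (l * x) := by positivity
    linarith
  · have h2 : Real.exp (l * y) ≤ Real.exp (l * x) :=
      Real.exp_le_exp.2 (mul_le_mul_of_nonneg_left h hl)
    have := mul_le_mul_of_nonneg_left h2 hx
    have : 0 ≤ y * Real.exp (l * y) := by positivity
    linarith

/-- At high temperature the centered overlaps have Gaussian concentration at scale `1 / √N`. The
proof follows the path from decoupled sites, lowering the exponent along the way: the derivative
along the path is at most a small multiple of the derivative in the exponent. -/
theorem nuK_exp_ov_sq_le (hS : 1 ≤ P.S) (h : IsReplicaSymmetric P p q)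
    (hβ : 12 * P.β ^ 2 * wbar (Fin 2) ≤ 1 / (32 * (P.S : ℝ) ^ 4)) (hN : 1 ≤ N) (x y : K) :
    nuK P N (fun σ : K → Config P.S N =>
        Real.exp (1 / (32 * (P.S : ℝ) ^ 4) * (N * ov p q σ x y ^ 2)))
      ≤ Real.exp (4 * P.β ^ 2 * wbar (Fin 2) * P.S ^ 4) *
        (2 * ∫ z, Real.exp (z ^ 2 / 4) ∂gaussianReal 0 1) := by
  have hq := h.q_nonneg
  have hS0 : (0 : ℝ) < P.S := by exact_mod_cast hS
  have hw := wbar_nonneg (Fin 2)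
  set w := wbar (Fin 2) with hwdef
  set l : ℝ := 1 / (16 * (P.S : ℝ) ^ 4) with hl
  have hl2 : 1 / (32 * (P.S : ℝ) ^ 4) = l / 2 := by rw [hl]; field_simp; norm_num
  have hl0 : 0 < l := by positivity
  rw [hl2] at hβ ⊢
  -- The rate at which the exponent is lowered: the derivative of the disorder is a sum over `4 ^ 2`
  -- pairs of replicas with coefficients at most `β ^ 2 / 2 * w`, and `hpair` costs a factor `3`, so it
  -- is bounded by `16 * 3 / 2 * β ^ 2 * w = 2 * a` times the average of `Ψ`.
  set a : ℝ := 12 * P.β ^ 2 * w with ha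
  have ha0 : 0 ≤ a := by positivity
  -- the exponent along the path
  set lam : ℝ → ℝ := fun θ => l - a * Real.sin θ ^ 2 with hlam
  have hlam0 : ∀ θ, 0 ≤ lam θ := fun θ => by
    have : a * Real.sin θ ^ 2 ≤ a * 1 := mul_le_mul_of_nonneg_left (Real.sin_sq_le_one θ) ha0
    simp only [hlam]; linarith
  set X : (Fin 2 → Config P.S N) → ℝ := fun σ => N * ov p q σ 0 1 ^ 2 with hX
  set Y : (Fin 2 → Config P.S N) → ℝ := fun σ => N * ov p q σ 0 0 ^ 2 with hY
  have hX0 : ∀ σ, 0 ≤ X σ := fun σ => by positivity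
  have hY0 : ∀ σ, 0 ≤ Y σ := fun σ => by positivity
  set f : ℝ → (Fin 2 → Config P.S N) → ℝ := fun θ σ =>
    Real.exp (lam θ * X σ) + Real.exp (lam θ * Y σ) with hf
  have hf0 : ∀ θ σ, 0 ≤ f θ σ := fun θ σ => by positivity
  set Ψ : ℝ → (Fin 2 → Config P.S N) → ℝ := fun θ σ =>
    X σ * Real.exp (lam θ * X σ) + Y σ * Real.exp (lam θ * Y σ) with hΨ
  set z : Pair N → Config P.S N → ℝ := fun _ _ => 0 with hz
  set C := pathC z (coupC P N) (freeC P q N) with hC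
  set D := pathD (fieldD P N) (fun _ => 0) (freeD P p q N) with hD
  set v : ℝ → ℝ := fun θ => gnu (C θ) (D θ) (f θ) with hv
  have hlamd : ∀ θ, HasDerivAt lam (-(2 * a * (Real.sin θ * Real.cos θ))) θ := fun θ => by
    refine ((((Real.hasDerivAt_sin θ).pow 2).const_mul a).const_sub l).congr_deriv ?_
    simp; ring
  have hfd : ∀ θ σ, HasDerivAt (fun s => f s σ) (-(2 * a * (Real.sin θ * Real.cos θ)) * Ψ θ σ) θ :=
    fun θ σ => by
      refine ((((hlamd θ).mul_const (X σ)).exp).add (((hlamd θ).mul_const (Y σ)).exp)).congr_deriv ?_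
      simp only [hΨ]; ring
  have hvd := fun θ => hasDerivAt_gnu_path_param (a := z) (b := coupC P N) (by simp [hz])
    (freeC P q N) (fieldD P N) (fun _ => 0) (freeD P p q N) (hfd θ)
  set L : ℝ → ℝ := fun θ => gnu (C θ) (D θ) (repL (fun σ τ => ∑ e, coupC P N e σ * coupC P N e τ
    - ∑ i, freeC P q N i σ * freeC P q N i τ) (fun σ => 0 - freeD P p q N σ) (f θ)) with hL
  have hΨ0 : ∀ θ, 0 ≤ gnu (C θ) (D θ) (Ψ θ) := fun θ => gnu_nonneg _ _ fun σ =>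
    add_nonneg (mul_nonneg (hX0 σ) (Real.exp_pos _).le) (mul_nonneg (hY0 σ) (Real.exp_pos _).le)
  have hLb : ∀ θ, L θ ≤ 2 * a * gnu (C θ) (D θ) (Ψ θ) + 8 * P.β ^ 2 * w * P.S ^ 4 * v θ := by
    intro θ
    have hj : Function.Injective fun k : Fin 2 => some (some k) :=
      fun i j hij => Option.some_injective _ (Option.some_injective _ hij)
    -- each overlap of the new replicas is compared with the two overlaps in the exponent
    have hpair : ∀ x y : Option (Option (Fin 2)),
        gnu (C θ) (D θ) (fun σ : Option (Option (Fin 2)) → Config P.S N =>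
          f θ (fun k => σ (some (some k))) * (N * ov p q σ x y ^ 2))
        ≤ 3 * gnu (C θ) (D θ) (Ψ θ) := by
      intro x y
      have h1 : ∀ σ : Option (Option (Fin 2)) → Config P.S N,
          f θ (fun k => σ (some (some k))) * (N * ov p q σ x y ^ 2)
          ≤ 2 * ((N * ov p q σ x y ^ 2) * Real.exp (lam θ * (N * ov p q σ x y ^ 2)))
            + Ψ θ (σ ∘ fun k => some (some k)) := by
        intro σ
        have h0 : 0 ≤ N * ov p q σ x y ^ 2 := by positivity
        have e1 := mul_exp_le (hlam0 θ) h0 (hX0 (σ ∘ fun k => some (some k)))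
        have e2 := mul_exp_le (hlam0 θ) h0 (hY0 (σ ∘ fun k => some (some k)))
        have e3 : f θ (fun k => σ (some (some k)))
            = Real.exp (lam θ * X (σ ∘ fun k => some (some k)))
              + Real.exp (lam θ * Y (σ ∘ fun k => some (some k))) := rfl
        have e4 : Ψ θ (σ ∘ fun k => some (some k)) = _ := rfl
        simp only [hΨ] at e4
        simp only [hΨ]
        rw [e3]
        linarith
      refine (gnu_mono _ _ h1).trans ?_
      rw [gnu_add, gnu_const_mul, gnu_comp_injective _ _ hj]
      have h2 : gnu (C θ) (D θ) (fun σ : Option (Option (Fin 2)) → Config P.S N =>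
          (N * ov p q σ x y ^ 2) * Real.exp (lam θ * (N * ov p q σ x y ^ 2)))
          ≤ gnu (C θ) (D θ) (Ψ θ) := by
        by_cases hxy : x = y
        · subst hxy
          have hinj : Function.Injective ![x] := Function.injective_of_subsingleton _
          have e1 := gnu_comp_injective (C θ) (D θ) hinj (fun σ : Fin 1 → Config P.S N =>
            (N * ov p q σ 0 0 ^ 2) * Real.exp (lam θ * (N * ov p q σ 0 0 ^ 2)))
          have hinj2 : Function.Injective ![(0 : Fin 2)] := Function.injective_of_subsingleton _
          have e2 := gnu_comp_injective (C θ) (D θ) hinj2 (fun σ : Fin 1 → Config P.S N =>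
            (N * ov p q σ 0 0 ^ 2) * Real.exp (lam θ * (N * ov p q σ 0 0 ^ 2)))
          simp only [ov_comp p q _ hinj, ov_comp p q _ hinj2] at e1 e2
          refine (e1.trans e2.symm).le.trans (gnu_mono _ _ fun σ => ?_)
          exact le_add_of_nonneg_left (mul_nonneg (hX0 σ) (Real.exp_pos _).le)
        · have hinj : Function.Injective ![x, y] := by
            intro i j; fin_cases i <;> fin_cases j <;> simp [hxy, Ne.symm hxy]
          have e1 := gnu_comp_injective (C θ) (D θ) hinj (fun σ : Fin 2 → Config P.S N =>
            (N * ov p q σ 0 1 ^ 2) * Real.exp (lam θ * (N * ov p q σ 0 1 ^ 2)))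
          simp only [ov_comp p q _ hinj] at e1
          refine e1.le.trans (gnu_mono _ _ fun σ => ?_)
          exact le_add_of_nonneg_right (mul_nonneg (hY0 σ) (Real.exp_pos _).le)
      linarith
    refine (le_abs_self _).trans ((abs_gnu_le_gnu _ _ (abs_repL_global_le hq hN (f θ))).trans ?_)
    rw [gnu_const_mul]
    have e1 : (fun σ : Option (Option (Fin 2)) → Config P.S N =>
        |f θ fun k => σ (some (some k))| * ∑ x, ∑ y, (N * ov p q σ x y ^ 2 + (P.S : ℝ) ^ 4))
        = fun σ => ∑ x, ∑ y, (f θ (fun k => σ (some (some k))) * (N * ov p q σ x y ^ 2)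
          + (P.S : ℝ) ^ 4 * f θ (σ ∘ fun k => some (some k))) := by
      funext σ
      rw [abs_of_nonneg (hf0 θ _), Finset.mul_sum]
      refine Finset.sum_congr rfl fun x _ => ?_
      rw [Finset.mul_sum]
      refine Finset.sum_congr rfl fun y _ => ?_
      simp only [Function.comp_def]; ring
    rw [e1, gnu_sum]
    have e2 : ∀ x : Option (Option (Fin 2)), gnu (C θ) (D θ)
        (fun σ : Option (Option (Fin 2)) → Config P.S N =>
          ∑ y, (f θ (fun k => σ (some (some k))) * (N * ov p q σ x y ^ 2)
          + (P.S : ℝ) ^ 4 * f θ (σ ∘ fun k => some (some k))))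
        ≤ 4 * (3 * gnu (C θ) (D θ) (Ψ θ) + (P.S : ℝ) ^ 4 * v θ) := by
      intro x
      rw [gnu_sum]
      calc _ ≤ ∑ _y : Option (Option (Fin 2)),
            (3 * gnu (C θ) (D θ) (Ψ θ) + (P.S : ℝ) ^ 4 * v θ) := by
            refine Finset.sum_le_sum fun y _ => ?_
            rw [gnu_add, gnu_const_mul, gnu_comp_injective _ _ hj]
            exact add_le_add (hpair x y) le_rfl
        _ = _ := by simp; ring
    have e3 : ∑ x : Option (Option (Fin 2)), gnu (C θ) (D θ)
        (fun σ : Option (Option (Fin 2)) → Config P.S N =>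
          ∑ y, (f θ (fun k => σ (some (some k))) * (N * ov p q σ x y ^ 2)
          + (P.S : ℝ) ^ 4 * f θ (σ ∘ fun k => some (some k))))
        ≤ 4 * (4 * (3 * gnu (C θ) (D θ) (Ψ θ) + (P.S : ℝ) ^ 4 * v θ)) := by
      refine (Finset.sum_le_sum fun x _ => e2 x).trans (le_of_eq ?_)
      simp
    refine (mul_le_mul_of_nonneg_left e3 (by positivity)).trans (le_of_eq ?_)
    simp only [ha]; ring
  -- the terms with `Ψ` cancel, and the bounded terms are absorbed in an integrating factor
  set E : ℝ := 4 * P.β ^ 2 * w * P.S ^ 4 with hE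
  have hanti : AntitoneOn (fun θ => Real.exp (-(E * Real.sin θ ^ 2)) * v θ)
      (Set.Icc 0 (Real.pi / 2)) := by
    have hd : ∀ θ, HasDerivAt (fun θ => Real.exp (-(E * Real.sin θ ^ 2)) * v θ)
        (Real.exp (-(E * Real.sin θ ^ 2)) * (Real.sin θ * Real.cos θ *
          (L θ - 2 * a * gnu (C θ) (D θ) (Ψ θ) - 2 * E * v θ))) θ := by
      intro θ
      refine ((((((Real.hasDerivAt_sin θ).pow 2).const_mul E).neg).exp).mul (hvd θ)).congr_deriv ?_
      rw [gnu_const_mul]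
      simp only [hL, hC, hD, hv]
      simp; ring
    refine antitoneOn_of_deriv_nonpos (convex_Icc _ _)
      (fun θ _ => (hd θ).continuousAt.continuousWithinAt)
      (fun θ _ => (hd θ).differentiableAt.differentiableWithinAt) fun θ hθ => ?_
    rw [interior_Icc] at hθ
    rw [(hd θ).deriv]
    have hsc : 0 ≤ Real.sin θ * Real.cos θ := by
      have := Real.pi_pos
      exact mul_nonneg (Real.sin_nonneg_of_nonneg_of_le_pi hθ.1.le (by linarith [hθ.2]))
        (Real.cos_nonneg_of_mem_Icc ⟨by linarith [hθ.1], hθ.2.le⟩)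
    refine mul_nonpos_of_nonneg_of_nonpos (Real.exp_pos _).le
      (mul_nonpos_of_nonneg_of_nonpos hsc ?_)
    have := hLb θ
    simp only [hE]
    linarith
  have hpi := Real.pi_pos
  have hfin := hanti (a := 0) (b := Real.pi / 2) ⟨le_rfl, by positivity⟩ ⟨by positivity, le_rfl⟩
    (by positivity)
  simp only [Real.sin_pi_div_two, Real.sin_zero] at hfin
  simp only [one_pow, mul_one, ne_eq, OfNat.ofNat_ne_zero, not_false_eq_true, zero_pow, mul_zero,
    neg_zero, Real.exp_zero, one_mul] at hfin
  have hfin2 : v (Real.pi / 2) ≤ Real.exp E * v 0 := by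
    have := mul_le_mul_of_nonneg_left hfin (Real.exp_pos E).le
    rwa [← mul_assoc, ← Real.exp_add, add_neg_cancel, Real.exp_zero, one_mul] at this
  have hend : v (Real.pi / 2) = nuK P N (f (Real.pi / 2)) := by
    simp only [hv, hC, hD]
    rw [gnu_path_pi_div_two]
    simp [hz, nuK]
  have hstart : v 0 ≤ 2 * ∫ z, Real.exp (z ^ 2 / 4) ∂gaussianReal 0 1 := by
    simp only [hv, hC, hD]
    rw [gnu_path_zero, hz, gnu_sumElim_zero_left]
    have hdd : (fun σ => fieldD P N σ + freeD P p q N σ) = fun σ : Config P.S N =>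
        ∑ i, (P.D * (σ i).val ^ 2 + P.h * (σ i).val + P.β ^ 2 / 2 * (p - q) * (σ i).val ^ 2) := by
      funext σ
      simp only [fieldD, freeD, Finset.mul_sum, Finset.sum_add_distrib]
    have hlB : l * (2 * (P.S : ℝ) ^ 2) ^ 2 ≤ 1 / 4 := by
      rw [hl]; apply le_of_eq; field_simp; norm_num
    have hb := fun i : Fin 2 => gnu_exp_ov_sq_le (κ := Fin 2) hN
      (fun a : Spin P.S => P.β * Real.sqrt q * a.val)
      (fun a => P.D * a.val ^ 2 + P.h * a.val + P.β ^ 2 / 2 * (p - q) * a.val ^ 2)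
      (p := p) (q := q) (x := 0) (y := i) (B := 2 * (P.S : ℝ) ^ 2) (by positivity)
      (fun ε => h.abs_sub_mu_le _ _ ε) (h.nuZ_sub_mu _ _) hl0.le hlB
    simp only [hf]
    rw [hdd, gnu_add]
    have hlam00 : lam 0 = l := by simp [hlam]
    simp only [hlam00, hX, hY, ← mul_assoc]
    have h1 := hb 1
    have h2 := hb 0
    have e : freeC P q N = fun (i : Fin N) (σ : Config P.S N) => P.β * Real.sqrt q * (σ i).val := rfl
    rw [e]
    linarith
  have hlam1 : l / 2 ≤ lam (Real.pi / 2) := by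
    simp only [hlam, Real.sin_pi_div_two]; linarith
  have hmain : ∀ g : (Fin 2 → Config P.S N) → ℝ, (∀ σ, g σ ≤ f (Real.pi / 2) σ) →
      nuK P N g ≤ Real.exp E * (2 * ∫ z, Real.exp (z ^ 2 / 4) ∂gaussianReal 0 1) := by
    intro g hg
    refine (gnu_mono _ _ hg).trans ?_
    have : gnu (coupC P N) (fieldD P N) (f (Real.pi / 2)) = v (Real.pi / 2) := hend.symm
    rw [this]
    exact hfin2.trans (mul_le_mul_of_nonneg_left hstart (Real.exp_pos _).le)
  by_cases hxy : x = y
  · subst hxy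
    have hinj : Function.Injective ![x] := Function.injective_of_subsingleton _
    have e1 := gnu_comp_injective (coupC P N) (fieldD P N) hinj (fun σ : Fin 1 → Config P.S N =>
      Real.exp (l / 2 * (N * ov p q σ 0 0 ^ 2)))
    have hinj2 : Function.Injective ![(0 : Fin 2)] := Function.injective_of_subsingleton _
    have e2 := gnu_comp_injective (coupC P N) (fieldD P N) hinj2 (fun σ : Fin 1 → Config P.S N =>
      Real.exp (l / 2 * (N * ov p q σ 0 0 ^ 2)))
    simp only [ov_comp p q _ hinj, ov_comp p q _ hinj2] at e1 e2
    refine (e1.trans e2.symm).le.trans (hmain _ fun σ => ?_)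
    refine le_trans ?_ (le_add_of_nonneg_left (Real.exp_pos _).le)
    exact Real.exp_le_exp.2 (mul_le_mul_of_nonneg_right hlam1 (hY0 σ))
  · have hinj : Function.Injective ![x, y] := by
      intro i j; fin_cases i <;> fin_cases j <;> simp [hxy, Ne.symm hxy]
    have e1 := gnu_comp_injective (coupC P N) (fieldD P N) hinj (fun σ : Fin 2 → Config P.S N =>
      Real.exp (l / 2 * (N * ov p q σ 0 1 ^ 2)))
    simp only [ov_comp p q _ hinj] at e1
    refine e1.le.trans (hmain _ fun σ => ?_)
    refine le_trans ?_ (le_add_of_nonneg_right (Real.exp_pos _).le)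
    exact Real.exp_le_exp.2 (mul_le_mul_of_nonneg_right hlam1 (hX0 σ))

end Concentration

/-! ### The cavity path at one site -/

/-- The couplings that do not involve the site `o`. -/
noncomputable def cavA (P : Params) {N : ℕ} (o : Fin N) (e : Pair N) (σ : Config P.S N) : ℝ :=
  if e.1.1 = o ∨ e.1.2 = o then 0 else coupC P N e σ

/-- The couplings that involve the site `o`. -/
noncomputable def cavB (P : Params) {N : ℕ} (o : Fin N) (e : Pair N) (σ : Config P.S N) : ℝ :=
  if e.1.1 = o ∨ e.1.2 = o then coupC P N e σ else 0

/-- The Gaussian field that replaces the couplings of the site `o`. -/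
noncomputable def cavF (P : Params) (q : ℝ) {N : ℕ} (o : Fin N) (_ : Unit) (σ : Config P.S N) : ℝ :=
  P.β * Real.sqrt q * (σ o).val

/-- The self-overlap correction at the site `o`. -/
noncomputable def cavD (P : Params) (p q : ℝ) {N : ℕ} (o : Fin N) (σ : Config P.S N) : ℝ :=
  P.β ^ 2 / 2 * (p - q) * (σ o).val ^ 2

/-- The average along the cavity path at the site `o`: at `θ = π / 2` it is the average of the model,
and at `θ = 0` the site `o` is decoupled from the others. -/
noncomputable def cavNu (P : Params) (p q : ℝ) {N : ℕ} (o : Fin N) (θ : ℝ) {κ : Type*} [Fintype κ]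
    [DecidableEq κ] (f : (κ → Config P.S N) → ℝ) : ℝ :=
  gnu (pathC (cavA P o) (cavB P o) (cavF P q o) θ)
    (pathD (fieldD P N) (fun _ => 0) (cavD P p q o) θ) f

/-- The overlap of the replicas `x` and `y` over the sites other than `o`, centered. -/
noncomputable def ovm (p q : ℝ) {S N : ℕ} {K : Type*} [DecidableEq K] (o : Fin N)
    (σ : K → Config S N) (x y : K) : ℝ :=
  ov p q σ x y - 1 / (N : ℝ) * ((σ x o).val * (σ y o).val)

/-- The operator of differentiation along the cavity path. -/
noncomputable def cavL (P : Params) (p q : ℝ) {N : ℕ} (o : Fin N) {κ : Type*} [Fintype κ]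
    [DecidableEq κ] (f : (κ → Config P.S N) → ℝ) (σ : Option (Option κ) → Config P.S N) : ℝ :=
  f (fun k => σ (some (some k))) *
    ∑ x, ∑ y, repW κ x y * (P.β ^ 2 * ((σ x o).val * (σ y o).val) * ovm p q o σ x y)

section Cavity

variable {P : Params} {p q : ℝ} {N : ℕ} {κ K : Type*} [Fintype κ] [DecidableEq κ]
  [Fintype K] [DecidableEq K]

lemma sum_pair_of_mem {N : ℕ} (o : Fin N) (x : Fin N → ℝ) :
    ∑ e : Pair N, (if e.1.1 = o ∨ e.1.2 = o then x e.1.1 * x e.1.2 else 0)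
      = x o * (∑ i, x i - x o) := by
  have h1 : ∀ e : Pair N, (if e.1.1 = o ∨ e.1.2 = o then x e.1.1 * x e.1.2 else 0)
      = x e.1.1 * x e.1.2 - Function.update x o 0 e.1.1 * Function.update x o 0 e.1.2 := by
    intro e
    by_cases ha : e.1.1 = o
    · simp [ha]
    · by_cases hb : e.1.2 = o
      · simp [hb]
      · simp [ha, hb]
  simp_rw [h1, Finset.sum_sub_distrib]
  have h2 := sum_pair x
  have h3 := sum_pair (Function.update x o 0)
  rw [h2, h3]
  have h4 : ∑ i, Function.update x o 0 i = ∑ i, x i - x o := by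
    rw [Finset.sum_update_of_mem (Finset.mem_univ o), zero_add,
      Finset.sum_eq_sum_sdiff_singleton_add (Finset.mem_univ o) x]
    ring
  have h5 : ∑ i, Function.update x o 0 i ^ 2 = ∑ i, x i ^ 2 - x o ^ 2 := by
    have : ∀ i, Function.update x o 0 i ^ 2 = Function.update (fun i => x i ^ 2) o 0 i := by
      intro i
      by_cases hi : i = o
      · subst hi; simp
      · simp [hi]
    simp_rw [this]
    rw [Finset.sum_update_of_mem (Finset.mem_univ o), zero_add,
      Finset.sum_eq_sum_sdiff_singleton_add (Finset.mem_univ o) (fun i => x i ^ 2)]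
    ring
  rw [h4, h5]; ring

/-- The self-overlap correction `cavD` is such that the difference of the covariances is proportional
to a centered overlap on the diagonal as well. -/
lemma vhat_cavity (hq : 0 ≤ q) (o : Fin N) (σ : K → Config P.S N) (x y : K) :
    (∑ e, cavB P o e (σ x) * cavB P o e (σ y) - ∑ j, cavF P q o j (σ x) * cavF P q o j (σ y))
      + (if x = y then 2 * (0 - cavD P p q o (σ x)) else 0)
      = P.β ^ 2 * ((σ x o).val * (σ y o).val) * ovm p q o σ x y := by
  have hN0 : (0 : ℝ) < N := by exact_mod_cast o.pos
  have hsq : Real.sqrt q ^ 2 = q := Real.sq_sqrt hq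
  have h1 : ∑ e, cavB P o e (σ x) * cavB P o e (σ y) = P.β ^ 2 / N *
      (((σ x o).val * (σ y o).val) *
        (∑ i, (σ x i).val * (σ y i).val - (σ x o).val * (σ y o).val)) := by
    rw [← sum_pair_of_mem o fun i => (σ x i).val * (σ y i).val, Finset.mul_sum]
    refine Finset.sum_congr rfl fun e _ => ?_
    unfold cavB coupC
    split_ifs
    · rw [show P.β ^ 2 / (N : ℝ) = P.β / Real.sqrt N * (P.β / Real.sqrt N) by
        rw [div_mul_div_comm, ← sq, Real.mul_self_sqrt hN0.le]]
      ring
    · ring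
  have h2 : ∑ j, cavF P q o j (σ x) * cavF P q o j (σ y)
      = P.β ^ 2 * q * ((σ x o).val * (σ y o).val) := by
    simp only [cavF, Finset.univ_unique, Finset.sum_singleton]
    linear_combination (P.β ^ 2 * (σ x o).val * (σ y o).val) * hsq
  rw [h1, h2]
  unfold ovm ov mu cavD
  split_ifs with hxy
  · subst hxy; field_simp; ring
  · field_simp; ring

lemma hasDerivAt_cavNu (hq : 0 ≤ q) (o : Fin N) (f : (κ → Config P.S N) → ℝ) (θ : ℝ) :
    HasDerivAt (fun s => cavNu P p q o s f)
      (Real.sin θ * Real.cos θ * cavNu P p q o θ (cavL P p q o f)) θ := by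
  have := hasDerivAt_gnu_path (a := cavA P o) (b := cavB P o) (fun j σ τ => by
    unfold cavA cavB; split_ifs <;> simp) (cavF P q o) (fieldD P N) (fun _ => 0) (cavD P p q o) f θ
  refine this.congr_deriv ?_
  congr 2
  funext σ
  unfold repL cavL
  simp_rw [vhat_cavity hq o σ]

lemma cavNu_pi_div_two (o : Fin N) (f : (κ → Config P.S N) → ℝ) :
    cavNu P p q o (Real.pi / 2) f = nuK P N f := by
  unfold cavNu
  rw [gnu_path_pi_div_two]
  unfold nuK
  congr 1
  · funext e σ; unfold cavA cavB; split_ifs <;> simp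
  · funext σ; simp

instance (S : ℕ) : Zero (Spin S) := ⟨⟨0, by simp⟩⟩

lemma Spin.val_zero {S : ℕ} : (0 : Spin S).val = 0 := by
  change (((⟨0, by simp⟩ : Spin S) : ℤ) : ℝ) = 0
  simp

/-- When the site `o` is decoupled, its spins are independent of the other sites, with the law of
the last spins. -/
lemma cavNu_zero_mul (o : Fin N) (φ : (κ → Spin P.S) → ℝ) {f : (κ → Config P.S N) → ℝ}
    (hf : ∀ σ, f (fun k => Function.update (σ k) o 0) = f σ) :
    cavNu P p q o 0 (fun σ => φ (fun k => σ k o) * f σ) = nuZ P p q φ * cavNu P p q o 0 f := by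
  set e := Equiv.funSplitAt o (Spin P.S) with he
  have hesymm : ∀ σ : Config P.S N, e.symm (0, (e σ).2) = Function.update σ o 0 := by
    intro σ
    funext i
    by_cases hi : i = o
    · subst hi; simp [he, Equiv.funSplitAt, Equiv.piSplitAt]
    · simp [he, Equiv.funSplitAt, Equiv.piSplitAt, hi]
  set hA : (Unit → ℝ) → Spin P.S → ℝ := fun g =>
    linH (fun (_ : Unit) ε => P.β * Real.sqrt q * ε.val)
    (fun ε => P.D * ε.val ^ 2 + P.h * ε.val + P.β ^ 2 / 2 * (p - q) * ε.val ^ 2) g with hhA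
  set hB : (Pair N → ℝ) → ({j // j ≠ o} → Spin P.S) → ℝ := fun g τ =>
    linH (cavA P o) (fieldD P N) g (e.symm (0, τ)) with hhB
  have hsplit : ∀ (g₁ : Pair N → ℝ) (g₂ : Unit → ℝ) (σ : Config P.S N),
      ∑ j, cavA P o j σ * g₁ j + ∑ j, cavF P q o j σ * g₂ j + (fieldD P N σ + cavD P p q o σ)
      = hA g₂ (e σ).1 + hB g₁ (e σ).2 := by
    intro g₁ g₂ σ
    simp only [hhA, hhB, hesymm]
    have e1 : (e σ).1 = σ o := by simp [he, Equiv.funSplitAt, Equiv.piSplitAt]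
    have e2 : ∀ j, cavA P o j (Function.update σ o 0) = cavA P o j σ := by
      intro j
      unfold cavA coupC
      split_ifs with hj
      · rfl
      · push Not at hj
        rw [Function.update_of_ne hj.1, Function.update_of_ne hj.2]
    have e3 : fieldD P N σ = fieldD P N (Function.update σ o 0)
        + (P.D * (σ o).val ^ 2 + P.h * (σ o).val) := by
      unfold fieldD
      rw [← Finset.add_sum_erase _ (fun i => (σ i).val ^ 2) (Finset.mem_univ o),
        ← Finset.add_sum_erase _ (fun i => (σ i).val) (Finset.mem_univ o),
        ← Finset.add_sum_erase _ (fun i => (Function.update σ o 0 i).val ^ 2) (Finset.mem_univ o),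
        ← Finset.add_sum_erase _ (fun i => (Function.update σ o 0 i).val) (Finset.mem_univ o)]
      have e4 : ∑ i ∈ Finset.univ.erase o, (Function.update σ o 0 i).val ^ 2
          = ∑ i ∈ Finset.univ.erase o, (σ i).val ^ 2 := Finset.sum_congr rfl fun i hi => by
        rw [Function.update_of_ne (Finset.ne_of_mem_erase hi)]
      have e5 : ∑ i ∈ Finset.univ.erase o, (Function.update σ o 0 i).val
          = ∑ i ∈ Finset.univ.erase o, (σ i).val := Finset.sum_congr rfl fun i hi => by
        rw [Function.update_of_ne (Finset.ne_of_mem_erase hi)]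
      rw [e4, e5, Function.update_self, Spin.val_zero]
      ring
    simp only [linH, e1, e2, e3, cavF, cavD, Finset.univ_unique, Finset.sum_singleton]
    ring
  set G : (κ → {j // j ≠ o} → Spin P.S) → ℝ := fun τ => f fun k => e.symm (0, τ k) with hG
  have hfG : ∀ σ : κ → Config P.S N, f σ = G fun k => (e (σ k)).2 := by
    intro σ
    simp only [hG, hesymm, hf]
  have hfac : ∀ ψ : (κ → Spin P.S) → ℝ,
      cavNu P p q o 0 (fun σ => ψ (fun k => σ k o) * f σ)
        = nuZ P p q ψ * ∫ g₁, ravg (hB g₁) G ∂gauss (Pair N) := by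
    intro ψ
    unfold cavNu
    rw [gnu_path_zero, gnu_sumElim]
    have hr : ∀ (g₁ : Pair N → ℝ) (g₂ : Unit → ℝ),
        ravg (fun σ => ∑ j, cavA P o j σ * g₁ j + ∑ j, cavF P q o j σ * g₂ j
          + (fieldD P N σ + cavD P p q o σ)) (fun σ => ψ (fun k => σ k o) * f σ)
        = ravg (hA g₂) ψ * ravg (hB g₁) G := by
      intro g₁ g₂
      rw [← ravg_prodEquiv e (hsplit g₁ g₂) ψ G]
      congr 1
      funext σ
      rw [hfG]
      congr 2
    simp_rw [hr]
    simp_rw [integral_mul_const]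
    rw [integral_const_mul]
    rfl
  rw [hfac φ]
  congr 1
  have := hfac fun _ => 1
  simp only [one_mul] at this
  rw [this]
  unfold nuZ
  rw [gnu_const, one_mul]

end Cavity

/-! ### Moments along the cavity path -/

/-- The high-temperature regime, at the solution `(p, q)` of the replica-symmetric equations. -/
structure HighTemp (P : Params) (p q : ℝ) : Prop where
  one_le_spin : 1 ≤ P.S
  isReplicaSymmetric : IsReplicaSymmetric P p q
  /-- The exponent in `nuK_exp_ov_sq_le` stays above half of its initial value. -/
  beta_le : 12 * P.β ^ 2 * wbar (Fin 2) ≤ 1 / (32 * (P.S : ℝ) ^ 4)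

/-- A random variable of order `1 / √N` that dominates all centered overlaps of the replicas
labelled by `K`, as well as `1 / √N`. -/
noncomputable def ovSum (p q : ℝ) {S N : ℕ} {K : Type*} [Fintype K] [DecidableEq K]
    (σ : K → Config S N) : ℝ :=
  1 / Real.sqrt N + ∑ x, ∑ y, |ov p q σ x y|

section Moments

variable {P : Params} {p q : ℝ} {κ K : Type*} [Fintype κ] [DecidableEq κ]
  [Fintype K] [DecidableEq K]

lemma one_div_sqrt_pos {N : ℕ} (hN : 1 ≤ N) : 0 < 1 / Real.sqrt N := by
  have : (0 : ℝ) < N := by exact_mod_cast hN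
  positivity

lemma one_div_eq_sq {N : ℕ} : 1 / (N : ℝ) = (1 / Real.sqrt N) ^ 2 := by
  rw [div_pow, one_pow, Real.sq_sqrt (Nat.cast_nonneg N)]

lemma one_div_sqrt_le_ovSum {S N : ℕ} (σ : K → Config S N) :
    1 / Real.sqrt N ≤ ovSum p q σ :=
  le_add_of_nonneg_right (Finset.sum_nonneg fun _ _ => Finset.sum_nonneg fun _ _ => abs_nonneg _)

lemma ovSum_nonneg {S N : ℕ} (σ : K → Config S N) : 0 ≤ ovSum p q σ :=
  le_trans (by positivity) (one_div_sqrt_le_ovSum σ)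

lemma one_div_le_ovSum_sq {S N : ℕ} (σ : K → Config S N) : 1 / (N : ℝ) ≤ ovSum p q σ ^ 2 := by
  rw [one_div_eq_sq]
  exact pow_le_pow_left₀ (by positivity) (one_div_sqrt_le_ovSum σ) 2

lemma abs_ov_le_ovSum {S N : ℕ} (σ : K → Config S N) (x y : K) :
    |ov p q σ x y| ≤ ovSum p q σ := by
  have h1 := Finset.single_le_sum (f := fun y => |ov p q σ x y|) (fun _ _ => abs_nonneg _)
    (Finset.mem_univ y)
  have h2 := Finset.single_le_sum (f := fun x => ∑ y, |ov p q σ x y|)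
    (fun _ _ => Finset.sum_nonneg fun _ _ => abs_nonneg _) (Finset.mem_univ x)
  have h3 : 0 ≤ 1 / Real.sqrt N := by positivity
  unfold ovSum
  linarith

lemma ovSum_comp_le {S N : ℕ} (σ : K → Config S N) {j : κ → K} (hj : Function.Injective j) :
    ovSum p q (σ ∘ j) ≤ ovSum p q σ := by
  unfold ovSum
  refine add_le_add le_rfl ?_
  simp_rw [ov_comp p q σ hj]
  have hsum : ∀ f : K → ℝ, (∀ x, 0 ≤ f x) → ∑ k, f (j k) ≤ ∑ x, f x := by
    intro f hf
    rw [← Finset.sum_image (f := f) (s := Finset.univ) (g := j) fun a _ b _ h => hj h]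
    exact Finset.sum_le_sum_of_subset_of_nonneg (Finset.subset_univ _) fun x _ _ => hf x
  refine (Finset.sum_le_sum fun k _ => hsum (fun y => |ov p q σ (j k) y|)
    fun _ => abs_nonneg _).trans ?_
  exact hsum (fun x => ∑ y, |ov p q σ x y|) fun _ => Finset.sum_nonneg fun _ _ => abs_nonneg _

lemma abs_ovm_le_ovSum {N : ℕ} (o : Fin N) (σ : K → Config P.S N) (x y : K) :
    |ovm p q o σ x y| ≤ (1 + (P.S : ℝ) ^ 2) * ovSum p q σ := by
  have hN : 1 ≤ N := o.pos
  have hN1 : (1 : ℝ) ≤ Real.sqrt N := by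
    rw [Real.one_le_sqrt]; exact_mod_cast hN
  unfold ovm
  refine (abs_sub _ _).trans ?_
  have h1 := abs_ov_le_ovSum (p := p) (q := q) σ x y
  have h2 := abs_val_mul_val_le (σ x o) (σ y o)
  have h3 : 1 / (N : ℝ) ≤ ovSum p q σ := by
    refine le_trans ?_ (one_div_sqrt_le_ovSum σ)
    rw [one_div_eq_sq, sq]
    refine mul_le_of_le_one_left (by positivity) ?_
    rw [div_le_one (by positivity)]; exact hN1
  rw [abs_mul, abs_of_nonneg (by positivity : (0 : ℝ) ≤ 1 / N)]
  have := mul_le_mul h3 h2 (abs_nonneg _) (ovSum_nonneg σ)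
  linarith

lemma abs_ovm_le (h : IsReplicaSymmetric P p q) {N : ℕ} (o : Fin N) (σ : K → Config P.S N)
    (x y : K) : |ovm p q o σ x y| ≤ 3 * (P.S : ℝ) ^ 2 := by
  have hN : (1 : ℝ) ≤ N := by exact_mod_cast o.pos
  unfold ovm ov
  have h1 := h.abs_mu_le x y
  have h2 := abs_val_mul_val_le (σ x o) (σ y o)
  have h3 : |1 / (N : ℝ) * ∑ i, (σ x i).val * (σ y i).val| ≤ (P.S : ℝ) ^ 2 := by
    rw [abs_mul, abs_of_nonneg (by positivity : (0 : ℝ) ≤ 1 / N), one_div,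
      inv_mul_le_iff₀ (by positivity)]
    refine (Finset.abs_sum_le_sum_abs _ _).trans ((Finset.sum_le_sum fun i _ =>
      abs_val_mul_val_le (σ x i) (σ y i)).trans (le_of_eq ?_))
    simp
  have h4 : |1 / (N : ℝ) * ((σ x o).val * (σ y o).val)| ≤ (P.S : ℝ) ^ 2 := by
    rw [abs_mul, abs_of_nonneg (by positivity : (0 : ℝ) ≤ 1 / N)]
    refine le_trans (mul_le_of_le_one_left (abs_nonneg _) ?_) h2
    rw [div_le_one (by positivity)]; exact hN
  refine (abs_sub _ _).trans ?_
  have := abs_sub (1 / (N : ℝ) * ∑ i, (σ x i).val * (σ y i).val) (mu p q x y)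
  linarith

lemma abs_cavL_le {N : ℕ} (o : Fin N) (f : (κ → Config P.S N) → ℝ)
    (σ : Option (Option κ) → Config P.S N) {C : ℝ} (hC : ∀ x y, |ovm p q o σ x y| ≤ C) :
    |cavL P p q o f σ|
      ≤ |f fun k => σ (some (some k))| * (wbar κ * (P.β ^ 2 * P.S ^ 2 * C)) := by
  unfold cavL wbar
  rw [abs_mul]
  refine mul_le_mul_of_nonneg_left ?_ (abs_nonneg _)
  rw [Finset.sum_mul]
  refine (Finset.abs_sum_le_sum_abs _ _).trans (Finset.sum_le_sum fun x _ => ?_)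
  rw [Finset.sum_mul]
  refine (Finset.abs_sum_le_sum_abs _ _).trans (Finset.sum_le_sum fun y _ => ?_)
  rw [abs_mul, abs_mul, abs_mul (P.β ^ 2), abs_of_nonneg (sq_nonneg P.β)]
  refine mul_le_mul_of_nonneg_left ?_ (abs_nonneg _)
  exact mul_le_mul (mul_le_mul_of_nonneg_left (abs_val_mul_val_le _ _) (sq_nonneg _)) (hC x y)
    (abs_nonneg _) (by positivity)

lemma injective_some_some : Function.Injective fun k : κ => some (some k) :=
  fun _ _ h => Option.some_injective _ (Option.some_injective _ h)

variable (K) in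
/-- All moments of the centered overlaps have the order of those of `1 / √N`. -/
lemma HighTemp.nuK_ovSum_pow_le (h : HighTemp P p q) (m : ℕ) :
    ∃ C : ℝ, 0 ≤ C ∧ ∀ N : ℕ, 1 ≤ N →
      nuK P N (fun σ : K → Config P.S N => ovSum p q σ ^ m) ≤ C * (1 / Real.sqrt N) ^ m := by
  obtain _ | n := m
  · refine ⟨1, zero_le_one, fun N _ => ?_⟩
    simp only [pow_zero, mul_one]
    exact (gnu_const _ _ _).le
  set l : ℝ := 1 / (32 * (P.S : ℝ) ^ 4) with hl
  have hS0 : (0 : ℝ) < P.S := by exact_mod_cast h.one_le_spin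
  have hl0 : 0 < l := by positivity
  set C₀ : ℝ := Real.exp (4 * P.β ^ 2 * wbar (Fin 2) * P.S ^ 4) *
        (2 * ∫ z, Real.exp (z ^ 2 / 4) ∂gaussianReal 0 1) with hC₀
  have hC₀0 : 0 ≤ C₀ := mul_nonneg (Real.exp_pos _).le
    (mul_nonneg zero_le_two (integral_nonneg fun _ => (Real.exp_pos _).le))
  set c : ℝ := (Fintype.card (Option (K × K)) : ℝ) ^ n with hc
  set A : ℝ := (n + 1).factorial / l ^ (n + 1) with hA
  refine ⟨c * (1 + ∑ _x : K, ∑ _y : K, (1 + A * C₀)), by positivity, fun N hN => ?_⟩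
  have hN0 : (0 : ℝ) < N := by exact_mod_cast hN
  have hr := one_div_sqrt_pos hN
  set r := 1 / Real.sqrt N with hrdef
  have hrN : r * Real.sqrt N = 1 := by
    rw [hrdef]; exact one_div_mul_cancel (Real.sqrt_pos.2 hN0).ne'
  have hpt : ∀ σ : K → Config P.S N, ovSum p q σ ^ (n + 1) ≤ r ^ (n + 1) *
      (c * (1 + ∑ x, ∑ y, (1 + A * Real.exp (l * (N * ov p q σ x y ^ 2))))) := by
    intro σ
    have e1 : ovSum p q σ = r * ∑ i : Option (K × K),
        (i.elim 1 fun z => Real.sqrt N * |ov p q σ z.1 z.2|) := by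
      rw [Fintype.sum_option, Fintype.sum_prod_type]
      simp only [Option.elim]
      rw [mul_add, mul_one, Finset.mul_sum]
      unfold ovSum
      congr 1
      refine Finset.sum_congr rfl fun x _ => ?_
      rw [Finset.mul_sum]
      refine Finset.sum_congr rfl fun y _ => ?_
      rw [← mul_assoc, hrN, one_mul]
    rw [e1, mul_pow]
    refine mul_le_mul_of_nonneg_left ?_ (by positivity)
    have e2 := pow_sum_div_card_le_sum_pow (s := (Finset.univ : Finset (Option (K × K))))
      (f := fun i => i.elim 1 fun z => Real.sqrt N * |ov p q σ z.1 z.2|)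
      (fun i _ => by cases i <;> simp only [Option.elim] <;> positivity) n
    rw [div_le_iff₀ (by rw [Finset.card_univ]; positivity)] at e2
    refine e2.trans ?_
    rw [mul_comm, Finset.card_univ]
    refine mul_le_mul_of_nonneg_left ?_ (by positivity)
    rw [Fintype.sum_option, Fintype.sum_prod_type]
    simp only [Option.elim, one_pow]
    refine add_le_add le_rfl (Finset.sum_le_sum fun x _ => Finset.sum_le_sum fun y _ => ?_)
    set t := Real.sqrt N * |ov p q σ x y| with ht
    have ht2 : N * ov p q σ x y ^ 2 = t ^ 2 := by
      rw [ht, mul_pow, Real.sq_sqrt hN0.le, sq_abs]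
    -- moments of `t` are bounded by exponential moments of `t ^ 2`
    have e3 : t ^ (n + 1) ≤ 1 + (t ^ 2) ^ (n + 1) := by
      rw [← pow_mul, mul_comm, pow_mul]
      nlinarith [sq_nonneg (t ^ (n + 1) - 1), sq_nonneg (t ^ (n + 1))]
    have e4 := Real.pow_div_factorial_le_exp (x := l * t ^ 2) (by positivity) (n + 1)
    rw [ht2]
    refine e3.trans (add_le_add le_rfl ?_)
    rw [mul_pow, div_le_iff₀ (by positivity)] at e4
    rw [hA, div_mul_eq_mul_div, le_div_iff₀ (by positivity)]
    linarith
  refine (gnu_mono _ _ hpt).trans ?_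
  rw [gnu_const_mul, gnu_const_mul, gnu_add, gnu_const, gnu_sum, mul_comm]
  refine mul_le_mul_of_nonneg_right ?_ (by positivity)
  refine mul_le_mul_of_nonneg_left (add_le_add le_rfl (Finset.sum_le_sum fun x _ => ?_))
    (by positivity)
  rw [gnu_sum]
  refine Finset.sum_le_sum fun y _ => ?_
  rw [gnu_add, gnu_const, gnu_const_mul]
  refine add_le_add le_rfl (mul_le_mul_of_nonneg_left ?_ (by positivity))
  exact nuK_exp_ov_sq_le h.one_le_spin h.isReplicaSymmetric h.beta_le hN x y

variable (K) in
/-- The same bound at every point of the cavity path, from its endpoint by Grönwall's inequality. -/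
lemma HighTemp.cavNu_ovSum_pow_le (h : HighTemp P p q) (m : ℕ) :
    ∃ C : ℝ, 0 ≤ C ∧ ∀ N : ℕ, ∀ o : Fin N, ∀ θ ∈ Set.Icc 0 (Real.pi / 2),
      cavNu P p q o θ (fun σ : K → Config P.S N => ovSum p q σ ^ m)
        ≤ C * (1 / Real.sqrt N) ^ m := by
  obtain ⟨C, hC0, hC⟩ := h.nuK_ovSum_pow_le K m
  have hw := wbar_nonneg K
  set B : ℝ := wbar K * (P.β ^ 2 * P.S ^ 2 * (3 * P.S ^ 2)) with hB
  refine ⟨Real.exp (2 * B) * C, by positivity, fun N o θ hθ => ?_⟩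
  have hg := path_gronwall (C := B) (hasDerivAt_cavNu (P := P) (p := p)
    h.isReplicaSymmetric.q_nonneg o
    (fun σ : K → Config P.S N => ovSum p q σ ^ m)) (by positivity)
    (fun θ => gnu_nonneg _ _ fun σ => pow_nonneg (ovSum_nonneg σ) m) (fun θ => by
      refine (abs_gnu_le_gnu _ _ fun σ => abs_cavL_le o _ σ (C := 3 * (P.S : ℝ) ^ 2)
        fun x y => abs_ovm_le h.isReplicaSymmetric o σ x y).trans (le_of_eq ?_)
      have e : (fun σ : Option (Option K) → Config P.S N =>
          |ovSum p q (fun k => σ (some (some k))) ^ m| * (wbar K * (P.β ^ 2 * P.S ^ 2 *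
            (3 * (P.S : ℝ) ^ 2)))) = fun σ => B * (fun τ : K → Config P.S N => ovSum p q τ ^ m)
              (σ ∘ fun k => some (some k)) := by
        funext σ
        rw [abs_of_nonneg (pow_nonneg (ovSum_nonneg _) m), mul_comm]
        rfl
      rw [e, gnu_const_mul, gnu_comp_injective _ _ injective_some_some
        (fun τ : K → Config P.S N => ovSum p q τ ^ m)]
      rfl) hθ
  rw [cavNu_pi_div_two] at hg
  refine hg.trans ?_
  rw [mul_assoc]
  exact mul_le_mul_of_nonneg_left (hC N o.pos) (Real.exp_pos _).le

/-- Differentiation along the cavity path produces one more centered overlap, hence raises the order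
by one. -/
lemma abs_cavL_le_ovSum {N : ℕ} (o : Fin N) {f : (κ → Config P.S N) → ℝ} {c : ℝ} {m : ℕ}
    (hf : ∀ σ, |f σ| ≤ c * ovSum p q σ ^ m) (hc : 0 ≤ c) (σ : Option (Option κ) → Config P.S N) :
    |cavL P p q o f σ| ≤ c * (wbar κ * (P.β ^ 2 * P.S ^ 2 * (1 + (P.S : ℝ) ^ 2))) *
      ovSum p q σ ^ (m + 1) := by
  have hw := wbar_nonneg κ
  refine (abs_cavL_le o f σ (abs_ovm_le_ovSum o σ)).trans ?_
  have h1 : |f fun k => σ (some (some k))| ≤ c * ovSum p q σ ^ m :=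
    (hf _).trans (mul_le_mul_of_nonneg_left (pow_le_pow_left₀ (ovSum_nonneg _)
      (ovSum_comp_le σ injective_some_some) m) hc)
  have hz := ovSum_nonneg (p := p) (q := q) σ
  refine (mul_le_mul_of_nonneg_right h1 (by positivity)).trans (le_of_eq ?_)
  ring

variable (κ) in
/-- First-order expansion along the cavity path. -/
lemma HighTemp.cavity_first_order (h : HighTemp P p q) (m : ℕ) :
    ∃ C : ℝ, 0 ≤ C ∧ ∀ (N : ℕ) (o : Fin N) (f : (κ → Config P.S N) → ℝ) (c : ℝ), 0 ≤ c →
      (∀ σ, |f σ| ≤ c * ovSum p q σ ^ m) → ∀ θ ∈ Set.Icc 0 (Real.pi / 2),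
      |cavNu P p q o θ f - cavNu P p q o 0 f| ≤ c * C * (1 / Real.sqrt N) ^ (m + 1) := by
  obtain ⟨C, hC0, hC⟩ := h.cavNu_ovSum_pow_le (Option (Option κ)) (m + 1)
  have hw := wbar_nonneg κ
  refine ⟨(wbar κ * (P.β ^ 2 * P.S ^ 2 * (1 + (P.S : ℝ) ^ 2))) * C, by positivity,
    fun N o f c hc hf θ hθ => ?_⟩
  refine path_first_order (hasDerivAt_cavNu h.isReplicaSymmetric.q_nonneg o f) (fun θ hθ => ?_) hθ
  refine (abs_gnu_le_gnu _ _ (abs_cavL_le_ovSum o hf hc)).trans ?_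
  rw [gnu_const_mul]
  refine (mul_le_mul_of_nonneg_left (hC N o θ hθ) (by positivity)).trans (le_of_eq ?_)
  ring

variable (κ) in
/-- Second-order expansion along the cavity path. -/
lemma HighTemp.cavity_second_order (h : HighTemp P p q) (m : ℕ) :
    ∃ C : ℝ, 0 ≤ C ∧ ∀ (N : ℕ) (o : Fin N) (f : (κ → Config P.S N) → ℝ) (c : ℝ), 0 ≤ c →
      (∀ σ, |f σ| ≤ c * ovSum p q σ ^ m) →
      |nuK P N f - cavNu P p q o 0 f - 1 / 2 * cavNu P p q o 0 (cavL P p q o f)|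
        ≤ c * C * (1 / Real.sqrt N) ^ (m + 2) := by
  obtain ⟨C, hC0, hC⟩ := h.cavity_first_order (Option (Option κ)) (m + 1)
  have hw := wbar_nonneg κ
  refine ⟨(wbar κ * (P.β ^ 2 * P.S ^ 2 * (1 + (P.S : ℝ) ^ 2))) * C, by positivity,
    fun N o f c hc hf => ?_⟩
  rw [← cavNu_pi_div_two (p := p) (q := q) o]
  refine path_second_order (hasDerivAt_cavNu h.isReplicaSymmetric.q_nonneg o f) fun θ hθ => ?_
  refine (hC N o (cavL P p q o f) _ (by positivity) (abs_cavL_le_ovSum o hf hc) θ hθ).trans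
    (le_of_eq ?_)
  ring

end Moments

/-! ### The cavity equation for products of overlaps -/

/-- Expansion of a product of factors `a j + b j` with `a j` of order `z` and `b j` of order `z ^ 2`:
the products, the error of order zero, and the error of order one. -/
lemma exists_abs_prod_add_sub_le {J : Type*} [DecidableEq J] (s : Finset J) {c : ℝ} (hc : 0 ≤ c) :
    ∃ C : ℝ, 0 ≤ C ∧ ∀ (a b : J → ℝ) (z : ℝ), 0 ≤ z → (∀ j ∈ s, |a j| ≤ c * z) →
      (∀ j ∈ s, |b j| ≤ c * z ^ 2) → (∀ j ∈ s, |a j + b j| ≤ c * z) →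
      |∏ j ∈ s, (a j + b j)| ≤ C * z ^ s.card ∧
      |∏ j ∈ s, a j| ≤ C * z ^ s.card ∧
      |∏ j ∈ s, (a j + b j) - ∏ j ∈ s, a j| ≤ C * z ^ (s.card + 1) ∧
      |∏ j ∈ s, (a j + b j) - ∏ j ∈ s, a j - ∑ j ∈ s, b j * ∏ i ∈ s.erase j, a i|
        ≤ C * z ^ (s.card + 2) := by
  induction s using Finset.induction_on with
  | empty =>
    refine ⟨1, zero_le_one, fun a b z hz _ _ _ => ?_⟩
    have h1 : 0 ≤ z ^ 1 := by positivity
    have h2 : 0 ≤ z ^ 2 := by positivity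
    simp only [Finset.prod_empty, Finset.card_empty, Finset.sum_empty]
    norm_num
    exact ⟨hz, h2⟩
  | insert j₀ s hj ih =>
    obtain ⟨C, hC0, hC⟩ := ih
    refine ⟨2 * (c * C), by positivity, fun a b z hz ha hb hab => ?_⟩
    obtain ⟨h1, h2, h3, h4⟩ := hC a b z hz (fun j h => ha j (Finset.mem_insert_of_mem h))
      (fun j h => hb j (Finset.mem_insert_of_mem h))
      (fun j h => hab j (Finset.mem_insert_of_mem h))
    have ha0 := ha j₀ (Finset.mem_insert_self _ _)
    have hb0 := hb j₀ (Finset.mem_insert_self _ _)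
    have hab0 := hab j₀ (Finset.mem_insert_self _ _)
    rw [Finset.prod_insert hj, Finset.prod_insert hj, Finset.card_insert_of_notMem hj,
      Finset.sum_insert hj, Finset.erase_insert hj]
    have hs : ∑ j ∈ s, b j * ∏ i ∈ (insert j₀ s).erase j, a i
        = a j₀ * ∑ j ∈ s, b j * ∏ i ∈ s.erase j, a i := by
      rw [Finset.mul_sum]
      refine Finset.sum_congr rfl fun j hjs => ?_
      have hne : j₀ ≠ j := fun h => hj (h ▸ hjs)
      rw [Finset.erase_insert_of_ne hne, Finset.prod_insert fun h => hj (Finset.mem_of_mem_erase h)]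
      ring
    rw [hs]
    set Pab := ∏ j ∈ s, (a j + b j)
    set Pa := ∏ j ∈ s, a j
    set L := ∑ j ∈ s, b j * ∏ i ∈ s.erase j, a i
    have mulb : ∀ {u v U V : ℝ}, |u| ≤ U → |v| ≤ V → |u * v| ≤ U * V := fun hu hv => by
      rw [abs_mul]
      exact mul_le_mul hu hv (abs_nonneg _) ((abs_nonneg _).trans hu)
    have hcC : ∀ k, 0 ≤ c * C * z ^ k := fun k => by positivity
    refine ⟨?_, ?_, ?_, ?_⟩
    · refine (mulb hab0 h1).trans ?_
      have := hcC (s.card + 1)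
      rw [pow_succ] at this ⊢
      nlinarith
    · refine (mulb ha0 h2).trans ?_
      have := hcC (s.card + 1)
      rw [pow_succ] at this ⊢
      nlinarith
    · have e : (a j₀ + b j₀) * Pab - a j₀ * Pa = a j₀ * (Pab - Pa) + b j₀ * Pab := by ring
      rw [e]
      refine (abs_add_le _ _).trans ((add_le_add (mulb ha0 h3) (mulb hb0 h1)).trans
        (le_of_eq ?_))
      ring
    · have e : (a j₀ + b j₀) * Pab - a j₀ * Pa - (b j₀ * Pa + a j₀ * L)
          = a j₀ * (Pab - Pa - L) + b j₀ * (Pab - Pa) := by ring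
      rw [e]
      refine (abs_add_le _ _).trans ((add_le_add (mulb ha0 h4) (mulb hb0 h3)).trans
        (le_of_eq ?_))
      ring

/-- A linear combination of the centered overlaps of the replicas labelled by `κ`. -/
noncomputable def ovLin (p q : ℝ) {S N : ℕ} {κ : Type*} [Fintype κ] [DecidableEq κ]
    (l : κ → κ → ℝ) (σ : κ → Config S N) : ℝ :=
  ∑ u, ∑ w, l u w * ov p q σ u w

/-- The same linear combination of the overlaps over the sites other than `o`. -/
noncomputable def ovmLin (p q : ℝ) {S N : ℕ} {κ : Type*} [Fintype κ] [DecidableEq κ]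
    (o : Fin N) (l : κ → κ → ℝ) (σ : κ → Config S N) : ℝ :=
  ∑ u, ∑ w, l u w * ovm p q o σ u w

/-- The same linear combination of the products of the spins at one site. -/
noncomputable def spinLin {S : ℕ} {κ : Type*} [Fintype κ] (l : κ → κ → ℝ) (ε : κ → Spin S) : ℝ :=
  ∑ u, ∑ w, l u w * ((ε u).val * (ε w).val)

/-- The total mass of the coefficients `l`. -/
noncomputable def mass {κ : Type*} [Fintype κ] (l : κ → κ → ℝ) : ℝ := ∑ u, ∑ w, |l u w|

section

variable {P : Params} {p q : ℝ} {κ : Type*} [Fintype κ] [DecidableEq κ]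

lemma mass_nonneg (l : κ → κ → ℝ) : 0 ≤ mass l :=
  Finset.sum_nonneg fun _ _ => Finset.sum_nonneg fun _ _ => abs_nonneg _

lemma abs_sum_sum_mul_le (l a : κ → κ → ℝ) {B : ℝ} (ha : ∀ u w, |a u w| ≤ B) :
    |∑ u, ∑ w, l u w * a u w| ≤ mass l * B := by
  unfold mass
  rw [Finset.sum_mul]
  refine (Finset.abs_sum_le_sum_abs _ _).trans (Finset.sum_le_sum fun u _ => ?_)
  rw [Finset.sum_mul]
  refine (Finset.abs_sum_le_sum_abs _ _).trans (Finset.sum_le_sum fun w _ => ?_)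
  rw [abs_mul]
  exact mul_le_mul_of_nonneg_left (ha u w) (abs_nonneg _)

lemma ovLin_eq_add {N : ℕ} (o : Fin N) (l : κ → κ → ℝ) (σ : κ → Config P.S N) :
    ovLin p q l σ = ovmLin p q o l σ + 1 / (N : ℝ) * spinLin l (fun k => σ k o) := by
  unfold ovLin ovmLin spinLin ovm
  simp_rw [Finset.mul_sum, ← Finset.sum_add_distrib]
  refine Finset.sum_congr rfl fun u _ => Finset.sum_congr rfl fun w _ => ?_
  ring

lemma ovm_update_zero {N : ℕ} (o : Fin N) (σ : κ → Config P.S N) (x y : κ) :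
    ovm p q o (fun k => Function.update (σ k) o 0) x y = ovm p q o σ x y := by
  unfold ovm ov
  rw [← Finset.add_sum_erase _ (fun i => (σ x i).val * (σ y i).val) (Finset.mem_univ o),
    ← Finset.add_sum_erase _ (fun i => (Function.update (σ x) o 0 i).val *
      (Function.update (σ y) o 0 i).val) (Finset.mem_univ o)]
  have e4 : ∑ i ∈ Finset.univ.erase o, (Function.update (σ x) o 0 i).val *
      (Function.update (σ y) o 0 i).val
      = ∑ i ∈ Finset.univ.erase o, (σ x i).val * (σ y i).val :=
    Finset.sum_congr rfl fun i hi => by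
      rw [Function.update_of_ne (Finset.ne_of_mem_erase hi),
        Function.update_of_ne (Finset.ne_of_mem_erase hi)]
  rw [e4]
  simp only [Function.update_self, Spin.val_zero]
  ring

lemma ovmLin_update_zero {N : ℕ} (o : Fin N) (l : κ → κ → ℝ) (σ : κ → Config P.S N) :
    ovmLin p q o l (fun k => Function.update (σ k) o 0) = ovmLin p q o l σ := by
  unfold ovmLin
  simp_rw [ovm_update_zero]

lemma exists_abs_le_of_finite {X : Type*} [Fintype X] (φ : X → ℝ) :
    ∃ B : ℝ, 0 ≤ B ∧ ∀ x, |φ x| ≤ B :=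
  ⟨∑ x, |φ x|, Finset.sum_nonneg fun _ _ => abs_nonneg _, fun x =>
    Finset.single_le_sum (f := fun x => |φ x|) (fun _ _ => abs_nonneg _) (Finset.mem_univ x)⟩

/-- A system size together with a site. Estimates that are uniform in both are stated as
`=O[⊤]` for functions on this type. -/
abbrev Site : Type := Σ N : ℕ, Fin N

/-- The order of magnitude `N ^ (-m / 2)`. -/
noncomputable def ordS (m : ℕ) (i : Site) : ℝ := (1 / Real.sqrt i.1) ^ m

lemma isBigO_ordS {f : Site → ℝ} {m : ℕ} {C : ℝ}
    (hf : ∀ (N : ℕ) (o : Fin N), |f ⟨N, o⟩| ≤ C * (1 / Real.sqrt N) ^ m) : f =O[⊤] ordS m := by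
  refine Asymptotics.isBigO_top.2 ⟨C, fun i => ?_⟩
  rw [Real.norm_eq_abs, Real.norm_of_nonneg (by unfold ordS; positivity)]
  exact hf i.1 i.2

lemma isBigO_one_div_mul {f : Site → ℝ} {m : ℕ} (hf : f =O[⊤] ordS m) :
    (fun i : Site => 1 / (i.1 : ℝ) * f i) =O[⊤] ordS (m + 2) := by
  have h1 : (fun i : Site => 1 / (i.1 : ℝ)) =O[⊤] fun i : Site => 1 / (i.1 : ℝ) :=
    Asymptotics.isBigO_refl _ _
  refine (h1.mul hf).congr_right fun i => ?_
  rw [one_div_eq_sq]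
  unfold ordS
  ring

/-- `f` is a family of functions of order `ovSum ^ m`, uniformly in the size and the site. -/
def IsOvO (p q : ℝ) {S : ℕ} (m : ℕ) (f : ∀ i : Site, (κ → Config S i.1) → ℝ) : Prop :=
  ∃ c : ℝ, 0 ≤ c ∧ ∀ i σ, |f i σ| ≤ c * ovSum p q σ ^ m

lemma IsOvO.mul_spin {m : ℕ} {g : ∀ i : Site, (κ → Config P.S i.1) → ℝ} (hg : IsOvO p q m g)
    (φ : (κ → Spin P.S) → ℝ) : IsOvO p q m fun i σ => φ (fun k => σ k i.2) * g i σ := by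
  obtain ⟨c, hc, hg⟩ := hg
  obtain ⟨B, hB, hφ⟩ := exists_abs_le_of_finite φ
  refine ⟨B * c, by positivity, fun i σ => ?_⟩
  rw [abs_mul, mul_assoc]
  exact mul_le_mul (hφ _) (hg i σ) (abs_nonneg _) hB

lemma HighTemp.nuK_isBigO (h : HighTemp P p q) {m : ℕ}
    {f : ∀ i : Site, (κ → Config P.S i.1) → ℝ} (hf : IsOvO p q m f) :
    (fun i => nuK P i.1 (f i)) =O[⊤] ordS m := by
  obtain ⟨c, hc, hf⟩ := hf
  obtain ⟨C, hC0, hC⟩ := h.nuK_ovSum_pow_le κ m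
  refine isBigO_ordS (C := c * C) fun N o => ?_
  refine (abs_gnu_le_gnu _ _ (hf ⟨N, o⟩)).trans ?_
  rw [gnu_const_mul, mul_assoc]
  exact mul_le_mul_of_nonneg_left (hC N o.pos) hc

lemma HighTemp.cavity_first_isBigO (h : HighTemp P p q) {m : ℕ}
    {f : ∀ i : Site, (κ → Config P.S i.1) → ℝ} (hf : IsOvO p q m f) :
    (fun i => nuK P i.1 (f i) - cavNu P p q i.2 0 (f i)) =O[⊤] ordS (m + 1) := by
  obtain ⟨c, hc, hf⟩ := hf
  obtain ⟨C, hC0, hC⟩ := h.cavity_first_order κ m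
  refine isBigO_ordS (C := c * C) fun N o => ?_
  have := hC N o (f ⟨N, o⟩) c hc (hf ⟨N, o⟩) (Real.pi / 2)
    ⟨by positivity, le_rfl⟩
  rwa [cavNu_pi_div_two] at this

lemma HighTemp.cavity_second_isBigO (h : HighTemp P p q) {m : ℕ}
    {f : ∀ i : Site, (κ → Config P.S i.1) → ℝ} (hf : IsOvO p q m f) :
    (fun i => nuK P i.1 (f i) - cavNu P p q i.2 0 (f i)
      - 1 / 2 * cavNu P p q i.2 0 (cavL P p q i.2 (f i))) =O[⊤] ordS (m + 2) := by
  obtain ⟨c, hc, hf⟩ := hf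
  obtain ⟨C, hC0, hC⟩ := h.cavity_second_order κ m
  exact isBigO_ordS (C := c * C) fun N o => hC N o (f ⟨N, o⟩) c hc (hf ⟨N, o⟩)

/-- To leading order, the spins at a site are independent of the overlaps over the other sites. -/
lemma HighTemp.cavNu_zero_isBigO (h : HighTemp P p q) {m : ℕ}
    {g g' : ∀ i : Site, (κ → Config P.S i.1) → ℝ} (hg : IsOvO p q m g)
    (hg' : IsOvO p q (m + 1) fun i σ => g' i σ - g i σ)
    (hinv : ∀ i σ, g i (fun k => Function.update (σ k) i.2 0) = g i σ)
    (φ : (κ → Spin P.S) → ℝ) :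
    (fun i => cavNu P p q i.2 0 (fun σ => φ (fun k => σ k i.2) * g i σ)
      - nuZ P p q φ * nuK P i.1 (g' i)) =O[⊤] ordS (m + 1) := by
  have h1 := (h.cavity_first_isBigO hg).const_mul_left (-nuZ P p q φ)
  have h2 := (h.nuK_isBigO hg').const_mul_left (-nuZ P p q φ)
  refine (h1.add h2).congr_left fun i => ?_
  rw [cavNu_zero_mul i.2 φ (hinv i)]
  have : nuK P i.1 (fun σ => g' i σ - g i σ) = nuK P i.1 (g' i) - nuK P i.1 (g i) :=
    gnu_sub _ _ _ _
  rw [this]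
  ring

/-- The same independence for the average of the model itself. -/
lemma HighTemp.nuK_mul_spin_isBigO (h : HighTemp P p q) {m : ℕ}
    {g g' : ∀ i : Site, (κ → Config P.S i.1) → ℝ} (hg : IsOvO p q m g)
    (hg' : IsOvO p q (m + 1) fun i σ => g' i σ - g i σ)
    (hinv : ∀ i σ, g i (fun k => Function.update (σ k) i.2 0) = g i σ)
    (φ : (κ → Spin P.S) → ℝ) :
    (fun i => nuK P i.1 (fun σ => φ (fun k => σ k i.2) * g i σ)
      - nuZ P p q φ * nuK P i.1 (g' i)) =O[⊤] ordS (m + 1) := by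
  refine ((h.cavNu_zero_isBigO hg hg' hinv φ).add
    (h.cavity_first_isBigO (hg.mul_spin φ))).congr_left fun i => ?_
  ring

end

/-- A product of linear combinations of centered overlaps. -/
noncomputable def prodOv (p q : ℝ) {S N : ℕ} {κ : Type*} [Fintype κ] [DecidableEq κ] {J : Type*}
    (l : J → κ → κ → ℝ) (s : Finset J) (σ : κ → Config S N) : ℝ :=
  ∏ j ∈ s, ovLin p q (l j) σ

/-- The same product for the overlaps over the sites other than `o`. -/
noncomputable def prodOvm (p q : ℝ) {S N : ℕ} {κ : Type*} [Fintype κ] [DecidableEq κ] {J : Type*}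
    (o : Fin N) (l : J → κ → κ → ℝ) (s : Finset J) (σ : κ → Config S N) : ℝ :=
  ∏ j ∈ s, ovmLin p q o (l j) σ

/-- The correlation of `ε_x ε_y` and `ε_u ε_w` under the law of the last spins. -/
noncomputable def theta (P : Params) (p q : ℝ) {κ : Type*} [Fintype κ] [DecidableEq κ]
    (x y u w : κ) : ℝ :=
  nuZ P p q fun ε : κ → Spin P.S =>
    ((ε x).val * (ε y).val - mu p q x y) * ((ε u).val * (ε w).val)

section

variable {P : Params} {p q : ℝ} {κ K : Type*} [Fintype κ] [DecidableEq κ]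
  [Fintype K] [DecidableEq K] {J : Type*} [DecidableEq J]

lemma IsOvO.mul {m m' : ℕ} {f f' : ∀ i : Site, (κ → Config P.S i.1) → ℝ} (hf : IsOvO p q m f)
    (hf' : IsOvO p q m' f') : IsOvO p q (m + m') fun i σ => f i σ * f' i σ := by
  obtain ⟨c, hc, hf⟩ := hf
  obtain ⟨c', hc', hf'⟩ := hf'
  refine ⟨c * c', by positivity, fun i σ => ?_⟩
  have := ovSum_nonneg (p := p) (q := q) σ
  rw [abs_mul, pow_add, mul_mul_mul_comm]
  exact mul_le_mul (hf i σ) (hf' i σ) (abs_nonneg _) (by positivity)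

lemma IsOvO.add {m : ℕ} {f f' : ∀ i : Site, (κ → Config P.S i.1) → ℝ} (hf : IsOvO p q m f)
    (hf' : IsOvO p q m f') : IsOvO p q m fun i σ => f i σ + f' i σ := by
  obtain ⟨c, hc, hf⟩ := hf
  obtain ⟨c', hc', hf'⟩ := hf'
  refine ⟨c + c', by positivity, fun i σ => ?_⟩
  rw [add_mul]
  exact (abs_add_le _ _).trans (add_le_add (hf i σ) (hf' i σ))

lemma IsOvO.comp {m : ℕ} {f : ∀ i : Site, (κ → Config P.S i.1) → ℝ} (hf : IsOvO p q m f)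
    {j : κ → K} (hj : Function.Injective j) :
    IsOvO p q m fun i (σ : K → Config P.S i.1) => f i fun k => σ (j k) := by
  obtain ⟨c, hc, hf⟩ := hf
  exact ⟨c, hc, fun i σ => (hf i _).trans (mul_le_mul_of_nonneg_left
    (pow_le_pow_left₀ (ovSum_nonneg _) (ovSum_comp_le σ hj) m) hc)⟩

lemma isOvO_ovm (x y : κ) : IsOvO p q 1 fun i (σ : κ → Config P.S i.1) => ovm p q i.2 σ x y :=
  ⟨1 + (P.S : ℝ) ^ 2, by positivity, fun i σ => by
    rw [pow_one]; exact abs_ovm_le_ovSum i.2 σ x y⟩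

lemma isOvO_ov_sub_ovm (x y : κ) :
    IsOvO p q 2 fun i (σ : κ → Config P.S i.1) => ov p q σ x y - ovm p q i.2 σ x y :=
  ⟨(P.S : ℝ) ^ 2, by positivity, fun i σ => by
    beta_reduce
    unfold ovm
    rw [sub_sub_cancel, abs_mul, abs_of_nonneg (by positivity), mul_comm]
    exact mul_le_mul (abs_val_mul_val_le _ _) (one_div_le_ovSum_sq σ) (by positivity)
      (by positivity)⟩

/-- Removal of the site `o` from a product of overlap forms: the product has as many orders as it has
factors, and its dependence on the spins at `o` is linear to leading order. -/
lemma isOvO_prod (l : J → κ → κ → ℝ) (s : Finset J) :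
    (IsOvO p q s.card fun i (σ : κ → Config P.S i.1) => prodOv p q l s σ) ∧
    (IsOvO p q s.card fun i (σ : κ → Config P.S i.1) => prodOvm p q i.2 l s σ) ∧
    (IsOvO p q (s.card + 1) fun i (σ : κ → Config P.S i.1) =>
      prodOv p q l s σ - prodOvm p q i.2 l s σ) ∧
    (IsOvO p q (s.card + 2) fun i (σ : κ → Config P.S i.1) =>
      prodOv p q l s σ - prodOvm p q i.2 l s σ
        - ∑ j ∈ s, 1 / (i.1 : ℝ) * spinLin (l j) (fun k => σ k i.2)
          * prodOvm p q i.2 l (s.erase j) σ) := by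
  set L : ℝ := ∑ j ∈ s, mass (l j) with hL
  have hL0 : 0 ≤ L := Finset.sum_nonneg fun j _ => mass_nonneg _
  have hmass : ∀ j ∈ s, mass (l j) ≤ L := fun j hj =>
    Finset.single_le_sum (f := fun j => mass (l j)) (fun _ _ => mass_nonneg _) hj
  obtain ⟨C, hC0, hC⟩ := exists_abs_prod_add_sub_le s (c := L * (1 + (P.S : ℝ) ^ 2))
    (by positivity)
  have key := fun (i : Site) (σ : κ → Config P.S i.1) =>
    hC (fun j => ovmLin p q i.2 (l j) σ) (fun j => 1 / (i.1 : ℝ) * spinLin (l j) fun k => σ k i.2)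
      (ovSum p q σ) (ovSum_nonneg σ)
      (fun j hj => by
        refine (abs_sum_sum_mul_le _ _ (abs_ovm_le_ovSum i.2 σ)).trans ?_
        rw [mul_assoc]
        exact mul_le_mul_of_nonneg_right (hmass j hj)
          (mul_nonneg (by positivity) (ovSum_nonneg σ)))
      (fun j hj => by
        rw [abs_mul, abs_of_nonneg (by positivity)]
        have h1 : |spinLin (l j) fun k => σ k i.2| ≤ L * (1 + (P.S : ℝ) ^ 2) :=
          (abs_sum_sum_mul_le _ _ fun u w => abs_val_mul_val_le _ _).trans
            (mul_le_mul (hmass j hj) (by linarith) (by positivity) hL0)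
        rw [mul_comm]
        exact mul_le_mul h1 (one_div_le_ovSum_sq σ) (by positivity) (by positivity))
      (fun j hj => by
        rw [← ovLin_eq_add]
        refine (abs_sum_sum_mul_le _ _ (abs_ov_le_ovSum σ)).trans ?_
        refine mul_le_mul_of_nonneg_right ?_ (ovSum_nonneg σ)
        have := hmass j hj
        nlinarith [sq_nonneg (P.S : ℝ)])
  simp_rw [← ovLin_eq_add] at key
  exact ⟨⟨C, hC0, fun i σ => (key i σ).1⟩, ⟨C, hC0, fun i σ => (key i σ).2.1⟩,
    ⟨C, hC0, fun i σ => (key i σ).2.2.1⟩, ⟨C, hC0, fun i σ => (key i σ).2.2.2⟩⟩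

lemma prodOvm_update_zero {N : ℕ} (o : Fin N) (l : J → κ → κ → ℝ) (s : Finset J)
    (σ : κ → Config P.S N) :
    prodOvm p q o l s (fun k => Function.update (σ k) o 0) = prodOvm p q o l s σ := by
  unfold prodOvm
  simp_rw [ovmLin_update_zero]

lemma nuZ_mul_spinLin (x y : κ) (l : κ → κ → ℝ) :
    nuZ P p q (fun ε : κ → Spin P.S => ((ε x).val * (ε y).val - mu p q x y) * spinLin l ε)
      = ∑ u, ∑ w, l u w * theta P p q x y u w := by
  have e : (fun ε : κ → Spin P.S => ((ε x).val * (ε y).val - mu p q x y) * spinLin l ε)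
      = fun ε => ∑ u, ∑ w, l u w * (((ε x).val * (ε y).val - mu p q x y) *
        ((ε u).val * (ε w).val)) := by
    funext ε
    unfold spinLin
    simp_rw [Finset.mul_sum]
    refine Finset.sum_congr rfl fun u _ => Finset.sum_congr rfl fun w _ => ?_
    ring
  rw [e]
  unfold nuZ theta nuZ
  rw [gnu_sum]
  refine Finset.sum_congr rfl fun u _ => ?_
  rw [gnu_sum]
  exact Finset.sum_congr rfl fun w _ => gnu_const_mul _ _ _ _

/-- The term produced by the interaction in the cavity equation: the derivative at the decoupled end
of the cavity path, to leading order and without the factor `β ^ 2`. -/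
noncomputable def cavMain (P : Params) (p q : ℝ) (N : ℕ) (x y : κ) (l : J → κ → κ → ℝ)
    (s : Finset J) : ℝ :=
  ∑ u : Option (Option κ), ∑ w, repW κ u w * theta P p q (some (some x)) (some (some y)) u w *
    nuK P N fun σ : Option (Option κ) → Config P.S N =>
      ov p q σ u w * prodOv p q l s fun k => σ (some (some k))

/-- The derivative at the decoupled end of the cavity path. The spins at the site separate from the
overlaps, which may then be completed by the site and averaged in the model. -/
lemma HighTemp.cavL_isBigO (h : HighTemp P p q) (x y : κ) (l : J → κ → κ → ℝ) (s : Finset J) :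
    (fun i : Site => cavNu P p q i.2 0 (cavL P p q i.2 fun σ : κ → Config P.S i.1 =>
        ((σ x i.2).val * (σ y i.2).val - mu p q x y) * prodOvm p q i.2 l s σ)
      - P.β ^ 2 * cavMain P p q i.1 x y l s) =O[⊤] ordS (s.card + 2) := by
  obtain ⟨hs1, hs2, hs3, hs4⟩ := isOvO_prod (P := P) (p := p) (q := q) l s
  have key : ∀ u w : Option (Option κ), _ := fun u w =>
    (h.cavNu_zero_isBigO (m := 1 + s.card)
      (g := fun i (σ : Option (Option κ) → Config P.S i.1) =>
        ovm p q i.2 σ u w * prodOvm p q i.2 l s fun k => σ (some (some k)))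
      (g' := fun i (σ : Option (Option κ) → Config P.S i.1) =>
        ov p q σ u w * prodOv p q l s fun k => σ (some (some k)))
      ((isOvO_ovm u w).mul (hs2.comp injective_some_some))
      (by
        have h1 := (isOvO_ov_sub_ovm (P := P) (p := p) (q := q) u w).mul
          (hs1.comp (injective_some_some (κ := κ)))
        have h2 := (isOvO_ovm (P := P) (p := p) (q := q) u w).mul
          (hs3.comp (injective_some_some (κ := κ)))
        rw [show 2 + s.card = 1 + s.card + 1 by ring] at h1
        rw [show 1 + (s.card + 1) = 1 + s.card + 1 by ring] at h2
        obtain ⟨c, hc, hh⟩ := h1.add h2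
        refine ⟨c, hc, fun i σ => le_trans (le_of_eq ?_) (hh i σ)⟩
        congr 1
        ring)
      (fun i σ => by
        have := prodOvm_update_zero (p := p) (q := q) i.2 l s fun k => σ (some (some k))
        simp only [ovm_update_zero, this])
      (fun ε : Option (Option κ) → Spin P.S =>
        ((ε (some (some x))).val * (ε (some (some y))).val
          - mu p q (some (some x)) (some (some y))) * ((ε u).val * (ε w).val))).const_mul_left
      (repW κ u w * P.β ^ 2)
  have hsum := Asymptotics.IsBigO.sum (s := Finset.univ) fun u _ =>
    Asymptotics.IsBigO.sum (s := Finset.univ) fun w _ => key u w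
  rw [show 1 + s.card + 1 = s.card + 2 by ring] at hsum
  refine hsum.congr_left fun i => ?_
  simp only [Finset.sum_apply, mul_sub, Finset.sum_sub_distrib]
  congr 1
  · unfold cavNu
    simp_rw [← gnu_const_mul, ← gnu_sum]
    congr 1
    funext σ
    unfold cavL
    simp only [mu, Option.some.injEq, Finset.mul_sum]
    refine Finset.sum_congr rfl fun u _ => Finset.sum_congr rfl fun w _ => ?_
    ring
  · unfold cavMain
    simp_rw [Finset.mul_sum]
    refine Finset.sum_congr rfl fun u _ => Finset.sum_congr rfl fun w _ => ?_
    unfold theta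
    ring

/-- The cavity equation for one site. The product of overlap forms is expanded in the spins at the
site. The term of order zero vanishes at the decoupled end of the path, by the replica-symmetric
equations, and leaves its derivative; the linear term gives the sum over the factors. -/
lemma HighTemp.cavity_site (h : HighTemp P p q) (x y : κ) (l : J → κ → κ → ℝ) (s : Finset J) :
    (fun i : Site => nuK P i.1 (fun σ : κ → Config P.S i.1 =>
        ((σ x i.2).val * (σ y i.2).val - mu p q x y) * prodOv p q l s σ)
      - (1 / (i.1 : ℝ) * ∑ j ∈ s, (∑ u, ∑ w, l j u w * theta P p q x y u w) *
          nuK P i.1 (fun σ : κ → Config P.S i.1 => prodOv p q l (s.erase j) σ)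
        + P.β ^ 2 / 2 * cavMain P p q i.1 x y l s)) =O[⊤] ordS (s.card + 2) := by
  obtain ⟨hs1, hs2, hs3, hs4⟩ := isOvO_prod (P := P) (p := p) (q := q) l s
  set ψ : (κ → Spin P.S) → ℝ := fun ε => (ε x).val * (ε y).val - mu p q x y with hψ
  have h1 := h.nuK_isBigO (hs4.mul_spin ψ)
  have h2 := h.cavity_second_isBigO (hs2.mul_spin ψ)
  have h3 := (h.cavL_isBigO x y l s).const_mul_left (1 / 2)
  have h4 : ∀ j ∈ s, (fun i : Site => 1 / (i.1 : ℝ) * (nuK P i.1 (fun σ : κ → Config P.S i.1 =>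
      (fun ε => ψ ε * spinLin (l j) ε) (fun k => σ k i.2) * prodOvm p q i.2 l (s.erase j) σ)
      - (∑ u, ∑ w, l j u w * theta P p q x y u w) *
          nuK P i.1 (fun σ : κ → Config P.S i.1 => prodOv p q l (s.erase j) σ)))
      =O[⊤] ordS (s.card + 2) := by
    intro j hj
    obtain ⟨-, he2, he3, -⟩ := isOvO_prod (P := P) (p := p) (q := q) l (s.erase j)
    have := isBigO_one_div_mul (h.nuK_mul_spin_isBigO he2 he3
      (fun i σ => prodOvm_update_zero i.2 l _ σ) fun ε => ψ ε * spinLin (l j) ε)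
    rw [Finset.card_erase_add_one hj, nuZ_mul_spinLin] at this
    exact this
  have h5 := Asymptotics.IsBigO.sum h4
  refine (((h1.add h2).add h3).add h5).congr_left fun i => ?_
  have e0 : cavNu P p q i.2 0 (fun σ : κ → Config P.S i.1 =>
      ψ (fun k => σ k i.2) * prodOvm p q i.2 l s σ) = 0 := by
    rw [cavNu_zero_mul i.2 ψ (prodOvm_update_zero i.2 l s), hψ,
      h.isReplicaSymmetric.nuZ_sub_mu, zero_mul]
  have e1 : nuK P i.1 (fun σ : κ → Config P.S i.1 => ψ (fun k => σ k i.2) *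
      (prodOv p q l s σ - prodOvm p q i.2 l s σ
        - ∑ j ∈ s, 1 / (i.1 : ℝ) * spinLin (l j) (fun k => σ k i.2)
          * prodOvm p q i.2 l (s.erase j) σ))
      = nuK P i.1 (fun σ : κ → Config P.S i.1 => ψ (fun k => σ k i.2) * prodOv p q l s σ)
        - nuK P i.1 (fun σ : κ → Config P.S i.1 => ψ (fun k => σ k i.2) * prodOvm p q i.2 l s σ)
        - ∑ j ∈ s, 1 / (i.1 : ℝ) * nuK P i.1 (fun σ : κ → Config P.S i.1 =>
          ψ (fun k => σ k i.2) * spinLin (l j) (fun k => σ k i.2)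
            * prodOvm p q i.2 l (s.erase j) σ) := by
    unfold nuK
    simp_rw [← gnu_const_mul, ← gnu_sum, ← gnu_sub]
    congr 1
    funext σ
    rw [mul_sub, mul_sub, Finset.mul_sum]
    congr 1
    refine Finset.sum_congr rfl fun j _ => ?_
    ring
  rw [e1, e0]
  simp only [Finset.sum_apply, mul_sub, Finset.sum_sub_distrib]
  simp only [Finset.mul_sum]
  simp only [hψ]
  ring

end

/-! ### The linear system of the cavity equations -/

section Sums

variable {κ : Type*} [Fintype κ] [DecidableEq κ] {V : Type*} [AddCommMonoid V]

/-- The sum of the off-diagonal entries of a matrix. -/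
def offS (w : κ → κ → V) : V := ∑ x, ∑ y ∈ Finset.univ.erase x, w x y

/-- The sum of the diagonal entries of a matrix. -/
def diagS (w : κ → κ → V) : V := ∑ x, w x x

/-- The sum of the off-diagonal entries of the row and of the column of `x`. -/
def rowS (w : κ → κ → V) (x : κ) : V := ∑ y ∈ Finset.univ.erase x, (w x y + w y x)

end Sums

section LinearSystem

variable {κ : Type*} [Fintype κ] [DecidableEq κ]

/-- The symmetry of the covariance of `T` and `S`: the coefficient of the off-diagonal sum in the
solution for `n c c` agrees with that of the diagonal sum in the solution for `n c d`. -/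
lemma covC0_symm {A D E G I3 K K4 b A2 A1 B1 C1 M1 M2 M3 M C0 : ℝ}
    (hM1 : M1 = 1 - b * (A - 2 * G)) (hM2 : M2 = 1 - b / 2 * D) (hM3 : M3 = 1 - b * A)
    (hM : M = M1 * M2 + b ^ 2 * E ^ 2) (hM30 : M3 ≠ 0) (hM0 : M ≠ 0)
    (hA2 : A2 = A / M3) (hA1 : A1 = (G * M2 + b / 2 * E ^ 2) / M * (1 / M3))
    (hB1 : B1 = (D * M1 - 2 * b * E ^ 2) / M) (hC1 : C1 = E / M)
    (hC0 : C0 = b / (2 * M) * (M2 * K + b * E * K4) * B1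
      + b / M * (M2 * (2 * G - I3) + b * E * (E - K)) * C1 + 1 / M * (M2 * K + b * E * K4)) :
    M * C0 = M1 * (K + b * (K * A2 + 2 * (E - K) * A1 + K4 * C1))
      - b * E * (I3 + b * (I3 * A2 + 2 * (2 * G - I3) * A1 + K * C1)) := by
  subst hA2 hA1 hB1 hC1 hC0
  have : M ≠ 0 := hM0
  field_simp
  subst hM
  subst hM1 hM2 hM3
  ring

lemma offS_eq (w : κ → κ → ℝ) : offS w = ∑ x, ∑ y, w x y - ∑ x, w x x := by
  unfold offS
  simp_rw [Finset.sum_erase_eq_sub (Finset.mem_univ _), Finset.sum_sub_distrib]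

lemma rowS_eq (w : κ → κ → ℝ) (x : κ) : rowS w x = ∑ y, (w x y + w y x) - 2 * w x x := by
  unfold rowS
  rw [Finset.sum_erase_eq_sub (Finset.mem_univ _)]
  ring

/-- The correlation of `x` with a replica that occurs nowhere else and differs from `x`, when `c` and
`d` are two such replicas. -/
def freshCol {V : Type*} (n : κ → κ → V) (c d : κ) (x : κ) : V := if x = c then n c d else n x c

/-- The system of cavity equations determines the correlations `n`, and the solution is given by the
covariances of the limiting Gaussian vector. The replicas `c` and `d` are fresh: the sources `w` do
not involve them, and `n` is symmetric under their exchange. Then `off`, `diag` and `row` are the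
sums over the weights `repW`, the two new replicas being identified with fresh ones.

Writing `n x y = tt x y + t x + t y + n c d` for `x ≠ y` and `n x x = s x + n c c`, with `tt`, `t`
and `s` vanishing on fresh replicas, makes the system triangular. Differences of equations give an
equation for `tt x y` alone, then a `2 × 2` system of determinant `M` for each pair `(t x, s x)`, and
then one, of the same determinant, for `(n c d, n c c)`. -/
lemma linear_system_solution {A D E G I3 K K4 b A2 A1 B1 C1 A0 B0 C0 M1 M2 M3 M : ℝ}
    (hM1 : M1 = 1 - b * (A - 2 * G)) (hM2 : M2 = 1 - b / 2 * D) (hM3 : M3 = 1 - b * A)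
    (hM : M = M1 * M2 + b ^ 2 * E ^ 2) (hM30 : M3 ≠ 0) (hM0 : M ≠ 0)
    (hA2 : A2 = A / M3) (hA1 : A1 = (G * M2 + b / 2 * E ^ 2) / M * (1 / M3))
    (hB1 : B1 = (D * M1 - 2 * b * E ^ 2) / M) (hC1 : C1 = E / M)
    (hA0 : A0 = b / M * (b * E * K4 + M2 * K) * C1
      + 2 * (b / M) * (b * E * (E - K) + M2 * (2 * G - I3)) * A1
      + b / M * (b * E * K + M2 * I3) * A2 + 1 / M * (b * E * K + M2 * I3))
    (hB0 : B0 = b / (2 * M) * (M1 * K4 - b * E * K) * B1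
      + b / M * (M1 * (E - K) - E * b * (2 * G - I3)) * C1 + 1 / M * (M1 * K4 - b * E * K))
    (hC0 : C0 = b / (2 * M) * (M2 * K + b * E * K4) * B1
      + b / M * (M2 * (2 * G - I3) + b * E * (E - K)) * C1 + 1 / M * (M2 * K + b * E * K4))
    {n w : κ → κ → ℝ} {c d : κ} (hcd : c ≠ d) (hn : ∀ x y, n x y = n y x)
    (hnd : ∀ x, x ≠ c → x ≠ d → n x d = n x c) (hnd' : n d d = n c c)
    (hwc : ∀ x, w x c = 0 ∧ w c x = 0) (hwd : ∀ x, w x d = 0 ∧ w d x = 0)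
    {off diag : ℝ} {row : κ → ℝ}
    (hoff : off = offS n - 2 * Fintype.card κ * ∑ x, freshCol n c d x
      + Fintype.card κ * (Fintype.card κ + 1) * n c d)
    (hdiag : diag = diagS n - Fintype.card κ * n c c)
    (hrow : ∀ x, row x = rowS n x - 2 * Fintype.card κ * freshCol n c d x)
    (h1 : ∀ x y, x ≠ y → n x y = I3 * offS w + K * diagS w + G * (rowS w x + rowS w y)
      + A * (w x y + w y x) + E * (w x x + w y y)
      + b / 2 * (I3 * off + K * diag + G * (row x + row y) + A * (2 * n x y) + E * (n x x + n y y)))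
    (h2 : ∀ x, n x x = K * offS w + K4 * diagS w + E * rowS w x + D * w x x
      + b / 2 * (K * off + K4 * diag + E * row x + D * n x x)) :
    (∀ x y, x ≠ y → x ≠ c → x ≠ d → y ≠ c → y ≠ d →
      n x y - n x c - n y c + n c d = A2 * (w x y + w y x)) ∧
    (∀ x, x ≠ c → x ≠ d → n x c - n c d = A1 * rowS w x + C1 * w x x) ∧
    (∀ x, x ≠ c → x ≠ d → n x x - n c c = C1 * rowS w x + B1 * w x x) ∧
    n c d = A0 * offS w + C0 * diagS w ∧ n c c = C0 * offS w + B0 * diagS w := by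
  set m := freshCol n c d with hm
  have hmc : m c = n c d := by simp [hm, freshCol]
  have hmd : m d = n c d := by simp [hm, freshCol, hcd.symm, hn d c]
  have hmx : ∀ x, x ≠ c → m x = n x c := fun x hx => by simp [hm, freshCol, hx]
  -- the components of `n`
  set t : κ → ℝ := fun x => m x - n c d with ht
  set tt : κ → κ → ℝ := fun x y => if x = y then 0 else n x y - m x - m y + n c d with htt
  set s : κ → ℝ := fun x => n x x - n c c with hs
  have htc : t c = 0 := by simp [ht, hmc]
  have htd : t d = 0 := by simp [ht, hmd]
  have httc : ∀ x, tt x c = 0 := fun x => by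
    simp only [htt]
    split_ifs with h
    · rfl
    · rw [hmc, hmx x h]; ring
  have httd : ∀ x, tt x d = 0 := fun x => by
    simp only [htt]
    split_ifs with h
    · rfl
    · by_cases hxc : x = c
      · subst hxc; rw [hmc, hmd]; ring
      · rw [hmd, hmx x hxc, hnd x hxc h]; ring
  have hnt : ∀ x y, x ≠ y → n x y = tt x y + t x + t y + n c d := fun x y hxy => by
    simp only [htt, ht, if_neg hxy]; ring
  have httxx : ∀ x, tt x x = 0 := fun x => by simp [htt]
  have htts : ∀ x y, tt x y = tt y x := fun x y => by
    simp only [htt, hn x y, eq_comm (a := x)]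
    split_ifs <;> ring
  set κc : ℝ := (Fintype.card κ : ℝ) with hκ
  have hsum1 : ∀ x, ∑ y ∈ Finset.univ.erase x, n x y
      = ∑ y, tt x y + (κc - 2) * t x + ∑ y, t y + (κc - 1) * n c d := fun x => by
    rw [Finset.sum_congr rfl fun y hy => hnt x y (Finset.ne_of_mem_erase hy).symm,
      Finset.sum_erase_eq_sub (Finset.mem_univ _)]
    simp only [Finset.sum_add_distrib, Finset.sum_const, Finset.card_univ, nsmul_eq_mul, httxx]
    ring
  have hrow' : ∀ x, row x = 2 * (∑ y, tt x y + ∑ y, t y - 2 * t x - n c d) := fun x => by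
    have : rowS n x = 2 * ∑ y ∈ Finset.univ.erase x, n x y := by
      unfold rowS
      rw [Finset.mul_sum]
      exact Finset.sum_congr rfl fun y _ => by rw [hn y x]; ring
    rw [hrow, this, hsum1]
    simp only [ht]; ring
  have hmt : ∑ x, m x = ∑ x, t x + κc * n c d := by
    simp only [ht, Finset.sum_sub_distrib, Finset.sum_const, Finset.card_univ, nsmul_eq_mul]
    ring
  have hoff' : off = ∑ x, ∑ y, tt x y - 2 * ∑ x, t x := by
    rw [hoff, hmt]
    unfold offS
    simp_rw [hsum1]
    simp only [Finset.sum_add_distrib, Finset.sum_const, Finset.card_univ, nsmul_eq_mul,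
      ← Finset.mul_sum]
    ring
  have hdiag' : diag = ∑ x, s x := by
    rw [hdiag]
    simp only [hs, diagS, Finset.sum_sub_distrib, Finset.sum_const, Finset.card_univ, nsmul_eq_mul]
    rfl
  have hrwc : rowS w c = 0 := Finset.sum_eq_zero fun x _ => by rw [(hwc x).1, (hwc x).2, add_zero]
  have hrwd : rowS w d = 0 := Finset.sum_eq_zero fun x _ => by rw [(hwd x).1, (hwd x).2, add_zero]
  -- pairs of replicas
  have htt' : ∀ x y, x ≠ y → tt x y = A2 * (w x y + w y x) := by
    intro x y hxy
    by_cases hxc : x = c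
    · subst hxc; rw [htts, httc, (hwc y).1, (hwc y).2]; ring
    by_cases hyc : y = c
    · subst hyc; rw [httc, (hwc x).1, (hwc x).2]; ring
    by_cases hxd : x = d
    · subst hxd; rw [htts, httd, (hwd y).1, (hwd y).2]; ring
    by_cases hyd : y = d
    · subst hyd; rw [httd, (hwd x).1, (hwd x).2]; ring
    have e1 := h1 x y hxy
    have e2 := h1 x c hxc
    have e3 := h1 y c hyc
    have e4 := h1 c d hcd
    have e5 : tt x y = n x y - n x c - n y c + n c d := by
      simp only [htt, if_neg hxy, hmx x hxc, hmx y hyc]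
    rw [(hwc x).1, (hwc x).2, (hwc c).1, hrwc] at e2
    rw [(hwc y).1, (hwc y).2, (hwc c).1, hrwc] at e3
    rw [(hwc d).1, (hwc d).2, (hwc c).1, (hwd d).1, hrwc, hrwd] at e4
    have e6 : M3 * tt x y = A * (w x y + w y x) := by
      have hrcd : row c = row d := by
        rw [hrow', hrow', htc, htd]
        simp_rw [htts c, htts d, httc, httd]
      rw [e5, hM3]
      linear_combination e1 - e2 - e3 + e4 - b / 2 * G * hrcd + b / 2 * E * hnd'
    rw [hA2]
    field_simp
    linear_combination e6
  have httsum : ∀ x, ∑ y, tt x y = A2 * rowS w x := fun x => by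
    unfold rowS
    rw [Finset.mul_sum, ← Finset.sum_congr rfl fun y hy =>
      htt' x y (Finset.ne_of_mem_erase hy).symm, Finset.sum_erase _ (httxx x)]
  have hrwsum : ∑ x, rowS w x = 2 * offS w := by
    simp_rw [rowS_eq, offS_eq, Finset.sum_sub_distrib, Finset.sum_add_distrib, ← Finset.mul_sum]
    rw [Finset.sum_comm (f := fun x y => w y x)]
    ring
  have hrow0 : row d = 2 * (∑ y, t y - n c d) := by
    rw [hrow', htd]
    simp_rw [htts d, httd]
    simp
  have hrow0c : row c = 2 * (∑ y, t y - n c d) := by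
    rw [hrow', htc]
    simp_rw [htts c, httc]
    simp
  -- single replicas
  have hts : ∀ x, t x = A1 * rowS w x + C1 * w x x ∧ s x = C1 * rowS w x + B1 * w x x := by
    intro x
    by_cases hxc : x = c
    · subst hxc; rw [htc, hrwc, (hwc x).1]; simp [hs]
    by_cases hxd : x = d
    · subst hxd; rw [htd, hrwd, (hwd x).1]; simp [hs, hnd']
    have e2 := h1 x c hxc
    have e4 := h1 c d hcd
    have e6 := h2 x
    have e7 := h2 c
    rw [(hwc x).1, (hwc x).2, (hwc c).1, hrwc, hrow', httsum, hrow0c] at e2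
    rw [(hwc d).1, (hwc d).2, (hwc c).1, (hwd d).1, hrwc, hrwd, hrow0, hrow0c, hnd'] at e4
    rw [hrow', httsum] at e6
    rw [hrow0c, hrwc, (hwc c).1] at e7
    have e8 : t x = n x c - n c d := by simp only [ht, hmx x hxc]
    have e9 : s x = n x x - n c c := rfl
    have r1 : M1 * t x - b * E / 2 * s x = (G + b * G * A2) * rowS w x + E * w x x := by
      rw [hM1]
      linear_combination e2 - e4 + (1 - b * A) * e8 - b * E / 2 * e9
    have r2 : M2 * s x + 2 * b * E * t x = (E + b * E * A2) * rowS w x + D * w x x := by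
      rw [hM2]
      linear_combination e6 - e7 + (1 - b * D / 2) * e9
    have r3 : M * t x = (M2 * (G + b * G * A2) + b * E / 2 * (E + b * E * A2)) * rowS w x
        + (M2 * E + b * E / 2 * D) * w x x := by
      rw [hM]; linear_combination M2 * r1 + b * E / 2 * r2
    have r4 : M * s x = (M1 * (E + b * E * A2) - 2 * b * E * (G + b * G * A2)) * rowS w x
        + (M1 * D - 2 * b * E * E) * w x x := by
      rw [hM]; linear_combination M1 * r2 - 2 * b * E * r1
    have hA2' : 1 + b * A2 = 1 / M3 := by
      rw [hA2]; field_simp; rw [hM3]; ring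
    constructor
    · apply mul_left_cancel₀ hM0
      have q1 : M * A1 = M2 * (G + b * G * A2) + b * E / 2 * (E + b * E * A2) := by
        rw [show M2 * (G + b * G * A2) + b * E / 2 * (E + b * E * A2)
          = (M2 * G + b * E / 2 * E) * (1 + b * A2) by ring, hA2', hA1]
        field_simp
      have q2 : M * C1 = M2 * E + b * E / 2 * D := by
        rw [hC1, hM2]; field_simp; ring
      rw [r3, ← q1, ← q2]; ring
    · apply mul_left_cancel₀ hM0
      have q1 : M * B1 = M1 * D - 2 * b * E * E := by
        rw [hB1]; field_simp
      have q2 : M * C1 = M1 * (E + b * E * A2) - 2 * b * E * (G + b * G * A2) := by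
        rw [show M1 * (E + b * E * A2) - 2 * b * E * (G + b * G * A2)
          = E * (M1 - 2 * b * G) * (1 + b * A2) by ring, hA2',
          show M1 - 2 * b * G = M3 by rw [hM1, hM3]; ring, hC1]
        field_simp
      rw [r4, ← q1, ← q2]; ring
  -- the self-averages
  have hT : ∑ x, ∑ y, tt x y = 2 * A2 * offS w := by
    simp_rw [httsum, ← Finset.mul_sum, hrwsum]; ring
  have hτ : ∑ x, t x = 2 * A1 * offS w + C1 * diagS w := by
    simp_rw [(hts _).1, Finset.sum_add_distrib, ← Finset.mul_sum, hrwsum]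
    unfold diagS; ring
  have hσ : ∑ x, s x = 2 * C1 * offS w + B1 * diagS w := by
    simp_rw [(hts _).2, Finset.sum_add_distrib, ← Finset.mul_sum, hrwsum]
    unfold diagS; ring
  have e4 := h1 c d hcd
  have e7 := h2 c
  rw [(hwc d).1, (hwc d).2, (hwc c).1, (hwd d).1, hrwc, hrwd, hrow0, hrow0c, hnd', hoff', hdiag', hT,
    hτ, hσ] at e4
  rw [hrow0c, hrwc, (hwc c).1, hoff', hdiag', hT, hτ, hσ] at e7
  have r1 : M1 * n c d - b * E * n c c
      = (I3 + b * (I3 * A2 + 2 * (2 * G - I3) * A1 + K * C1)) * offS w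
        + (K + b * ((2 * G - I3) * C1 + K / 2 * B1)) * diagS w := by
    rw [hM1]; linear_combination e4
  have r2 : M2 * n c c + b * E * n c d
      = (K + b * (K * A2 + 2 * (E - K) * A1 + K4 * C1)) * offS w
        + (K4 + b * ((E - K) * C1 + K4 / 2 * B1)) * diagS w := by
    rw [hM2]; linear_combination e7
  refine ⟨fun x y hxy hxc _ hyc _ => ?_, fun x hxc _ => ?_, fun x _ _ => (hts x).2, ?_, ?_⟩
  · rw [← htt' x y hxy]
    simp only [htt, if_neg hxy, hmx x hxc, hmx y hyc]
  · rw [← (hts x).1]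
    simp only [ht, hmx x hxc]
  · apply mul_left_cancel₀ hM0
    have q1 : M * A0 = M2 * (I3 + b * (I3 * A2 + 2 * (2 * G - I3) * A1 + K * C1))
        + b * E * (K + b * (K * A2 + 2 * (E - K) * A1 + K4 * C1)) := by
      rw [hA0]; field_simp; ring
    have q2 : M * C0 = M2 * (K + b * ((2 * G - I3) * C1 + K / 2 * B1))
        + b * E * (K4 + b * ((E - K) * C1 + K4 / 2 * B1)) := by
      rw [hC0]; field_simp; ring
    rw [mul_add, ← mul_assoc, ← mul_assoc, q1, q2]
    rw [hM]
    linear_combination M2 * r1 + b * E * r2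
  · apply mul_left_cancel₀ hM0
    have q1 := covC0_symm hM1 hM2 hM3 hM hM30 hM0 hA2 hA1 hB1 hC1 hC0
    have q2 : M * B0 = M1 * (K4 + b * ((E - K) * C1 + K4 / 2 * B1))
        - b * E * (K + b * ((2 * G - I3) * C1 + K / 2 * B1)) := by
      rw [hB0]; field_simp; ring
    rw [mul_add, ← mul_assoc, ← mul_assoc, q1, q2]
    rw [hM]
    linear_combination M1 * r2 - b * E * r1

end LinearSystem

/-! ### The coefficients of the cavity equations -/

section ThetaSums

variable {P : Params} {p q : ℝ} {K : Type*} [Fintype K] [DecidableEq K]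

lemma IsReplicaSymmetric.sum_theta_of_ne (h : IsReplicaSymmetric P p q) (w : K → K → ℝ) {x y : K}
    (hxy : x ≠ y) :
    ∑ u, ∑ v, w u v * theta P p q x y u v
      = cI3 P p q * offS w + cI5 P p q * diagS w + cG P p q * (rowS w x + rowS w y)
        + cA P p q * (w x y + w y x) + cE P p q * (w x x + w y y) := by
  have e : ∀ u v, w u v * theta P p q x y u v
      = cI3 P p q * w u v + cG P p q * ((if u = x then w u v else 0) + (if v = x then w u v else 0)
          + (if u = y then w u v else 0) + (if v = y then w u v else 0))
        + cA P p q * ((if u = x then if v = y then w u v else 0 else 0)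
          + if u = y then if v = x then w u v else 0 else 0)
        + (if u = v then (cI5 P p q - cI3 P p q) * w u u
          + (cE P p q - 2 * cG P p q) * ((if u = x then w u u else 0) + if u = y then w u u else 0)
          else 0) := by
    intro u v
    unfold theta
    rw [h.nuZ_offDiag hxy]
    by_cases huv : u = v
    · subst huv
      by_cases hx : u = x
      · subst hx; simp [hxy]; ring
      · by_cases hy : u = y
        · subst hy; simp [hx]; ring
        · simp [hx, hy]; ring
    · simp only [if_neg huv, ite_and, mul_add, mul_ite, mul_one, mul_zero]
      split_ifs <;> ring
  simp_rw [e, Finset.sum_add_distrib, ← Finset.mul_sum, Finset.sum_add_distrib]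
  rw [offS_eq, rowS_eq, rowS_eq]
  unfold diagS
  have s1 : ∀ z : K, ∑ u, ∑ v, (if u = z then w u v else 0) = ∑ v, w z v := fun z => by
    rw [Finset.sum_comm]; simp
  have s2 : ∀ z : K, ∑ u, ∑ v, (if v = z then w u v else 0) = ∑ u, w u z := fun z => by simp
  have s3 : ∀ z z' : K, ∑ u, ∑ v, (if u = z then if v = z' then w u v else 0 else 0) = w z z' :=
    fun z z' => by
      rw [Finset.sum_comm]; simp
  simp_rw [s1, s2, s3]
  simp only [Finset.sum_ite_eq, Finset.mem_univ, if_true, Finset.sum_add_distrib,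
    ← Finset.mul_sum, Finset.sum_ite_eq']
  ring

lemma IsReplicaSymmetric.sum_theta_self (h : IsReplicaSymmetric P p q) (w : K → K → ℝ) (x : K) :
    ∑ u, ∑ v, w u v * theta P p q x x u v
      = cK3 P p q * offS w + cK4 P p q * diagS w + cE P p q * rowS w x + cD P p q * w x x := by
  have e : ∀ u v, w u v * theta P p q x x u v
      = cK3 P p q * w u v + cE P p q * ((if u = x then w u v else 0) + if v = x then w u v else 0)
        + (if u = v then (cK4 P p q - cK3 P p q) * w u u
          + (cD P p q - 2 * cE P p q) * (if u = x then w u u else 0) else 0) := by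
    intro u v
    unfold theta
    rw [h.nuZ_diag]
    by_cases huv : u = v
    · subst huv
      by_cases hx : u = x
      · subst hx; simp; ring
      · simp [hx]; ring
    · simp only [if_neg huv]
      split_ifs <;> ring
  simp_rw [e, Finset.sum_add_distrib, ← Finset.mul_sum, Finset.sum_add_distrib]
  rw [offS_eq, rowS_eq]
  unfold diagS
  have s1 : ∀ z : K, ∑ u, ∑ v, (if u = z then w u v else 0) = ∑ v, w z v := fun z => by
    rw [Finset.sum_comm]; simp
  have s2 : ∀ z : K, ∑ u, ∑ v, (if v = z then w u v else 0) = ∑ u, w u z := fun z => by simp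
  simp_rw [s1, s2]
  simp only [Finset.sum_ite_eq, Finset.mem_univ, if_true, Finset.sum_add_distrib,
    ← Finset.mul_sum, Finset.sum_ite_eq']
  ring

end ThetaSums

/-! ### Symmetry between fresh replicas -/

section Fresh

variable {P : Params} {p q : ℝ} {κ K : Type*} [Fintype κ] [DecidableEq κ]
  [Fintype K] [DecidableEq K] {J : Type*} [DecidableEq J]

/-- The forms `l j`, `j ∈ s`, do not involve the replica `c`. -/
def IsFresh (l : J → κ → κ → ℝ) (s : Finset J) (c : κ) : Prop :=
  ∀ j ∈ s, ∀ u, l j u c = 0 ∧ l j c u = 0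

/-- The correlation of the overlap of `x` and `y` with the product of the forms `l j`, `j ∈ s`. -/
noncomputable def corr (P : Params) (p q : ℝ) (l : J → κ → κ → ℝ) (s : Finset J) (N : ℕ) (x y : κ) :
    ℝ :=
  nuK P N fun σ : κ → Config P.S N => ov p q σ x y * prodOv p q l s σ

/-- The same correlation for two replicas out of a larger set. -/
noncomputable def corrExt (P : Params) (p q : ℝ) (l : J → κ → κ → ℝ) (s : Finset J) (N : ℕ)
    (u w : Option (Option κ)) : ℝ :=
  nuK P N fun σ : Option (Option κ) → Config P.S N =>
    ov p q σ u w * prodOv p q l s fun k => σ (some (some k))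

lemma corr_comm (l : J → κ → κ → ℝ) (s : Finset J) (N : ℕ) (x y : κ) :
    corr P p q l s N x y = corr P p q l s N y x := by
  unfold corr
  simp_rw [ov_comm p q _ x y]

lemma corrExt_comm (l : J → κ → κ → ℝ) (s : Finset J) (N : ℕ) (x y : Option (Option κ)) :
    corrExt P p q l s N x y = corrExt P p q l s N y x := by
  unfold corrExt
  simp_rw [ov_comm p q _ x y]

/-- Fresh replicas may be relabelled. -/
lemma corrExt_eq {l : J → κ → κ → ℝ} {s : Finset J} (N : ℕ) {j : κ → Option (Option κ)}
    (hj : Function.Injective j) (hfresh : ∀ k, j k ≠ some (some k) → IsFresh l s k) (x y : κ) :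
    corrExt P p q l s N (j x) (j y) = corr P p q l s N x y := by
  unfold corr corrExt nuK
  rw [← gnu_comp_injective _ _ hj]
  congr 1
  funext σ
  rw [ov_comp p q σ hj]
  congr 1
  refine Finset.prod_congr rfl fun i hi => ?_
  refine Finset.sum_congr rfl fun u _ => Finset.sum_congr rfl fun w _ => ?_
  by_cases hu : j u = some (some u)
  · by_cases hw : j w = some (some w)
    · have h1 := ov_comp p q σ (injective_some_some (κ := κ)) u w
      rw [ov_comp p q σ hj, hu, hw, ← h1]
      rfl
    · rw [(hfresh w hw i hi u).1]; ring
  · rw [(hfresh u hu i hi w).2]; ring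

lemma corr_eq_of_injective {l : J → κ → κ → ℝ} {s : Finset J} (N : ℕ) {j : κ → κ}
    (hj : Function.Injective j) (hfresh : ∀ k, j k ≠ k → IsFresh l s k) (x y : κ) :
    corr P p q l s N (j x) (j y) = corr P p q l s N x y := by
  rw [← corrExt_eq (P := P) (p := p) (q := q) N (injective_some_some.comp hj)
    (fun k hk => hfresh k fun h => hk (by simp [h])) x y,
    ← corrExt_eq (P := P) (p := p) (q := q) N (injective_some_some (κ := κ)) (fun k hk => absurd rfl hk)
      (j x) (j y)]
  rfl

variable {l : J → κ → κ → ℝ} {s : Finset J} {c d : κ}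

lemma corr_fresh_right (hc : IsFresh l s c) (hd : IsFresh l s d) (N : ℕ) {x : κ}
    (hxc : x ≠ c) (hxd : x ≠ d) : corr P p q l s N x d = corr P p q l s N x c := by
  have := corr_eq_of_injective (P := P) (p := p) (q := q) (l := l) (s := s) N
    (Equiv.swap c d).injective (fun k hk => by
      by_cases h1 : k = c
      · exact h1 ▸ hc
      · by_cases h2 : k = d
        · exact h2 ▸ hd
        · exact absurd (Equiv.swap_apply_of_ne_of_ne h1 h2) hk) x c
  rwa [Equiv.swap_apply_of_ne_of_ne hxc hxd, Equiv.swap_apply_left] at this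

lemma corr_fresh_self (hc : IsFresh l s c) (hd : IsFresh l s d) (N : ℕ) :
    corr P p q l s N d d = corr P p q l s N c c := by
  have := corr_eq_of_injective (P := P) (p := p) (q := q) (l := l) (s := s) N
    (Equiv.swap c d).injective (fun k hk => by
      by_cases h1 : k = c
      · exact h1 ▸ hc
      · by_cases h2 : k = d
        · exact h2 ▸ hd
        · exact absurd (Equiv.swap_apply_of_ne_of_ne h1 h2) hk) c c
  rwa [Equiv.swap_apply_left] at this

/-- The correlations with the two new replicas, reduced to those with the fresh replicas `c` and `d`.
For a correlation with `x = c`, the replica `d` is used. -/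
lemma corrExt_values (hcd : c ≠ d) (hc : IsFresh l s c) (hd : IsFresh l s d) (N : ℕ) :
    (∀ x y, corrExt P p q l s N (some (some x)) (some (some y)) = corr P p q l s N x y) ∧
    (∀ x, corrExt P p q l s N (some (some x)) (some none)
      = freshCol (corr P p q l s N) c d x) ∧
    (∀ x, corrExt P p q l s N (some (some x)) none = freshCol (corr P p q l s N) c d x) ∧
    corrExt P p q l s N (some none) none = corr P p q l s N c d ∧
    corrExt P p q l s N (some none) (some none) = corr P p q l s N c c := by
  -- replace a single fresh replica `e` by one of the additional replicas `z`
  have single : ∀ z : Option (Option κ), (∀ k, z ≠ some (some k)) → ∀ e, IsFresh l s e → ∀ x,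
      x ≠ e → corrExt P p q l s N (some (some x)) z = corr P p q l s N x e ∧
        corrExt P p q l s N z z = corr P p q l s N e e := by
    intro z hz e he x hx
    have hj : Function.Injective (fun k => if k = e then z else some (some k)) := by
      intro a b hab
      by_cases ha : a = e <;> by_cases hb : b = e <;> simp_all
      · exact absurd hab.symm (hz a)
    have key := corrExt_eq (P := P) (p := p) (q := q) (l := l) (s := s) N hj (fun k hk => by
      by_cases h1 : k = e
      · exact h1 ▸ he
      · simp [h1] at hk)
    have k1 := key x e
    have k2 := key e e
    simp only [if_neg hx, if_true] at k1 k2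
    exact ⟨k1, k2⟩
  have col : ∀ z : Option (Option κ), (∀ k, z ≠ some (some k)) → ∀ x,
      corrExt P p q l s N (some (some x)) z = freshCol (corr P p q l s N) c d x := by
    intro z hz x
    unfold freshCol
    split_ifs with h
    · subst h; exact (single z hz d hd x hcd).1
    · exact (single z hz c hc x h).1
  refine ⟨fun x y => corrExt_eq N injective_some_some (fun k hk => absurd rfl hk) x y,
    col _ (by simp), col _ (by simp), ?_, (single _ (by simp) c hc d hcd.symm).2⟩
  have hj : Function.Injective
      (fun k => if k = c then some none else if k = d then none else some (some k)) := by
    intro a b hab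
    by_cases ha : a = c <;> by_cases hb : b = c <;> by_cases ha' : a = d <;>
      by_cases hb' : b = d <;> simp_all
  have key := corrExt_eq (P := P) (p := p) (q := q) (l := l) (s := s) N hj (fun k hk => by
    by_cases h1 : k = c
    · exact h1 ▸ hc
    · by_cases h2 : k = d
      · exact h2 ▸ hd
      · simp [h1, h2] at hk) c d
  simpa [hcd.symm] using key

/-- The sums over the weights `repW` that enter the cavity equations. -/
lemma repW_sums (hcd : c ≠ d) (hc : IsFresh l s c) (hd : IsFresh l s d) (N : ℕ) :
    offS (fun u w => repW κ u w * corrExt P p q l s N u w)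
      = offS (corr P p q l s N)
        - 2 * Fintype.card κ * ∑ x, freshCol (corr P p q l s N) c d x
        + Fintype.card κ * (Fintype.card κ + 1) * corr P p q l s N c d ∧
    diagS (fun u w => repW κ u w * corrExt P p q l s N u w)
      = diagS (corr P p q l s N) - Fintype.card κ * corr P p q l s N c c ∧
    ∀ x, rowS (fun u w => repW κ u w * corrExt P p q l s N u w) (some (some x))
      = rowS (corr P p q l s N) x
        - 2 * Fintype.card κ * freshCol (corr P p q l s N) c d x := by
  obtain ⟨v1, v2, v3, v4, v5⟩ := corrExt_values (P := P) (p := p) (q := q) hcd hc hd N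
  have v2' : ∀ x, corrExt P p q l s N (some none) (some (some x))
      = freshCol (corr P p q l s N) c d x := fun x => by rw [corrExt_comm, v2]
  simp_rw [offS_eq, rowS_eq]
  unfold diagS
  simp only [Fintype.sum_option, repW, v1, v2, v2', v3, v4, v5]
  simp only [Finset.sum_add_distrib, ← Finset.mul_sum, one_mul, zero_mul, Finset.sum_const_zero]
  refine ⟨?_, ?_, fun x => ?_⟩ <;> ring

end Fresh

/-! ### Solving the cavity equations up to higher order -/

/-- The sequences of order `N ^ (-m / 2)`, as a submodule. -/
noncomputable def negl (m : ℕ) : Submodule ℝ (ℕ → ℝ) where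
  carrier := {f | ∃ C : ℝ, ∀ N : ℕ, 1 ≤ N → |f N| ≤ C * (1 / Real.sqrt N) ^ m}
  zero_mem' := ⟨0, fun N _ => by simp⟩
  add_mem' := by
    rintro f g ⟨C, hC⟩ ⟨C', hC'⟩
    refine ⟨C + C', fun N hN => ?_⟩
    rw [add_mul]
    exact (abs_add_le _ _).trans (add_le_add (hC N hN) (hC' N hN))
  smul_mem' := by
    rintro a f ⟨C, hC⟩
    refine ⟨|a| * C, fun N hN => ?_⟩
    rw [Pi.smul_apply, smul_eq_mul, abs_mul, mul_assoc]
    exact mul_le_mul_of_nonneg_left (hC N hN) (abs_nonneg a)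

lemma mem_negl {m : ℕ} {f : ℕ → ℝ} :
    f ∈ negl m ↔ ∃ C : ℝ, ∀ N : ℕ, 1 ≤ N → |f N| ≤ C * (1 / Real.sqrt N) ^ m := Iff.rfl

/-- Linear functionals that vanish on a submodule detect its elements. -/
lemma mem_of_forall_dual {V : Type*} [AddCommGroup V] [Module ℝ V] {W : Submodule ℝ V} {v : V}
    (h : ∀ ψ : V →ₗ[ℝ] ℝ, (∀ u ∈ W, ψ u = 0) → ψ v = 0) : v ∈ W := by
  by_contra hv
  obtain ⟨ψ, hψ, hW⟩ := Submodule.exists_le_ker_of_notMem hv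
  exact hψ (h ψ fun u hu => hW hu)

section Sums

variable {κ : Type*} [Fintype κ] [DecidableEq κ] {V : Type*} [AddCommGroup V] [Module ℝ V]

lemma offS_apply (w : κ → κ → ℕ → ℝ) (N : ℕ) : offS w N = offS fun x y => w x y N := by
  simp [offS]

lemma diagS_apply (w : κ → κ → ℕ → ℝ) (N : ℕ) : diagS w N = diagS fun x y => w x y N := by
  simp [diagS]

lemma rowS_apply (w : κ → κ → ℕ → ℝ) (x : κ) (N : ℕ) :
    rowS w x N = rowS (fun x y => w x y N) x := by
  simp [rowS]

lemma freshCol_apply (w : κ → κ → ℕ → ℝ) (c d x : κ) (N : ℕ) :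
    freshCol w c d x N = freshCol (fun x y => w x y N) c d x := by
  unfold freshCol; split_ifs <;> rfl

lemma map_offS (ψ : V →ₗ[ℝ] ℝ) (w : κ → κ → V) : ψ (offS w) = offS fun x y => ψ (w x y) := by
  simp [offS, map_sum]

lemma map_diagS (ψ : V →ₗ[ℝ] ℝ) (w : κ → κ → V) : ψ (diagS w) = diagS fun x y => ψ (w x y) := by
  simp [diagS, map_sum]

lemma map_rowS (ψ : V →ₗ[ℝ] ℝ) (w : κ → κ → V) (x : κ) :
    ψ (rowS w x) = rowS (fun x y => ψ (w x y)) x := by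
  simp [rowS, map_sum]

lemma map_freshCol (ψ : V →ₗ[ℝ] ℝ) (w : κ → κ → V) (c d x : κ) :
    ψ (freshCol w c d x) = freshCol (fun x y => ψ (w x y)) c d x := by
  unfold freshCol; split_ifs <;> rfl

end Sums

section Solve

variable {P : Params} {p q : ℝ} {κ : Type*} [Fintype κ] [DecidableEq κ] {J : Type*} [DecidableEq J]

/-- The cavity equation, averaged over the sites. The error has two orders more than the product of
the forms, while the correlation on the left has only one order more. -/
lemma HighTemp.cavity_eq (h : HighTemp P p q) (x y : κ) (l : J → κ → κ → ℝ) (s : Finset J) :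
    (fun N : ℕ => corr P p q l s N x y
      - (1 / (N : ℝ) * ∑ j ∈ s, (∑ u, ∑ w, l j u w * theta P p q x y u w) *
          nuK P N (fun σ : κ → Config P.S N => prodOv p q l (s.erase j) σ)
        + P.β ^ 2 / 2 * cavMain P p q N x y l s)) ∈ negl (s.card + 2) := by
  obtain ⟨C, hC⟩ := Asymptotics.isBigO_top.1 (h.cavity_site x y l s)
  refine ⟨C, fun N hN => ?_⟩
  have hN0 : (0 : ℝ) < N := by exact_mod_cast hN
  set b : ℝ := 1 / (N : ℝ) * ∑ j ∈ s, (∑ u, ∑ w, l j u w * theta P p q x y u w) *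
          nuK P N (fun σ : κ → Config P.S N => prodOv p q l (s.erase j) σ)
        + P.β ^ 2 / 2 * cavMain P p q N x y l s with hb
  have hC' : ∀ o : Fin N, |nuK P N (fun σ : κ → Config P.S N =>
      ((σ x o).val * (σ y o).val - mu p q x y) * prodOv p q l s σ) - b|
      ≤ C * (1 / Real.sqrt N) ^ (s.card + 2) := fun o => by
    have := hC ⟨N, o⟩
    rwa [Real.norm_eq_abs, Real.norm_of_nonneg (by unfold ordS; positivity)] at this
  have e : corr P p q l s N x y - b = 1 / (N : ℝ) * ∑ o : Fin N, (nuK P N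
      (fun σ : κ → Config P.S N => ((σ x o).val * (σ y o).val - mu p q x y) * prodOv p q l s σ)
        - b) := by
    rw [Finset.sum_sub_distrib, Finset.sum_const, Finset.card_univ, Fintype.card_fin, nsmul_eq_mul,
      mul_sub, ← mul_assoc, one_div_mul_cancel hN0.ne', one_mul]
    congr 1
    unfold corr nuK
    rw [← gnu_sum, ← gnu_const_mul]
    congr 1
    funext σ
    unfold ov
    rw [← Finset.sum_mul, Finset.sum_sub_distrib, Finset.sum_const, Finset.card_univ,
      Fintype.card_fin, nsmul_eq_mul]
    field_simp
  change |corr P p q l s N x y - b| ≤ _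
  rw [e, abs_mul, abs_of_pos (by positivity), one_div, inv_mul_le_iff₀ hN0]
  refine (Finset.abs_sum_le_sum_abs _ _).trans ((Finset.sum_le_sum fun o _ => hC' o).trans
    (le_of_eq ?_))
  rw [Finset.sum_const, Finset.card_univ, Fintype.card_fin, nsmul_eq_mul]

/-- The source terms of the linear system of the cavity equations. -/
noncomputable def source (P : Params) (p q : ℝ) (l : J → κ → κ → ℝ) (s : Finset J) (x y : κ)
    (N : ℕ) : ℝ :=
  1 / (N : ℝ) * ∑ j ∈ s, l j x y *
    nuK P N (fun σ : κ → Config P.S N => prodOv p q l (s.erase j) σ)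

lemma source_sum (l : J → κ → κ → ℝ) (s : Finset J) (a : κ → κ → ℝ) (N : ℕ) :
    1 / (N : ℝ) * ∑ j ∈ s, (∑ u, ∑ w, l j u w * a u w) *
        nuK P N (fun σ : κ → Config P.S N => prodOv p q l (s.erase j) σ)
      = ∑ u, ∑ w, source P p q l s u w N * a u w := by
  unfold source
  simp_rw [Finset.sum_mul, Finset.mul_sum, Finset.sum_mul]
  rw [Finset.sum_comm]
  refine Finset.sum_congr rfl fun u _ => ?_
  rw [Finset.sum_comm]
  refine Finset.sum_congr rfl fun w _ => Finset.sum_congr rfl fun j _ => ?_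
  ring

/-- The conditions on the constants under which the cavity equations can be solved. -/
structure Solvable (P : Params) (p q : ℝ) : Prop where
  cM3_pos : 0 < cM3 P p q
  cM_pos : 0 < cM P p q

/-- The correlations of the overlaps with a product of forms, up to higher order. The cavity
equations hold modulo `negl (s.card + 2)`, so they become exact under every functional that vanishes
on this submodule. -/
lemma HighTemp.corr_solution (h : HighTemp P p q) (hM : Solvable P p q) {l : J → κ → κ → ℝ}
    {s : Finset J} {c d : κ} (hcd : c ≠ d) (hc : IsFresh l s c) (hd : IsFresh l s d) :
    (∀ x y, x ≠ y → x ≠ c → x ≠ d → y ≠ c → y ≠ d →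
      ((fun N => corr P p q l s N x y - corr P p q l s N x c - corr P p q l s N y c
        + corr P p q l s N c d - varA2 P p q 1 * (source P p q l s x y N + source P p q l s y x N))
        ∈ negl (s.card + 2))) ∧
    (∀ x, x ≠ c → x ≠ d → ((fun N => corr P p q l s N x c - corr P p q l s N c d
      - (varA1 P p q 1 * rowS (fun x y => source P p q l s x y N) x
        + covC1 P p q 1 * source P p q l s x x N)) ∈ negl (s.card + 2))) ∧
    (∀ x, x ≠ c → x ≠ d → ((fun N => corr P p q l s N x x - corr P p q l s N c c
      - (covC1 P p q 1 * rowS (fun x y => source P p q l s x y N) x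
        + varB1 P p q 1 * source P p q l s x x N)) ∈ negl (s.card + 2))) ∧
    ((fun N => corr P p q l s N c d
      - (varA0 P p q 1 * offS (fun x y => source P p q l s x y N)
        + covC0 P p q 1 * diagS (fun x y => source P p q l s x y N))) ∈ negl (s.card + 2)) ∧
    ((fun N => corr P p q l s N c c
      - (covC0 P p q 1 * offS (fun x y => source P p q l s x y N)
        + varB0 P p q 1 * diagS (fun x y => source P p q l s x y N))) ∈ negl (s.card + 2)) := by
  set nF : κ → κ → ℕ → ℝ := fun x y N => corr P p q l s N x y with hnF
  set wF : κ → κ → ℕ → ℝ := source P p q l s with hwF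
  set off : ℕ → ℝ := offS nF - (2 * Fintype.card κ : ℝ) • ∑ x, freshCol nF c d x
      + (Fintype.card κ * (Fintype.card κ + 1) : ℝ) • nF c d with hoff
  set diag : ℕ → ℝ := diagS nF - (Fintype.card κ : ℝ) • nF c c with hdiag
  set row : κ → ℕ → ℝ := fun x =>
    rowS nF x - (2 * Fintype.card κ : ℝ) • freshCol nF c d x with hrow
  -- two relations between the constants, which reduce the system to that of
  -- `linear_system_solution`
  have hK : cI5 P p q = cK3 P p q := by
    rw [h.isReplicaSymmetric.cI5_eq, h.isReplicaSymmetric.cK3_eq]; ring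
  have hF : cF P p q = cA P p q + cG P p q := by rw [cA_eq, cF_eq, cG_eq]; ring
  have hfun : ∀ N, offS (fun u w => repW κ u w * corrExt P p q l s N u w) = off N ∧
      diagS (fun u w => repW κ u w * corrExt P p q l s N u w) = diag N ∧
      ∀ x, rowS (fun u w => repW κ u w * corrExt P p q l s N u w) (some (some x)) = row x N := by
    intro N
    obtain ⟨r1, r2, r3⟩ := repW_sums (P := P) (p := p) (q := q) hcd hc hd N
    refine ⟨?_, ?_, fun x => ?_⟩
    · rw [r1, hoff]
      simp only [Pi.add_apply, Pi.sub_apply, Pi.smul_apply, smul_eq_mul, Finset.sum_apply,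
        offS_apply, freshCol_apply, hnF]
    · rw [r2, hdiag]
      simp only [Pi.sub_apply, Pi.smul_apply, smul_eq_mul, diagS_apply, hnF]
    · rw [r3, hrow]
      simp only [Pi.sub_apply, Pi.smul_apply, smul_eq_mul, rowS_apply, freshCol_apply, hnF]
  have hmain : ∀ (N : ℕ) (x y : κ), cavMain P p q N x y l s = ∑ u, ∑ w,
      (repW κ u w * corrExt P p q l s N u w) *
        theta P p q (some (some x)) (some (some y)) u w := fun N x y =>
    Finset.sum_congr rfl fun u _ => Finset.sum_congr rfl fun w _ => by unfold corrExt; ring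
  have hext : ∀ (N : ℕ) (x y : κ),
      repW κ (some (some x)) (some (some y)) * corrExt P p q l s N (some (some x)) (some (some y))
        = nF x y N := fun N x y => by
    rw [(corrExt_values (P := P) (p := p) (q := q) hcd hc hd N).1]
    simp only [repW, one_mul, hnF]
  -- the off-diagonal and the diagonal cavity equations as congruences
  have hneg1 : ∀ x y, x ≠ y → nF x y - (cI3 P p q • offS wF + cK3 P p q • diagS wF
      + cG P p q • (rowS wF x + rowS wF y) + cA P p q • (wF x y + wF y x)
      + cE P p q • (wF x x + wF y y) + (P.β ^ 2 / 2) • (cI3 P p q • off + cK3 P p q • diag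
        + cG P p q • (row x + row y) + cA P p q • ((2 : ℝ) • nF x y)
        + cE P p q • (nF x x + nF y y))) ∈ negl (s.card + 2) := by
    intro x y hxy
    convert h.cavity_eq x y l s using 1
    funext N
    rw [source_sum, hmain, h.isReplicaSymmetric.sum_theta_of_ne _ hxy,
      h.isReplicaSymmetric.sum_theta_of_ne _ (by simpa using hxy : some (some x) ≠ some (some y)),
      (hfun N).1, (hfun N).2.1, (hfun N).2.2, (hfun N).2.2, hext, hext, hext, hext, hK]
    simp only [Pi.add_apply, Pi.sub_apply, Pi.smul_apply, smul_eq_mul, offS_apply, diagS_apply,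
      rowS_apply, hwF]
    rw [show nF y x N = nF x y N from corr_comm l s N y x]
    simp only [hnF]
    ring
  have hneg2 : ∀ x, nF x x - (cK3 P p q • offS wF + cK4 P p q • diagS wF
      + cE P p q • rowS wF x + cD P p q • wF x x + (P.β ^ 2 / 2) • (cK3 P p q • off
        + cK4 P p q • diag + cE P p q • row x + cD P p q • nF x x)) ∈ negl (s.card + 2) := by
    intro x
    convert h.cavity_eq x x l s using 1
    funext N
    rw [source_sum, hmain, h.isReplicaSymmetric.sum_theta_self,
      h.isReplicaSymmetric.sum_theta_self,
      (hfun N).1, (hfun N).2.1, (hfun N).2.2, hext]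
    simp only [Pi.add_apply, Pi.sub_apply, Pi.smul_apply, smul_eq_mul, offS_apply, diagS_apply,
      rowS_apply, hwF]
    simp only [hnF]
  have hsrc : ∀ {e : κ}, IsFresh l s e → ∀ x, wF x e = 0 ∧ wF e x = 0 := by
    intro e he x
    constructor <;> funext N <;> simp only [hwF, source, Pi.zero_apply]
    · rw [Finset.sum_eq_zero fun j hj => by rw [(he j hj x).1, zero_mul], mul_zero]
    · rw [Finset.sum_eq_zero fun j hj => by rw [(he j hj x).2, zero_mul], mul_zero]
  have key := fun (ψ : (ℕ → ℝ) →ₗ[ℝ] ℝ) (hψ : ∀ u ∈ negl (s.card + 2), ψ u = 0) =>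
    linear_system_solution (A := cA P p q) (D := cD P p q) (E := cE P p q) (G := cG P p q)
      (I3 := cI3 P p q) (K := cK3 P p q) (K4 := cK4 P p q) (b := P.β ^ 2) (A2 := varA2 P p q 1)
      (A1 := varA1 P p q 1) (B1 := varB1 P p q 1) (C1 := covC1 P p q 1) (A0 := varA0 P p q 1)
      (B0 := varB0 P p q 1) (C0 := covC0 P p q 1) (M1 := cM1 P p q) (M2 := cM2 P p q)
      (M3 := cM3 P p q) (M := cM P p q) (by unfold cM1; rw [hF]; ring) rfl
      (by unfold cM3; rw [hF]; ring) (by unfold cM; ring) hM.cM3_pos.ne' hM.cM_pos.ne'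
      (by unfold varA2 cM3; rw [hF]; push_cast; congr 1; ring)
      (by unfold varA1; push_cast; ring) (by unfold varB1; push_cast; ring)
      (by unfold covC1; push_cast; ring) (by unfold varA0; rw [hK]; push_cast; ring)
      (by unfold varB0; rw [hK]; push_cast; ring) (by unfold covC0; rw [hK]; push_cast; ring)
      (n := fun x y => ψ (nF x y)) (w := fun x y => ψ (wF x y)) hcd
      (fun x y => congrArg ψ (funext fun N => corr_comm l s N x y))
      (fun x hxc hxd => congrArg ψ (funext fun N => corr_fresh_right hc hd N hxc hxd))
      (congrArg ψ (funext fun N => corr_fresh_self hc hd N))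
      (fun x => by rw [(hsrc hc x).1, (hsrc hc x).2, map_zero]; exact ⟨rfl, rfl⟩)
      (fun x => by rw [(hsrc hd x).1, (hsrc hd x).2, map_zero]; exact ⟨rfl, rfl⟩)
      (off := ψ off) (diag := ψ diag) (row := fun x => ψ (row x))
      (by simp only [hoff, map_add, map_sub, map_smul, smul_eq_mul, map_sum, map_offS, map_freshCol])
      (by simp only [hdiag, map_sub, map_smul, smul_eq_mul, map_diagS])
      (fun x => by simp only [hrow, map_sub, map_smul, smul_eq_mul, map_rowS, map_freshCol])
      (fun x y hxy => by
        have := hψ _ (hneg1 x y hxy)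
        simp only [map_sub, map_add, map_smul, smul_eq_mul, map_offS, map_diagS, map_rowS] at this
        linear_combination this)
      (fun x => by
        have := hψ _ (hneg2 x)
        simp only [map_sub, map_add, map_smul, smul_eq_mul, map_offS, map_diagS, map_rowS] at this
        linear_combination this)
  refine ⟨fun x y hxy hxc hxd hyc hyd => mem_of_forall_dual fun ψ hψ => ?_,
    fun x hxc hxd => mem_of_forall_dual fun ψ hψ => ?_,
    fun x hxc hxd => mem_of_forall_dual fun ψ hψ => ?_,
    mem_of_forall_dual fun ψ hψ => ?_, mem_of_forall_dual fun ψ hψ => ?_⟩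
  · have := (key ψ hψ).1 x y hxy hxc hxd hyc hyd
    rw [show (fun N => nF x y N - nF x c N - nF y c N + nF c d N
      - varA2 P p q 1 * (wF x y N + wF y x N)) = nF x y - nF x c - nF y c + nF c d
        - varA2 P p q 1 • (wF x y + wF y x) from rfl]
    simp only [map_sub, map_add, map_smul, smul_eq_mul]
    linear_combination this
  · have := (key ψ hψ).2.1 x hxc hxd
    rw [show (fun N => nF x c N - nF c d N - (varA1 P p q 1 * rowS (fun x y => wF x y N) x
      + covC1 P p q 1 * wF x x N)) = nF x c - nF c d
        - (varA1 P p q 1 • rowS wF x + covC1 P p q 1 • wF x x) from by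
      funext N; simp [rowS_apply]]
    simp only [map_sub, map_add, map_smul, smul_eq_mul, map_rowS]
    linear_combination this
  · have := (key ψ hψ).2.2.1 x hxc hxd
    rw [show (fun N => nF x x N - nF c c N - (covC1 P p q 1 * rowS (fun x y => wF x y N) x
      + varB1 P p q 1 * wF x x N)) = nF x x - nF c c
        - (covC1 P p q 1 • rowS wF x + varB1 P p q 1 • wF x x) from by
      funext N; simp [rowS_apply]]
    simp only [map_sub, map_add, map_smul, smul_eq_mul, map_rowS]
    linear_combination this
  · have := (key ψ hψ).2.2.2.1
    rw [show (fun N => nF c d N - (varA0 P p q 1 * offS (fun x y => wF x y N)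
      + covC0 P p q 1 * diagS (fun x y => wF x y N))) = nF c d
        - (varA0 P p q 1 • offS wF + covC0 P p q 1 • diagS wF) from by
      funext N; simp [offS_apply, diagS_apply]]
    simp only [map_sub, map_add, map_smul, smul_eq_mul, map_offS, map_diagS]
    linear_combination this
  · have := (key ψ hψ).2.2.2.2
    rw [show (fun N => nF c c N - (covC0 P p q 1 * offS (fun x y => wF x y N)
      + varB0 P p q 1 * diagS (fun x y => wF x y N))) = nF c c
        - (covC0 P p q 1 • offS wF + varB0 P p q 1 • diagS wF) from by
      funext N; simp [offS_apply, diagS_apply]]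
    simp only [map_sub, map_add, map_smul, smul_eq_mul, map_offS, map_diagS]
    linear_combination this

end Solve

/-! ### The basis variables as forms in the overlaps -/

/-- The matrix with a single entry `1`, in the row `a` and the column `b`. -/
def unitForm {κ : Type*} [DecidableEq κ] (a b x y : κ) : ℝ := if x = a ∧ y = b then 1 else 0

/-- The replicas used for a product of basis variables indexed by `J`: the `n` given ones, and two
more for each factor, which represent the factors `⟨σ_i⟩` and `⟨σ_i ^ 2⟩` in it. -/
abbrev RepIndex (n : ℕ) (J : Type*) : Type _ := Fin n ⊕ J × Bool

/-- The form in the centered overlaps that represents a basis variable, `c` and `d` being the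
additional replicas. The coefficients of `T` and `S` have sum `1` and keep the centering `-q` or
`-p`; those of the other variables have sum `0` and remove it. -/
def basisForm {n : ℕ} {J : Type*} [DecidableEq J] (c d : RepIndex n J) :
    BasisIndex n → RepIndex n J → RepIndex n J → ℝ
  | .Tpair e => fun x y => unitForm (Sum.inl e.1.1) (Sum.inl e.1.2) x y
      - unitForm c (Sum.inl e.1.2) x y - unitForm (Sum.inl e.1.1) d x y + unitForm c d x y
  | .Trep k => fun x y => unitForm (Sum.inl k) d x y - unitForm c d x y
  | .Srep k => fun x y => unitForm (Sum.inl k) (Sum.inl k) x y - unitForm c c x y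
  | .T => unitForm c d
  | .S => unitForm c c

section Forms

variable {κ : Type*} [Fintype κ] [DecidableEq κ]

lemma offS_sub (v w : κ → κ → ℝ) : offS (fun x y => v x y - w x y) = offS v - offS w := by
  simp [offS, Finset.sum_sub_distrib]

lemma offS_add (v w : κ → κ → ℝ) : offS (fun x y => v x y + w x y) = offS v + offS w := by
  simp [offS, Finset.sum_add_distrib]

lemma diagS_sub (v w : κ → κ → ℝ) : diagS (fun x y => v x y - w x y) = diagS v - diagS w := by
  simp [diagS, Finset.sum_sub_distrib]

lemma diagS_add (v w : κ → κ → ℝ) : diagS (fun x y => v x y + w x y) = diagS v + diagS w := by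
  simp [diagS, Finset.sum_add_distrib]

lemma rowS_sub (v w : κ → κ → ℝ) (x : κ) :
    rowS (fun x y => v x y - w x y) x = rowS v x - rowS w x := by
  simp only [rowS_eq, Finset.sum_add_distrib, Finset.sum_sub_distrib]; ring

lemma rowS_add (v w : κ → κ → ℝ) (x : κ) :
    rowS (fun x y => v x y + w x y) x = rowS v x + rowS w x := by
  simp only [rowS_eq, Finset.sum_add_distrib]; ring

lemma diagS_unitForm (a b : κ) : diagS (unitForm a b) = if a = b then 1 else 0 := by
  unfold diagS unitForm
  simp_rw [ite_and]
  simp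

lemma offS_unitForm (a b : κ) : offS (unitForm a b) = if a = b then 0 else 1 := by
  rw [offS_eq]
  have := diagS_unitForm a b
  unfold diagS at this
  rw [this]
  unfold unitForm
  simp_rw [ite_and]
  split_ifs <;> simp [*]

lemma rowS_unitForm (a b x : κ) :
    rowS (unitForm a b) x
      = if a = b then 0 else (if x = a then 1 else 0) + if x = b then 1 else 0 := by
  rw [rowS_eq]
  unfold unitForm
  simp_rw [Finset.sum_add_distrib, ite_and]
  by_cases h1 : x = a
  · subst h1
    by_cases h2 : x = b
    · subst h2; simp; norm_num
    · simp [h2]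
  · by_cases h2 : x = b
    · subst h2; simp [h1, Ne.symm h1]
    · simp [h1, h2]

lemma sum_unitForm_mul (a b : κ) (f : κ → κ → ℝ) : ∑ x, ∑ y, unitForm a b x y * f x y = f a b := by
  unfold unitForm
  simp_rw [ite_and, ite_mul, one_mul, zero_mul]
  simp

variable {n : ℕ} {J : Type*} [Fintype J] [DecidableEq J] (i : J) (Y : BasisIndex n)

/-- Each kind of basis variable is detected by one of the combinations of entries that occur in
`HighTemp.corr_solution`: the pairs here, and `S_k`, `T_k`, `T` and `S` in the following lemmas. -/
lemma basisForm_pair (e : Pair n) :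
    basisForm (Sum.inr (i, false)) (Sum.inr (i, true)) Y (Sum.inl e.1.1) (Sum.inl e.1.2)
      + basisForm (Sum.inr (i, false)) (Sum.inr (i, true)) Y (Sum.inl e.1.2) (Sum.inl e.1.1)
      = if Y = .Tpair e then 1 else 0 := by
  have he := e.2.ne
  cases Y with
  | Tpair e' =>
    have he' := e'.2
    have hlt := e.2
    simp only [basisForm, unitForm, Sum.inl.injEq, reduceCtorEq, false_and, and_false, if_false,
      BasisIndex.Tpair.injEq, Subtype.ext_iff, Prod.ext_iff]
    have : ¬ (e.1.2 = e'.1.1 ∧ e.1.1 = e'.1.2) := by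
      rintro ⟨h1, h2⟩
      rw [← h1, ← h2] at he'
      exact absurd he' hlt.asymm
    rw [if_neg this, if_congr (and_congr eq_comm eq_comm) rfl rfl]
    ring
  | Srep k =>
    simp only [basisForm, unitForm, Sum.inl.injEq, reduceCtorEq, false_and, if_false]
    rw [if_neg fun h => he (h.1.trans h.2.symm), if_neg fun h => he (h.2.trans h.1.symm)]
    ring
  | _ => simp [basisForm, unitForm]

lemma basisForm_diag (k : Fin n) :
    basisForm (Sum.inr (i, false)) (Sum.inr (i, true)) Y (Sum.inl k) (Sum.inl k)
      = if Y = .Srep k then 1 else 0 := by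
  cases Y with
  | Tpair e =>
    simp only [basisForm, unitForm, Sum.inl.injEq, reduceCtorEq, false_and, and_false, if_false]
    rw [if_neg fun h => e.2.ne (h.1.symm.trans h.2)]
    ring
  | Srep l => simp [basisForm, unitForm, eq_comm]
  | _ => simp [basisForm, unitForm]

lemma rowS_basisForm (k : Fin n) :
    rowS (basisForm (Sum.inr (i, false)) (Sum.inr (i, true)) Y) (Sum.inl k)
      = if Y = .Trep k then 1 else 0 := by
  cases Y with
  | Tpair e =>
    simp only [basisForm, rowS_add, rowS_sub, rowS_unitForm]
    simp [e.2.ne]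
  | Trep l => simp [basisForm, rowS_sub, rowS_unitForm, eq_comm]
  | Srep l => simp [basisForm, rowS_sub, rowS_unitForm]
  | _ => simp [basisForm, rowS_unitForm]

lemma offS_basisForm :
    offS (basisForm (Sum.inr (i, false)) (Sum.inr (i, true)) Y) = if Y = .T then 1 else 0 := by
  cases Y with
  | Tpair e => simp [basisForm, offS_add, offS_sub, offS_unitForm, e.2.ne]
  | Trep l => simp [basisForm, offS_sub, offS_unitForm]
  | Srep l => simp [basisForm, offS_sub, offS_unitForm]
  | _ => simp [basisForm, offS_unitForm]

lemma diagS_basisForm :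
    diagS (basisForm (Sum.inr (i, false)) (Sum.inr (i, true)) Y) = if Y = .S then 1 else 0 := by
  cases Y with
  | Tpair e => simp [basisForm, diagS_add, diagS_sub, diagS_unitForm, e.2.ne]
  | Trep l => simp [basisForm, diagS_sub, diagS_unitForm]
  | Srep l => simp [basisForm, diagS_sub, diagS_unitForm]
  | _ => simp [basisForm, diagS_unitForm]

/-- The forms of a family of basis variables. -/
def basisForms (X : J → BasisIndex n) (j : J) : RepIndex n J → RepIndex n J → ℝ :=
  basisForm (Sum.inr (j, false)) (Sum.inr (j, true)) (X j)

lemma isFresh_basisForms (X : J → BasisIndex n) {s : Finset J} {i : J} (hi : i ∉ s) (b : Bool) :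
    IsFresh (basisForms X) s (Sum.inr (i, b)) := by
  intro j hj u
  have hij : i ≠ j := fun h => hi (h ▸ hj)
  unfold basisForms
  cases X j <;> simp [basisForm, unitForm, hij]

end Forms

section Factor

variable {P : Params} {p q : ℝ} {n : ℕ} {J : Type*} [Fintype J] [DecidableEq J]

lemma ravg_prodType {Ω : Type*} [Fintype Ω] (H : Ω → ℝ) (F : J → (Bool → Ω) → ℝ) :
    ravg H (fun τ : J × Bool → Ω => ∏ j, F j fun b => τ (j, b)) = ∏ j, ravg H (F j) := by
  unfold ravg
  rw [← (Equiv.curry J Bool Ω).symm.sum_comp, Fintype.prod_sum]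
  refine Finset.sum_congr rfl fun τ _ => ?_
  rw [Fintype.prod_prod_type, Finset.prod_mul_distrib]
  rfl

/-- The average over two replicas of a product of functions of each of them. -/
lemma ravg_bool {Ω : Type*} [Fintype Ω] (H : Ω → ℝ) (f f' : Ω → ℝ) :
    ravg H (fun τ : Bool → Ω => f (τ false) * f' (τ true))
      = (∑ x, f x * boltz H x) * ∑ x, f' x * boltz H x := by
  have := ravg_prod H fun b : Bool => if b then f' else f
  simp only [Fintype.prod_bool, if_true, Bool.false_eq_true, if_false] at this
  rw [mul_comm, ← this]
  congr 1
  funext τ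
  rw [mul_comm]

lemma magnetization_eq {N : ℕ} (g : Disorder N) (i : Fin N) :
    magnetization P g i = ∑ σ : Config P.S N, (σ i).val * boltz (hamiltonian P g) σ := by
  unfold magnetization
  rw [gibbsAvg_eq, ← hamiltonian_eq]
  have := ravg_prod (hamiltonian P g) fun (_ : Fin 1) σ => (σ i).val
  simpa using this

lemma secondMoment_eq {N : ℕ} (g : Disorder N) (i : Fin N) :
    secondMoment P g i = ∑ σ : Config P.S N, (σ i).val ^ 2 * boltz (hamiltonian P g) σ := by
  unfold secondMoment
  rw [gibbsAvg_eq, ← hamiltonian_eq]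
  have := ravg_prod (hamiltonian P g) fun (_ : Fin 1) σ => (σ i).val ^ 2
  simpa using this

/-- A basis variable is the average, over the two additional replicas, of its form. -/
lemma basisVar_eq_ravg {N : ℕ} (g : Disorder N) (σ : Fin n → Config P.S N) (j : J)
    (X : BasisIndex n) (τ₀ : J × Bool → Config P.S N) :
    basisVar P p q g σ X = ravg (hamiltonian P g) fun τ : Bool → Config P.S N =>
      ovLin p q (basisForm (Sum.inr (j, false)) (Sum.inr (j, true)) X)
        (Sum.elim σ fun a => if a.1 = j then τ a.2 else τ₀ a) := by
  set H := hamiltonian P g with hH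
  have h1 : ∀ (a b : ℝ) (v : Fin N → ℝ) (i : Fin N), ∑ x : Config P.S N,
      (a * (x i).val ^ 2 + b * (x i).val + v i) * boltz H x
      = a * secondMoment P g i + b * magnetization P g i + v i := by
    intro a b v i
    rw [secondMoment_eq, magnetization_eq]
    simp_rw [add_mul, Finset.sum_add_distrib, mul_assoc, ← Finset.mul_sum]
    rw [sum_boltz, mul_one]
  -- averaging a sum over the sites of products of functions of the two replicas
  have key : ∀ (a b a' b' : ℝ) (v v' : Fin N → ℝ) (C : ℝ),
      ravg H (fun τ : Bool → Config P.S N => 1 / (N : ℝ) * ∑ i,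
        ((a * (τ false i).val ^ 2 + b * (τ false i).val + v i)
          * (a' * (τ true i).val ^ 2 + b' * (τ true i).val + v' i)) - C)
      = 1 / (N : ℝ) * ∑ i, ((a * secondMoment P g i + b * magnetization P g i + v i)
        * (a' * secondMoment P g i + b' * magnetization P g i + v' i)) - C := by
    intro a b a' b' v v' C
    rw [ravg_sub, ravg_const_mul, ravg_sum, ravg_const]
    congr 2
    refine Finset.sum_congr rfl fun i _ => ?_
    rw [ravg_bool H (fun x => a * (x i).val ^ 2 + b * (x i).val + v i)
      (fun x => a' * (x i).val ^ 2 + b' * (x i).val + v' i), h1, h1]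
  have hmu : ∀ {x y : RepIndex n J}, x ≠ y → mu p q x y = q := fun h => if_neg h
  have hmu' : ∀ x : RepIndex n J, mu p q x x = p := fun x => if_pos rfl
  cases X with
  | Tpair e =>
    have := key 0 (-1) 0 (-1) (fun i => (σ e.1.1 i).val) (fun i => (σ e.1.2 i).val) 0
    convert this.symm using 1
    · simp only [basisVar]
      rw [sub_zero]
      congr 1
      refine Finset.sum_congr rfl fun i _ => ?_
      ring
    · congr 1
      funext τ
      have e1 : ∀ i, (0 * (τ false i).val ^ 2 + -1 * (τ false i).val + (σ e.1.1 i).val)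
          * (0 * (τ true i).val ^ 2 + -1 * (τ true i).val + (σ e.1.2 i).val)
          = (σ e.1.1 i).val * (σ e.1.2 i).val - (τ false i).val * (σ e.1.2 i).val
            - (σ e.1.1 i).val * (τ true i).val + (τ false i).val * (τ true i).val := fun i => by
        ring
      rw [Finset.sum_congr rfl fun i _ => e1 i]
      unfold ovLin
      simp only [basisForm, add_mul, sub_mul, Finset.sum_add_distrib, Finset.sum_sub_distrib,
        sum_unitForm_mul]
      unfold ov
      rw [hmu (by simpa using e.2.ne), hmu (by simp), hmu (by simp), hmu (by simp)]
      simp only [Sum.elim_inl, Sum.elim_inr, if_true]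
      ring
  | Trep k =>
    have := key 0 (-1) 0 1 (fun i => (σ k i).val) (fun i => 0) 0
    convert this.symm using 1
    · simp only [basisVar]
      rw [sub_zero]
      congr 1
      refine Finset.sum_congr rfl fun i _ => ?_
      ring
    · congr 1
      funext τ
      unfold ovLin
      simp only [basisForm, sub_mul, Finset.sum_sub_distrib, sum_unitForm_mul]
      unfold ov
      rw [hmu (by simp), hmu (by simp)]
      simp only [Sum.elim_inl, Sum.elim_inr, if_true]
      rw [sub_sub_sub_cancel_right, ← mul_sub, ← Finset.sum_sub_distrib, sub_zero]
      congr 1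
      refine Finset.sum_congr rfl fun i _ => ?_
      ring
  | Srep k =>
    have := key (-1) 0 0 0 (fun i => (σ k i).val ^ 2) (fun i => 1) 0
    convert this.symm using 1
    · simp only [basisVar]
      rw [sub_zero]
      congr 1
      refine Finset.sum_congr rfl fun i _ => ?_
      ring
    · congr 1
      funext τ
      unfold ovLin
      simp only [basisForm, sub_mul, Finset.sum_sub_distrib, sum_unitForm_mul]
      unfold ov
      rw [hmu', hmu']
      simp only [Sum.elim_inl, Sum.elim_inr, if_true]
      rw [sub_sub_sub_cancel_right, ← mul_sub, ← Finset.sum_sub_distrib, sub_zero]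
      congr 1
      refine Finset.sum_congr rfl fun i _ => ?_
      ring
  | T =>
    have := key 0 1 0 1 (fun i => 0) (fun i => 0) q
    convert this.symm using 1
    · simp only [basisVar]
      congr 2
      refine Finset.sum_congr rfl fun i _ => ?_
      ring
    · congr 1
      funext τ
      unfold ovLin
      simp only [basisForm, sum_unitForm_mul]
      unfold ov
      rw [hmu (by simp)]
      simp only [Sum.elim_inr, if_true]
      congr 2
      refine Finset.sum_congr rfl fun i _ => ?_
      ring
  | S =>
    have := key 1 0 0 0 (fun i => 0) (fun i => 1) p
    convert this.symm using 1
    · simp only [basisVar]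
      congr 2
      refine Finset.sum_congr rfl fun i _ => ?_
      ring
    · congr 1
      funext τ
      unfold ovLin
      simp only [basisForm, sum_unitForm_mul]
      unfold ov
      rw [hmu']
      simp only [Sum.elim_inr, if_true]
      congr 2
      refine Finset.sum_congr rfl fun i _ => ?_
      ring

/-- The form of a basis variable depends only on the given replicas and its own additional ones. -/
lemma ovLin_basisForm_congr {N : ℕ} (σ : Fin n → Config P.S N) (j : J) (X : BasisIndex n)
    {τ τ' : J × Bool → Config P.S N} (h : ∀ b, τ (j, b) = τ' (j, b)) :
    ovLin p q (basisForm (Sum.inr (j, false)) (Sum.inr (j, true)) X) (Sum.elim σ τ)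
      = ovLin p q (basisForm (Sum.inr (j, false)) (Sum.inr (j, true)) X) (Sum.elim σ τ') := by
  unfold ovLin
  cases X <;> simp only [basisForm, add_mul, sub_mul, Finset.sum_add_distrib,
    Finset.sum_sub_distrib, sum_unitForm_mul] <;> simp only [ov, Sum.elim_inl, Sum.elim_inr, h]

lemma gibbsAvg_prod_basisVar (X : J → BasisIndex n) (s : Finset J) {N : ℕ} (g : Disorder N) :
    ravg (hamiltonian P g) (fun σ : Fin n → Config P.S N => ∏ j ∈ s, basisVar P p q g σ (X j))
      = ravg (hamiltonian P g) fun σ : RepIndex n J → Config P.S N =>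
        prodOv p q (basisForms X) s σ := by
  rw [ravg_sumType]
  congr 1
  funext σ
  set F : J → (Bool → Config P.S N) → ℝ := fun j ρ => if j ∈ s then
    ovLin p q (basisForms X j) (Sum.elim σ fun a => if a.1 = j then ρ a.2 else 0) else 1 with hF
  have hfac : ∀ τ : J × Bool → Config P.S N, prodOv p q (basisForms X) s (Sum.elim σ τ)
      = ∏ j, F j fun b => τ (j, b) := by
    intro τ
    unfold prodOv
    simp only [hF]
    rw [Finset.prod_ite_mem, Finset.univ_inter]
    exact Finset.prod_congr rfl fun j _ => ovLin_basisForm_congr σ j (X j) (by simp)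
  rw [funext hfac, ravg_prodType _ F]
  change ∏ j ∈ s, basisVar P p q g σ (X j) = _
  rw [← Finset.univ_inter s, ← Finset.prod_ite_mem]
  refine Finset.prod_congr rfl fun j _ => ?_
  simp only [hF]
  split_ifs with hj
  · exact basisVar_eq_ravg g σ j (X j) 0
  · rw [ravg_const]

/-- The moments of the basis variables are averages of products of forms in the overlaps. -/
lemma nu_prod_basisVar (X : J → BasisIndex n) (s : Finset J) (N : ℕ) :
    nu P (fun (g : Disorder N) (σ : Fin n → Config P.S N) => ∏ j ∈ s, basisVar P p q g σ (X j))
      = nuK P N fun σ : RepIndex n J → Config P.S N => prodOv p q (basisForms X) s σ := by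
  unfold nu nuK gnu
  refine integral_congr_ae (Filter.Eventually.of_forall fun g => ?_)
  change gibbsAvg P g _ = ravg (linH (coupC P N) (fieldD P N) g) _
  rw [gibbsAvg_eq, ← hamiltonian_eq]
  exact gibbsAvg_prod_basisVar X s g

end Factor

/-! ### The recursion for the moments of the basis variables -/

section Scaling

variable (P : Params) (p q : ℝ) (N : ℕ)

lemma varA2_eq : varA2 P p q N = 1 / N * varA2 P p q 1 := by
  simp only [varA2, div_eq_mul_inv, mul_inv, Nat.cast_one, inv_one]; ring

lemma varA1_eq : varA1 P p q N = 1 / N * varA1 P p q 1 := by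
  simp only [varA1, div_eq_mul_inv, mul_inv, Nat.cast_one, inv_one]; ring

lemma varB1_eq : varB1 P p q N = 1 / N * varB1 P p q 1 := by
  simp only [varB1, div_eq_mul_inv, mul_inv, Nat.cast_one, inv_one]; ring

lemma covC1_eq : covC1 P p q N = 1 / N * covC1 P p q 1 := by
  simp only [covC1, div_eq_mul_inv, mul_inv, Nat.cast_one, inv_one]; ring

lemma varA0_eq : varA0 P p q N = 1 / N * varA0 P p q 1 := by
  unfold varA0
  rw [covC1_eq, varA1_eq, varA2_eq]
  simp only [div_eq_mul_inv, mul_inv, Nat.cast_one, inv_one]; ring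

lemma varB0_eq : varB0 P p q N = 1 / N * varB0 P p q 1 := by
  unfold varB0
  rw [covC1_eq, varB1_eq]
  simp only [div_eq_mul_inv, mul_inv, Nat.cast_one, inv_one]; ring

lemma covC0_eq : covC0 P p q N = 1 / N * covC0 P p q 1 := by
  unfold covC0
  rw [covC1_eq, varB1_eq]
  simp only [div_eq_mul_inv, mul_inv, Nat.cast_one, inv_one]; ring

variable (n : ℕ)

lemma covMatrix_eq_smul : covMatrix P p q N n = (1 / (N : ℝ)) • covMatrix P p q 1 n := by
  ext X Y
  rw [Matrix.smul_apply, smul_eq_mul]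
  cases X <;> cases Y <;> simp only [covMatrix, Matrix.of_apply, mul_zero, mul_ite, ← varA2_eq,
    ← varA1_eq, ← varB1_eq, ← covC1_eq, ← varA0_eq, ← varB0_eq, ← covC0_eq]

variable {n} (Y : BasisIndex n)

lemma covMatrix_Tpair (e : Pair n) :
    covMatrix P p q N n (.Tpair e) Y = varA2 P p q N * (if Y = .Tpair e then 1 else 0) := by
  cases Y <;> simp [covMatrix, eq_comm]

lemma covMatrix_Trep (k : Fin n) :
    covMatrix P p q N n (.Trep k) Y = varA1 P p q N * (if Y = .Trep k then 1 else 0)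
      + covC1 P p q N * (if Y = .Srep k then 1 else 0) := by
  cases Y <;> simp [covMatrix, eq_comm]

lemma covMatrix_Srep (k : Fin n) :
    covMatrix P p q N n (.Srep k) Y = covC1 P p q N * (if Y = .Trep k then 1 else 0)
      + varB1 P p q N * (if Y = .Srep k then 1 else 0) := by
  cases Y <;> simp [covMatrix, eq_comm]

lemma covMatrix_T :
    covMatrix P p q N n .T Y = varA0 P p q N * (if Y = .T then 1 else 0)
      + covC0 P p q N * (if Y = .S then 1 else 0) := by
  cases Y <;> simp [covMatrix]

lemma covMatrix_S :
    covMatrix P p q N n .S Y = covC0 P p q N * (if Y = .T then 1 else 0)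
      + varB0 P p q N * (if Y = .S then 1 else 0) := by
  cases Y <;> simp [covMatrix]

end Scaling

section Recursion

variable {P : Params} {p q : ℝ} {n : ℕ} {J : Type*} [Fintype J] [DecidableEq J]

/-- A moment of the basis variables of the model. -/
noncomputable def basisMom (P : Params) (p q : ℝ) (X : J → BasisIndex n) (s : Finset J) (N : ℕ) :
    ℝ :=
  nuK P N fun σ : RepIndex n J → Config P.S N => prodOv p q (basisForms X) s σ

/-- The combinations of the sources in `HighTemp.corr_solution` select the factors that are a given
basis variable. -/
lemma source_basisForms (X : J → BasisIndex n) (s : Finset J) (N : ℕ) :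
    (∀ e : Pair n, source P p q (basisForms X) s (Sum.inl e.1.1) (Sum.inl e.1.2) N
        + source P p q (basisForms X) s (Sum.inl e.1.2) (Sum.inl e.1.1) N
      = 1 / (N : ℝ) * ∑ j ∈ s, (if X j = .Tpair e then 1 else 0) * basisMom P p q X (s.erase j) N) ∧
    (∀ k, rowS (fun x y => source P p q (basisForms X) s x y N) (Sum.inl k)
      = 1 / (N : ℝ) * ∑ j ∈ s, (if X j = .Trep k then 1 else 0) * basisMom P p q X (s.erase j) N) ∧
    (∀ k, source P p q (basisForms X) s (Sum.inl k) (Sum.inl k) N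
      = 1 / (N : ℝ) * ∑ j ∈ s, (if X j = .Srep k then 1 else 0) * basisMom P p q X (s.erase j) N) ∧
    (offS (fun x y => source P p q (basisForms X) s x y N)
      = 1 / (N : ℝ) * ∑ j ∈ s, (if X j = .T then 1 else 0) * basisMom P p q X (s.erase j) N) ∧
    (diagS (fun x y => source P p q (basisForms X) s x y N)
      = 1 / (N : ℝ) * ∑ j ∈ s, (if X j = .S then 1 else 0) * basisMom P p q X (s.erase j) N) := by
  refine ⟨fun e => ?_, fun k => ?_, fun k => ?_, ?_, ?_⟩
  · unfold source
    rw [← mul_add, ← Finset.sum_add_distrib]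
    congr 1
    refine Finset.sum_congr rfl fun j _ => ?_
    rw [← add_mul]
    congr 1
    exact basisForm_pair j (X j) e
  · have e : ∀ j, (if X j = .Trep k then (1 : ℝ) else 0) = rowS (basisForms X j) (Sum.inl k) :=
      fun j => (rowS_basisForm j (X j) k).symm
    simp_rw [e]
    unfold rowS source basisMom basisForms
    simp_rw [Finset.mul_sum, ← Finset.sum_add_distrib, Finset.sum_mul, Finset.mul_sum]
    rw [Finset.sum_comm]
    refine Finset.sum_congr rfl fun u _ => Finset.sum_congr rfl fun j _ => ?_
    ring
  · unfold source
    congr 1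
    refine Finset.sum_congr rfl fun j _ => ?_
    congr 1
    exact basisForm_diag j (X j) k
  · have e : ∀ j, (if X j = .T then (1 : ℝ) else 0) = offS (basisForms X j) :=
      fun j => (offS_basisForm j (X j)).symm
    simp_rw [e]
    unfold offS source basisMom basisForms
    simp_rw [Finset.sum_mul, Finset.mul_sum]
    symm
    rw [Finset.sum_comm]
    refine Finset.sum_congr rfl fun u _ => ?_
    rw [Finset.sum_comm]
  · have e : ∀ j, (if X j = .S then (1 : ℝ) else 0) = diagS (basisForms X j) :=
      fun j => (diagS_basisForm j (X j)).symm
    simp_rw [e]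
    unfold diagS source basisMom basisForms
    simp_rw [Finset.sum_mul, Finset.mul_sum]
    rw [Finset.sum_comm]

/-- A moment is a linear combination of correlations of overlaps with the product of the other
factors. -/
lemma basisMom_insert_eq_sum (X : J → BasisIndex n) {s : Finset J} {i : J} (hi : i ∉ s) (N : ℕ) :
    basisMom P p q X (insert i s) N
      = ∑ u, ∑ w, basisForms X i u w * corr P p q (basisForms X) s N u w := by
  unfold basisMom corr nuK
  simp_rw [← gnu_const_mul, ← gnu_sum]
  congr 1
  funext σ
  unfold prodOv
  rw [Finset.prod_insert hi]
  unfold ovLin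
  simp_rw [Finset.sum_mul]
  refine Finset.sum_congr rfl fun u _ => Finset.sum_congr rfl fun w _ => ?_
  ring

/-- To leading order, the moments of the basis variables satisfy the recursion of the moments of a
Gaussian vector with the covariances `covMatrix`. -/
lemma HighTemp.basisMom_insert (h : HighTemp P p q) (hM : Solvable P p q) (X : J → BasisIndex n)
    {s : Finset J} {i : J} (hi : i ∉ s) :
    (fun N => basisMom P p q X (insert i s) N
      - ∑ j ∈ s, covMatrix P p q N n (X i) (X j) * basisMom P p q X (s.erase j) N)
      ∈ negl (s.card + 2) := by
  have hc := isFresh_basisForms X hi false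
  have hd := isFresh_basisForms X hi true
  obtain ⟨k1, k2, k3, k4, k5⟩ := h.corr_solution hM (c := Sum.inr (i, false))
    (d := Sum.inr (i, true)) (by simp) hc hd
  simp_rw [basisMom_insert_eq_sum X hi]
  cases hX : X i with
  | Tpair e =>
    convert k1 (Sum.inl e.1.1) (Sum.inl e.1.2) (by simpa using e.2.ne) (by simp) (by simp)
      (by simp) (by simp) using 1
    funext N
    rw [(source_basisForms X s N).1]
    simp only [covMatrix_Tpair, basisForms, hX, basisForm, add_mul, sub_mul,
      Finset.sum_add_distrib, Finset.sum_sub_distrib, sum_unitForm_mul]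
    rw [varA2_eq]
    simp_rw [mul_assoc, ← Finset.mul_sum]
    rw [corr_fresh_right (x := Sum.inl e.1.1) hc hd N (by simp) (by simp),
      corr_comm _ _ _ (Sum.inr (i, false)) (Sum.inl e.1.2)]
    unfold basisForms
    ring
  | Trep k =>
    convert k2 (Sum.inl k) (by simp) (by simp) using 1
    funext N
    rw [(source_basisForms X s N).2.1, (source_basisForms X s N).2.2.1]
    simp only [covMatrix_Trep, basisForms, hX, basisForm, sub_mul, add_mul,
      Finset.sum_add_distrib, Finset.sum_sub_distrib, sum_unitForm_mul]
    rw [varA1_eq, covC1_eq]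
    simp_rw [mul_assoc, ← Finset.mul_sum]
    rw [corr_fresh_right (x := Sum.inl k) hc hd N (by simp) (by simp)]
    unfold basisForms
    ring
  | Srep k =>
    convert k3 (Sum.inl k) (by simp) (by simp) using 1
    funext N
    rw [(source_basisForms X s N).2.1, (source_basisForms X s N).2.2.1]
    simp only [covMatrix_Srep, basisForms, hX, basisForm, sub_mul, add_mul,
      Finset.sum_add_distrib, Finset.sum_sub_distrib, sum_unitForm_mul]
    rw [varB1_eq, covC1_eq]
    simp_rw [mul_assoc, ← Finset.mul_sum]
    unfold basisForms
    ring
  | T =>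
    convert k4 using 1
    funext N
    rw [(source_basisForms X s N).2.2.2.1, (source_basisForms X s N).2.2.2.2]
    simp only [covMatrix_T, basisForms, hX, basisForm, add_mul,
      Finset.sum_add_distrib, sum_unitForm_mul]
    rw [varA0_eq, covC0_eq]
    simp_rw [mul_assoc, ← Finset.mul_sum]
    unfold basisForms
    ring
  | S =>
    convert k5 using 1
    funext N
    rw [(source_basisForms X s N).2.2.2.1, (source_basisForms X s N).2.2.2.2]
    simp only [covMatrix_S, basisForms, hX, basisForm, add_mul,
      Finset.sum_add_distrib, sum_unitForm_mul]
    rw [varB0_eq, covC0_eq]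
    simp_rw [mul_assoc, ← Finset.mul_sum]
    unfold basisForms
    ring

lemma basisMom_empty (X : J → BasisIndex n) (N : ℕ) : basisMom P p q X ∅ N = 1 := by
  unfold basisMom prodOv nuK
  simp only [Finset.prod_empty]
  exact gnu_const _ _ _

end Recursion

/-! ### Moments of Gaussian vectors -/

section Gaussian

variable {ι : Type*} [Fintype ι] [DecidableEq ι] {J : Type*} [DecidableEq J]

lemma integrable_gauss_of_le_pow {F : (ι → ℝ) → ℝ} (hF : Continuous F) {C : ℝ} {k : ℕ}
    (hb : ∀ x : EuclideanSpace ℝ ι, |F fun i => x i| ≤ C * ‖x‖ ^ k) : Integrable F (gauss ι) := by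
  have h1 : Integrable (fun x : EuclideanSpace ℝ ι => F fun i => x i)
      (stdGaussian (EuclideanSpace ℝ ι)) := by
    have h2 : Integrable (fun x : EuclideanSpace ℝ ι => ‖id x‖ ^ k)
        (stdGaussian (EuclideanSpace ℝ ι)) :=
      (IsGaussian.memLp_id _ k (by simp)).integrable_norm_pow'
    refine (h2.const_mul C).mono' ?_ (Filter.Eventually.of_forall hb)
    exact (hF.comp (by fun_prop)).aestronglyMeasurable
  rw [← map_pi_eq_stdGaussian] at h1
  exact (integrable_map_measure (hF.comp (by fun_prop)).aestronglyMeasurable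
    (by fun_prop)).1 h1

lemma abs_sum_mul_le_norm (a : ι → ℝ) (x : EuclideanSpace ℝ ι) :
    |∑ i, a i * x i| ≤ (∑ i, |a i|) * ‖x‖ := by
  rw [Finset.sum_mul]
  refine (Finset.abs_sum_le_sum_abs _ _).trans (Finset.sum_le_sum fun i _ => ?_)
  rw [abs_mul]
  exact mul_le_mul_of_nonneg_left (PiLp.norm_apply_le x i) (abs_nonneg _)

lemma abs_prod_sum_le_norm (a : J → ι → ℝ) (s : Finset J) (x : EuclideanSpace ℝ ι) :
    |∏ j ∈ s, ∑ i, a j i * x i| ≤ (∏ j ∈ s, ∑ i, |a j i|) * ‖x‖ ^ s.card := by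
  rw [Finset.abs_prod, ← Finset.prod_const, ← Finset.prod_mul_distrib]
  exact Finset.prod_le_prod (fun _ _ => abs_nonneg _) fun j _ => abs_sum_mul_le_norm _ _

/-- Gaussian integration by parts for products of linear forms. -/
lemma integral_prod_insert_gauss (a : J → ι → ℝ) {s : Finset J} {j₀ : J} (hj : j₀ ∉ s) :
    ∫ g, ∏ j ∈ insert j₀ s, ∑ i, a j i * g i ∂gauss ι
      = ∑ j ∈ s, (∑ i, a j₀ i * a j i) * ∫ g, ∏ k ∈ s.erase j, ∑ i, a k i * g i ∂gauss ι := by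
  have hint : ∀ s : Finset J, Integrable (fun g : ι → ℝ => ∏ j ∈ s, ∑ i, a j i * g i) (gauss ι) :=
    fun s => integrable_gauss_of_le_pow (by fun_prop) (abs_prod_sum_le_norm a s)
  have hint' : ∀ i, Integrable (fun g : ι → ℝ => g i * ∏ j ∈ s, ∑ i, a j i * g i) (gauss ι) := by
    intro i
    refine integrable_gauss_of_le_pow (C := ∏ j ∈ s, ∑ i, |a j i|) (k := s.card + 1)
      (by fun_prop) fun x => ?_
    rw [abs_mul, pow_succ, ← mul_assoc, mul_comm]
    exact mul_le_mul (abs_prod_sum_le_norm a s x) (PiLp.norm_apply_le x i) (abs_nonneg _)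
      (mul_nonneg (Finset.prod_nonneg fun _ _ => Finset.sum_nonneg fun _ _ => abs_nonneg _)
        (by positivity))
  have hstep : ∀ i, ∫ g : ι → ℝ, g i * ∏ j ∈ s, ∑ i, a j i * g i ∂gauss ι
      = ∑ j ∈ s, a j i * ∫ g, ∏ k ∈ s.erase j, ∑ i, a k i * g i ∂gauss ι := by
    intro i
    have hsum : Integrable (fun g : ι → ℝ => ∑ j ∈ s, a j i *
        ∏ k ∈ s.erase j, ∑ i, a k i * g i) (gauss ι) :=
      integrable_finsetSum _ fun j _ => (hint _).const_mul _
    rw [integral_coord_mul_gauss i (fun g x => ?_) (hint s) hsum (hint' i),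
      integral_finsetSum _ fun j _ => (hint _).const_mul _]
    · simp_rw [integral_const_mul]
    · have hlin : ∀ j ∈ s, HasDerivAt (fun y => ∑ k, a j k * Function.update g i y k) (a j i) x := by
        intro j _
        have e : (fun y => ∑ k, a j k * Function.update g i y k)
            = fun y => a j i * y + ∑ k ∈ Finset.univ.erase i, a j k * g k := by
          funext y
          rw [← Finset.add_sum_erase _ _ (Finset.mem_univ i), Function.update_self]
          congr 1
          refine Finset.sum_congr rfl fun k hk => ?_
          rw [Function.update_of_ne (Finset.ne_of_mem_erase hk)]
        rw [e]
        simpa using ((hasDerivAt_id x).const_mul (a j i)).add_const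
          (∑ k ∈ Finset.univ.erase i, a j k * g k)
      refine (HasDerivAt.fun_finsetProd hlin).congr_deriv (Finset.sum_congr rfl fun j _ => ?_)
      rw [smul_eq_mul, mul_comm]
  have e : ∀ g : ι → ℝ, ∏ j ∈ insert j₀ s, ∑ i, a j i * g i
      = ∑ i, a j₀ i * (g i * ∏ j ∈ s, ∑ i, a j i * g i) := by
    intro g
    rw [Finset.prod_insert hj, Finset.sum_mul]
    exact Finset.sum_congr rfl fun i _ => by ring
  simp_rw [e]
  rw [integral_finsetSum _ fun i _ => (hint' i).const_mul _]
  simp_rw [integral_const_mul, hstep, Finset.mul_sum, Finset.sum_mul]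
  rw [Finset.sum_comm]
  refine Finset.sum_congr rfl fun j _ => Finset.sum_congr rfl fun i _ => ?_
  ring

open scoped MatrixOrder in
/-- The recursion for the moments of a centered Gaussian vector. -/
lemma integral_prod_insert_multivariateGaussian {C : Matrix ι ι ℝ} (hC : C.PosSemidef) (X : J → ι)
    {s : Finset J} {j₀ : J} (hj : j₀ ∉ s) :
    ∫ x : EuclideanSpace ℝ ι, ∏ j ∈ insert j₀ s, x (X j) ∂multivariateGaussian 0 C
      = ∑ j ∈ s, C (X j₀) (X j) *
        ∫ x : EuclideanSpace ℝ ι, ∏ k ∈ s.erase j, x (X k) ∂multivariateGaussian 0 C := by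
  set R := CFC.sqrt C with hR
  have hmom : ∀ s : Finset J, ∫ x : EuclideanSpace ℝ ι, ∏ j ∈ s, x (X j) ∂multivariateGaussian 0 C
      = ∫ g, ∏ j ∈ s, ∑ i, R (X j) i * g i ∂gauss ι := by
    intro s
    rw [multivariateGaussian, integral_map (by fun_prop) (by fun_prop), ← map_pi_eq_stdGaussian,
      integral_map (by fun_prop) (by fun_prop)]
    refine integral_congr_ae (Filter.Eventually.of_forall fun g => ?_)
    refine Finset.prod_congr rfl fun j _ => ?_
    simp [Matrix.mulVec, dotProduct, hR]
  have hsq : ∀ Y Z, ∑ i, R Y i * R Z i = C Y Z := by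
    intro Y Z
    have h1 : R * R = C := CFC.sqrt_mul_sqrt_self C hC.nonneg
    have h2 : R.IsHermitian := (Matrix.nonneg_iff_posSemidef.1 (CFC.sqrt_nonneg C)).1
    rw [← h1, Matrix.mul_apply]
    refine Finset.sum_congr rfl fun i _ => ?_
    rw [show R Z i = R i Z by simpa using h2.apply i Z]
  rw [hmom, integral_prod_insert_gauss _ hj]
  simp_rw [hmom, hsq]

end Gaussian

/-! ### Comparison with the Gaussian moments -/

section Comparison

variable {P : Params} {p q : ℝ} {n : ℕ}

lemma covMatrix_isHermitian (N : ℕ) : (covMatrix P p q N n).IsHermitian := by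
  refine Matrix.IsHermitian.ext fun X Y => ?_
  rw [star_trivial]
  cases X <;> cases Y <;> simp [covMatrix, eq_comm]

/-- The two-element family of basis variables used for the second moments. -/
def basisPair (X Y : BasisIndex n) (b : Bool) : BasisIndex n := if b then X else Y

/-- The matrix of second moments of the basis variables is positive semidefinite. -/
lemma sum_mul_basisMom_nonneg (v : BasisIndex n → ℝ) (N : ℕ) :
    0 ≤ ∑ X, ∑ Y, v X * v Y * basisMom P p q (basisPair X Y) Finset.univ N := by
  unfold basisMom nuK
  simp_rw [← gnu_const_mul, ← gnu_sum]
  unfold gnu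
  refine integral_nonneg fun g => ?_
  simp only [Pi.zero_apply, ravg_sum, ravg_const_mul]
  have e : ∀ X Y : BasisIndex n, ravg (linH (coupC P N) (fieldD P N) g)
      (fun σ : RepIndex n Bool → Config P.S N =>
        prodOv p q (basisForms (basisPair X Y)) Finset.univ σ)
      = ravg (hamiltonian P g) fun σ : Fin n → Config P.S N =>
        basisVar P p q g σ X * basisVar P p q g σ Y := by
    intro X Y
    rw [← hamiltonian_eq, ← gibbsAvg_prod_basisVar (basisPair X Y) Finset.univ g]
    simp [basisPair]
  simp_rw [e, ← ravg_const_mul, ← ravg_sum]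
  unfold ravg
  refine Finset.sum_nonneg fun σ _ => mul_nonneg ?_ (prod_boltz_nonneg _ _)
  have : ∑ X, ∑ Y, v X * v Y * (basisVar P p q g σ X * basisVar P p q g σ Y)
      = (∑ X, v X * basisVar P p q g σ X) * ∑ Y, v Y * basisVar P p q g σ Y := by
    rw [Finset.sum_mul_sum]
    refine Finset.sum_congr rfl fun X _ => Finset.sum_congr rfl fun Y _ => ?_
    ring
  beta_reduce
  rw [this]
  exact mul_self_nonneg _

/-- For `N = 1` the covariances are limits of rescaled second moments, and in general they are
multiples of those. -/
lemma HighTemp.covMatrix_posSemidef (h : HighTemp P p q) (hM : Solvable P p q) (N : ℕ) :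
    (covMatrix P p q N n).PosSemidef := by
  have hone : (covMatrix P p q 1 n).PosSemidef := by
    refine Matrix.PosSemidef.of_dotProduct_mulVec_nonneg (covMatrix_isHermitian 1) fun v => ?_
    set Q := star v ⬝ᵥ (covMatrix P p q 1 n).mulVec v with hQ
    have hQ' : Q = ∑ X, ∑ Y, v X * v Y * covMatrix P p q 1 n X Y := by
      simp only [hQ, dotProduct, Matrix.mulVec, Finset.mul_sum, star_trivial]
      exact Finset.sum_congr rfl fun X _ => Finset.sum_congr rfl fun Y _ => by ring
    have hdiff : (fun N => ∑ X, ∑ Y, v X * v Y * (basisMom P p q (basisPair X Y) Finset.univ N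
        - covMatrix P p q N n X Y)) ∈ negl 3 := by
      have : (∑ X, ∑ Y, (v X * v Y) • fun N => basisMom P p q (basisPair X Y) Finset.univ N
          - covMatrix P p q N n X Y) ∈ negl 3 := by
        refine Submodule.sum_mem _ fun X _ => Submodule.sum_mem _ fun Y _ =>
          Submodule.smul_mem _ _ ?_
        have := h.basisMom_insert hM (basisPair X Y) (s := {false}) (i := true) (by simp)
        have e : ∀ N, ∑ j ∈ {false}, covMatrix P p q N n (basisPair X Y true) (basisPair X Y j) *
            basisMom P p q (basisPair X Y) (({false} : Finset Bool).erase j) N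
            = covMatrix P p q N n X Y := fun N => by
          rw [Finset.sum_singleton, show ({false} : Finset Bool).erase false = ∅ from rfl,
            basisMom_empty, mul_one]
          rfl
        rw [Finset.card_singleton, show insert true ({false} : Finset Bool) = Finset.univ from rfl]
          at this
        simpa only [e] using this
      convert this using 1
      funext N
      simp only [Finset.sum_apply, Pi.smul_apply, smul_eq_mul]
    obtain ⟨C, hC⟩ := mem_negl.1 hdiff
    have hlow : ∀ N : ℕ, 1 ≤ N → -(C * (1 / Real.sqrt N)) ≤ Q := by
      intro N hN
      have hN0 : (0 : ℝ) < N := by exact_mod_cast hN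
      have h1 := (abs_le.1 (hC N hN)).2
      have h2 := sum_mul_basisMom_nonneg (P := P) (p := p) (q := q) v N
      simp only [mul_sub, Finset.sum_sub_distrib] at h1
      have h3 : ∑ X, ∑ Y, v X * v Y * covMatrix P p q N n X Y = (1 / Real.sqrt N) ^ 2 * Q := by
        rw [hQ', covMatrix_eq_smul, ← one_div_eq_sq]
        simp only [Finset.mul_sum, Matrix.smul_apply, smul_eq_mul]
        exact Finset.sum_congr rfl fun X _ => Finset.sum_congr rfl fun Y _ => by ring
      rw [h3] at h1
      have h4 : 0 ≤ (1 / Real.sqrt N) ^ 2 * (Q + C * (1 / Real.sqrt N)) := by nlinarith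
      have h5 : 0 < (1 / Real.sqrt N) ^ 2 := by have := one_div_sqrt_pos hN; positivity
      linarith [nonneg_of_mul_nonneg_right h4 h5]
    have hlim : Filter.Tendsto (fun N : ℕ => -(C * (1 / Real.sqrt N))) Filter.atTop (nhds 0) := by
      have : Filter.Tendsto (fun N : ℕ => 1 / Real.sqrt N) Filter.atTop (nhds 0) := by
        simp only [one_div]
        exact tendsto_inv_atTop_zero.comp
          (Real.tendsto_sqrt_atTop.comp tendsto_natCast_atTop_atTop)
      simpa using (this.const_mul C).neg
    exact le_of_tendsto hlim (Filter.eventually_atTop.2 ⟨1, hlow⟩)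
  rw [covMatrix_eq_smul]
  exact hone.smul (by positivity)

variable {J : Type*} [Fintype J] [DecidableEq J]

lemma negl_one_div_mul {m : ℕ} {f : ℕ → ℝ} (hf : f ∈ negl m) :
    (fun N : ℕ => 1 / (N : ℝ) * f N) ∈ negl (m + 2) := by
  obtain ⟨C, hC⟩ := hf
  refine ⟨C, fun N hN => ?_⟩
  rw [abs_mul, abs_of_nonneg (by positivity), one_div_eq_sq, pow_add, ← mul_assoc, mul_comm]
  exact mul_le_mul_of_nonneg_right (hC N hN) (by positivity)

/-- The moments of the basis variables agree with those of the Gaussian vector up to higher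
order. -/
lemma HighTemp.basisMom_sub_integral (h : HighTemp P p q) (hM : Solvable P p q)
    (X : J → BasisIndex n) (s : Finset J) :
    (fun N => basisMom P p q X s N - ∫ x : EuclideanSpace ℝ (BasisIndex n), ∏ j ∈ s, x (X j)
      ∂multivariateGaussian 0 (covMatrix P p q N n)) ∈ negl (s.card + 1) := by
  induction s using Finset.strongInduction with
  | H s ih =>
    rcases s.eq_empty_or_nonempty with rfl | ⟨i, hi⟩
    · refine ⟨0, fun N _ => ?_⟩
      simp [basisMom_empty]
    · have hi' := Finset.notMem_erase i s
      have hs : insert i (s.erase i) = s := Finset.insert_erase hi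
      have h1 := h.basisMom_insert hM X hi'
      have h2 : (∑ j ∈ s.erase i, covMatrix P p q 1 n (X i) (X j) • fun N : ℕ => 1 / (N : ℝ) *
          (basisMom P p q X ((s.erase i).erase j) N
            - ∫ x : EuclideanSpace ℝ (BasisIndex n), ∏ j ∈ (s.erase i).erase j, x (X j)
              ∂multivariateGaussian 0 (covMatrix P p q N n))) ∈ negl ((s.erase i).card + 2) := by
        refine Submodule.sum_mem _ fun j hj => Submodule.smul_mem _ _ ?_
        have := negl_one_div_mul (ih ((s.erase i).erase j)
          ((Finset.erase_ssubset hj).trans (Finset.erase_ssubset hi)))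
        rwa [Finset.card_erase_add_one hj] at this
      -- the difference of the two recursions: the error in the first one, plus the error of the
      -- lower moments multiplied by covariances of order `1 / N`
      have h3 := Submodule.add_mem _ h1 h2
      rw [← hs, Finset.card_insert_of_notMem hi']
      convert h3 using 1
      funext N
      rw [integral_prod_insert_multivariateGaussian (h.covMatrix_posSemidef hM N) X hi']
      simp only [Pi.add_apply, Finset.sum_apply, Pi.smul_apply, smul_eq_mul, mul_sub,
        Finset.sum_sub_distrib]
      have e : ∀ j, covMatrix P p q N n (X i) (X j)
          = 1 / (N : ℝ) * covMatrix P p q 1 n (X i) (X j) := fun j => by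
        rw [covMatrix_eq_smul, Matrix.smul_apply, smul_eq_mul]
      have e1 : ∀ (y : J → ℝ), ∑ j ∈ s.erase i, covMatrix P p q N n (X i) (X j) * y j
          = ∑ j ∈ s.erase i, covMatrix P p q 1 n (X i) (X j) * (1 / (N : ℝ) * y j) := fun y =>
        Finset.sum_congr rfl fun j _ => by rw [e]; ring
      rw [e1, e1]
      ring

end Comparison

/-! ### The high-temperature regime -/

section HighTemperature

variable {P : Params} {p q : ℝ}

lemma abs_nuZero_le {m : ℕ} {f : (Fin m → ℝ) → ℝ} {B : ℝ}
    (hf : ∀ ε : Fin m → Spin P.S, |f fun k => (ε k).val| ≤ B) : |nuZero P p q f| ≤ B := by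
  rw [nuZero_eq]
  exact (abs_gnu_le_gnu _ _ (g := fun _ => B) hf).trans (gnu_const _ _ _).le

lemma abs_sub_mul_le {a b c B : ℝ} (ha : |a| ≤ B) (hb : |b| ≤ B) (hc : |c| ≤ B) :
    |(a - b) * c| ≤ 2 * B ^ 2 := by
  have hB : 0 ≤ B := (abs_nonneg a).trans ha
  rw [abs_mul, sq, ← mul_assoc]
  exact mul_le_mul ((abs_sub _ _).trans (by linarith)) hc (abs_nonneg _) (by positivity)

lemma solvable_of_small (hβ : 8 * (P.β ^ 2 * (P.S : ℝ) ^ 4) < 1) : Solvable P p q := by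
  have hv : ∀ x y : Spin P.S, |x.val * y.val| ≤ (P.S : ℝ) ^ 2 := abs_val_mul_val_le
  have hv2 : ∀ x : Spin P.S, |x.val ^ 2| ≤ (P.S : ℝ) ^ 2 := fun x => by rw [sq x.val]; exact hv x x
  have hS4 : 2 * ((P.S : ℝ) ^ 2) ^ 2 = 2 * (P.S : ℝ) ^ 4 := by ring
  have hD : |cD P p q| ≤ 2 * (P.S : ℝ) ^ 4 := hS4 ▸ abs_nuZero_le fun ε =>
    abs_sub_mul_le (hv2 _) (hv2 _) (hv2 _)
  have hF : |cF P p q| ≤ 2 * (P.S : ℝ) ^ 4 := hS4 ▸ abs_nuZero_le fun ε =>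
    abs_sub_mul_le (hv _ _) (hv _ _) (hv _ _)
  have hG : |cG P p q| ≤ 2 * (P.S : ℝ) ^ 4 := hS4 ▸ abs_nuZero_le fun ε =>
    abs_sub_mul_le (hv _ _) (hv _ _) (hv _ _)
  rw [abs_le] at hD hF hG
  have hb : 0 ≤ P.β ^ 2 := sq_nonneg _
  have h1 : 0 < cM1 P p q := by unfold cM1; nlinarith
  have h2 : 0 < cM2 P p q := by unfold cM2; nlinarith
  refine ⟨by unfold cM3; nlinarith, ?_⟩
  unfold cM
  have := mul_pos h1 h2
  positivity

/-- An inverse temperature below which all the estimates are available. The most demanding one is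
the bound `12 * β ^ 2 * wbar (Fin 2) ≤ 1 / (32 * S ^ 4)` in `HighTemp`, as `12 * 32 ≤ 400`; the
summand `1` makes the bound on `β ^ 2 * S ^ 4` in `solvable_of_small` follow as well. -/
noncomputable def betaZero (S : ℕ) : ℝ := Real.sqrt (1 / (400 * (S : ℝ) ^ 4 * (wbar (Fin 2) + 1)))

lemma betaZero_pos {S : ℕ} (hS : 1 ≤ S) : 0 < betaZero S := by
  have hS0 : (0 : ℝ) < S := by exact_mod_cast hS
  have := wbar_nonneg (Fin 2)
  exact Real.sqrt_pos.2 (by positivity)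

lemma sq_mul_lt_of_lt_betaZero (hS : 1 ≤ P.S) (h0 : 0 ≤ P.β) (hβ : P.β < betaZero P.S) :
    400 * (P.β ^ 2 * (P.S : ℝ) ^ 4 * (wbar (Fin 2) + 1)) < 1 := by
  have hS0 : (0 : ℝ) < P.S := by exact_mod_cast hS
  have hw := wbar_nonneg (Fin 2)
  have := (Real.lt_sqrt h0).1 hβ
  rw [lt_div_iff₀ (by positivity)] at this
  linarith

lemma exists_highTemp (hS : 1 ≤ P.S) (h0 : 0 ≤ P.β) (hβ : P.β < betaZero P.S) :
    ∃ p q : ℝ, HighTemp P p q ∧ Solvable P p q ∧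
      ∀ p' q' : ℝ, IsReplicaSymmetric P p' q' → p' = p ∧ q' = q := by
  have hS0 : (0 : ℝ) < P.S := by exact_mod_cast hS
  have hw := wbar_nonneg (Fin 2)
  have hb := sq_mul_lt_of_lt_betaZero hS h0 hβ
  have hx : 0 ≤ P.β ^ 2 * (P.S : ℝ) ^ 4 := by positivity
  have hxw : 0 ≤ P.β ^ 2 * (P.S : ℝ) ^ 4 * wbar (Fin 2) := by positivity
  obtain ⟨p, q, hpq, huniq⟩ := exists_unique_isReplicaSymmetric P (by
    change (P.S : ℝ) ^ 2 * (wbar (Fin 2) * (3 * P.β ^ 2 * (P.S : ℝ) ^ 2)) < 1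
    nlinarith)
  refine ⟨p, q, ⟨hS, hpq, ?_⟩, solvable_of_small (by nlinarith), huniq⟩
  rw [le_div_iff₀ (by positivity)]
  nlinarith

end HighTemperature

lemma one_div_sqrt_pow_eq_rpow (N k : ℕ) :
    (1 / Real.sqrt N) ^ (k + 1) = (N : ℝ) ^ (-((k : ℝ) + 1) / 2) := by
  have hN0 : (0 : ℝ) ≤ N := Nat.cast_nonneg N
  rw [one_div, Real.sqrt_eq_rpow, ← Real.rpow_neg hN0, ← Real.rpow_natCast, ← Real.rpow_mul hN0]
  congr 1
  push_cast
  ring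

end GhatakSherrington

theorem mainTheorem2 (S : ℕ) (hS : 1 ≤ S) :
    ∃ β₀ : ℝ, 0 < β₀ ∧ ∀ P : GhatakSherrington.Params,
      P.S = S → 0 ≤ P.β → P.β < β₀ → 0 ≤ P.h →
      ∃ p q : ℝ, GhatakSherrington.IsReplicaSymmetric P p q ∧
        (∀ p' q' : ℝ, GhatakSherrington.IsReplicaSymmetric P p' q' → p' = p ∧ q' = q) ∧
        0 < GhatakSherrington.cM3 P p q ∧ 0 < GhatakSherrington.cM P p q ∧
        ∀ n : ℕ,
          (∀ N : ℕ, 1 ≤ N → (GhatakSherrington.covMatrix P p q N n).PosSemidef) ∧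
          ∀ a : GhatakSherrington.BasisIndex n → ℕ, ∃ K : ℝ, ∀ N : ℕ, 1 ≤ N →
            |GhatakSherrington.nu P (fun (g : GhatakSherrington.Disorder N)
                  (σ : Fin n → GhatakSherrington.Config P.S N) =>
                ∏ X, GhatakSherrington.basisVar P p q g σ X ^ a X)
              - ∫ x : EuclideanSpace ℝ (GhatakSherrington.BasisIndex n), ∏ X, x X ^ a X
                  ∂(multivariateGaussian 0 (GhatakSherrington.covMatrix P p q N n))|
            ≤ K * (N : ℝ) ^ (-(((∑ X, a X : ℕ) : ℝ) + 1) / 2) := by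
  refine ⟨GhatakSherrington.betaZero S, GhatakSherrington.betaZero_pos hS, ?_⟩
  rintro P rfl h0 hβ -
  obtain ⟨p, q, hT, hM, huniq⟩ := GhatakSherrington.exists_highTemp hS h0 hβ
  refine ⟨p, q, hT.isReplicaSymmetric, huniq, hM.cM3_pos, hM.cM_pos, fun n =>
    ⟨fun N _ => hT.covMatrix_posSemidef hM N, fun a => ?_⟩⟩
  -- the monomial as a product over a family in which `X` occurs `a X` times
  obtain ⟨K, hK⟩ := GhatakSherrington.mem_negl.1 (hT.basisMom_sub_integral hM
    (J := Σ X : GhatakSherrington.BasisIndex n, Fin (a X)) Sigma.fst Finset.univ)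
  refine ⟨K, fun N hN => ?_⟩
  have hprod : ∀ y : GhatakSherrington.BasisIndex n → ℝ,
      ∏ X, y X ^ a X = ∏ j : (Σ X : GhatakSherrington.BasisIndex n, Fin (a X)), y j.1 := by
    intro y
    rw [Fintype.prod_sigma]
    simp
  have h := hK N hN
  have hcard : (Finset.univ : Finset (Σ X : GhatakSherrington.BasisIndex n, Fin (a X))).card
      = ∑ X, a X := by simp
  rw [hcard, GhatakSherrington.one_div_sqrt_pow_eq_rpow, GhatakSherrington.basisMom,
    ← GhatakSherrington.nu_prod_basisVar] at h
  simp_rw [hprod]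
  exact h
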